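/- Let $\mathcal T\subset\mathbb R^2$ be the open triangle with vertices $(0,0)$, $(1/\sqrt3,0)$, $(0,1)$. Let $\alpha\in(0,1/(3+\sqrt3)]$ and put $r_\alpha:=1-\alpha(3+\sqrt3)$, $$S_\alpha:=\mathcal T\setminus \overline{\,r_\alpha\mathcal T+(\alpha,\alpha)\,},\qquad t_\alpha:=\inf_{k\in\mathbb N,\,k\ge1}\int_0^\alpha\sin^2\Big(\frac{\pi kx}{\sqrt3}\Big)\,dx,\qquad T_\alpha:=\sqrt{\frac{40}{\sqrt3\,t_\alpha}}.$$ Let $T>T_\alpha$ and $$c_\alpha:=\frac T\pi\Big(\frac{t_\alpha}{\sqrt3}-\frac{40}{3T^2}\Big).$$ Then $c_\alpha>0$, and for all $u_0\in L^2(\mathcal T)$ and $u_1\in H^{-1}(\mathcal T)$ (real-valued) the weak solution $u\in C(\mathbb R;L^2(\mathcal T))\cap C^1(\mathbb R;H^{-1}(\mathcal T))$ of $$u_{tt}-\Delta u=0\ \text{ in }\mathbb R\times\mathcal T,\qquad u=0\ \text{ on }\mathbb R\times\partial\mathcal T,\qquad u(0,\cdot)=u_0,\quad u_t(0,\cdot)=u_1\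 \text{ in }\mathcal T$$ (the equation and the boundary condition being understood by testing against the domain of the Dirichlet Laplacian of $\mathcal T$) satisfies $$\|u_0\|_{0}^2+\|u_1\|_{-1}^2\le\frac1{c_\alpha}\int_0^T\int_{S_\alpha}|u(t,x)|^2\,dx\,dt.$$ Here $\|\cdot\|_0$ is the norm of $L^2(\mathcal T)$ and $\|\cdot\|_{-1}$ is the norm of $H^{-1}(\mathcal T)$ dual to $\|\nabla\varphi\|_{L^2}$ on $H^1_0(\mathcal T)$; equivalently, $\|u_1\|_{-1}^2=\sum_k\gamma_k^{-1}|\langle u_1,e_k\rangle|^2$ for any orthonormal basis $(e_k)$ of $L^2(\mathcal T)$ formed by eigenfunctions of $-\Delta$ in $H^1_0(\mathcal T)$, with eigenvalues $\gamma_k$. -/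

import Mathlib

open MeasureTheory

noncomputable section

/-- The Euclidean plane. -/
abbrev Plane : Type := EuclideanSpace ℝ (Fin 2)

/-! ### Function spaces on an open set of the plane -/

/-- The real Hilbert space `L²(Ω)`. -/
abbrev L2 (Ω : Set Plane) : Type := Lp ℝ 2 (volume.restrict Ω)

/-- The real Hilbert space `L²(Ω; ℝ²)`. -/
abbrev L2Vec (Ω : Set Plane) : Type := Lp Plane 2 (volume.restrict Ω)

/-- The pairs `(φ, ∇φ)` with `φ` a smooth function with compact support in `Ω`,
as elements of `L²(Ω) × L²(Ω; ℝ²)`. -/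
def testPairs (Ω : Set Plane) : Set (L2 Ω × L2Vec Ω) :=
  {p | ∃ φ : Plane → ℝ, ContDiff ℝ (⊤ : ℕ∞) φ ∧ HasCompactSupport φ ∧ tsupport φ ⊆ Ω ∧
    p.1 =ᵐ[volume.restrict Ω] φ ∧ p.2 =ᵐ[volume.restrict Ω] gradient φ}

/-- `H¹₀(Ω)`, the closure of the smooth functions with compact support in `Ω` for the `H¹` norm.
An element `f` is represented by the pair `(f, ∇f)`. (The set `testPairs Ω` is already a linear
subspace; `Submodule.span` only records this.) -/
def H10 (Ω : Set Plane) : Submodule ℝ (L2 Ω × L2Vec Ω) :=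
  (Submodule.span ℝ (testPairs Ω)).topologicalClosure

/-- The underlying `L²` function of an element of `H¹₀(Ω)`. -/
def H10.toL2 {Ω : Set Plane} (f : H10 Ω) : L2 Ω := (f : L2 Ω × L2Vec Ω).1

/-- The gradient of an element of `H¹₀(Ω)`. -/
def H10.grad {Ω : Set Plane} (f : H10 Ω) : L2Vec Ω := (f : L2 Ω × L2Vec Ω).2

/-- `H⁻¹(Ω)`, the topological dual of `H¹₀(Ω)`. -/
abbrev Hneg1 (Ω : Set Plane) : Type := H10 Ω →L[ℝ] ℝ

/-- The norm of `H⁻¹(Ω)` dual to the norm `‖∇f‖` on `H¹₀(Ω)`: the least `C ≥ 0` with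
`|F f| ≤ C ‖∇f‖` for all `f`. If `(e_k)` is an orthonormal basis of `L²(Ω)` of Dirichlet
eigenfunctions of `-Δ` with eigenvalues `γ_k`, it equals `(∑ γ_k⁻¹ |F e_k|²)^(1/2)`. -/
def Hneg1.dualNorm {Ω : Set Plane} (F : Hneg1 Ω) : ℝ :=
  sInf {C : ℝ | 0 ≤ C ∧ ∀ f : H10 Ω, |F f| ≤ C * ‖H10.grad f‖}

/-! ### The wave equation with Dirichlet boundary condition -/

/-- `φ ∈ H¹₀(Ω)` belongs to the domain of the Dirichlet Laplacian, and `Δφ = g ∈ L²(Ω)`. -/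
def HasDirichletLaplacian {Ω : Set Plane} (φ : H10 Ω) (g : L2 Ω) : Prop :=
  ∀ ψ : H10 Ω, inner ℝ (H10.grad φ) (H10.grad ψ) = -inner ℝ g (H10.toL2 ψ)

/-- `u` is the (weak) solution of `u_tt - Δu = 0` in `ℝ × Ω`, `u = 0` on `ℝ × ∂Ω`, `u(0) = u₀`,
`u_t(0) = u₁`, for data `u₀ ∈ L²(Ω)` and `u₁ ∈ H⁻¹(Ω)`: one has
`u ∈ C(ℝ; L²(Ω)) ∩ C¹(ℝ; H⁻¹(Ω))`, with time derivative `v`, and the equation together with the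
boundary condition holds in the sense of transposition, i.e. tested against the domain of the
Dirichlet Laplacian. -/
def IsWaveSolution {Ω : Set Plane} (u₀ : L2 Ω) (u₁ : Hneg1 Ω) (u : ℝ → L2 Ω) : Prop :=
  Continuous u ∧ u 0 = u₀ ∧
  ∃ v : ℝ → Hneg1 Ω, Continuous v ∧ v 0 = u₁ ∧
    (∀ (φ : H10 Ω) (t : ℝ), HasDerivAt (fun s => inner ℝ (u s) (H10.toL2 φ)) (v t φ) t) ∧
    (∀ (φ : H10 Ω) (g : L2 Ω), HasDirichletLaplacian φ g →
      ∀ t : ℝ, HasDerivAt (fun s => v s φ) (inner ℝ (u t) g) t)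

/-! ### The triangle and the observation region -/

/-- The open triangle with vertices `(0,0)`, `(1/√3,0)` and `(0,1)`. -/
def triangle : Set Plane := {x | 0 < x 0 ∧ 0 < x 1 ∧ √3 * x 0 + x 1 < 1}

/-- The ratio `r_α = 1 - α (3 + √3)`. -/
def ratio (α : ℝ) : ℝ := 1 - α * (3 + √3)

/-- `S_α`: the triangle minus the closure of its copy scaled by `r_α` and translated
by `(α, α)`. -/
def stripRegion (α : ℝ) : Set Plane :=
  triangle \ closure ((fun x : Plane => ratio α • x + !₂[α, α]) '' triangle)

/-- `t_α = inf_{k ≥ 1} ∫₀^α sin²(π k x / √3) dx`. -/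
def tInf (α : ℝ) : ℝ :=
  ⨅ k : ℕ+, ∫ x in (0 : ℝ)..α, Real.sin (Real.pi * (k : ℝ) * x / √3) ^ 2

/-- The observation time `T_α = √(40 / (√3 t_α))`. -/
def obsTime (α : ℝ) : ℝ := √(40 / (√3 * tInf α))

/-- The constant `c_α = (T / π) (t_α / √3 - 40 / (3 T²))`. -/
def obsConst (α T : ℝ) : ℝ := T / Real.pi * (tInf α / √3 - 40 / (3 * T ^ 2))

end

/-!
The modes `trigMode m q`, alternating sums of products of sines over the reflection group of type
`G₂`, are eigenfunctions of the Dirichlet Laplacian of the triangle. Those with `0 < m < q` form an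
orthogonal basis of `L²`: orthogonality comes from tiling the rectangle `(0, √3) × (0, 1)` by six
copies of the triangle (`setIntegral_rect_eq`, `integral_mode_mul_mode`). For completeness, the
span of all modes is stable under multiplication by two invariant trigonometric polynomials which
separate the points of the closed triangle, so that by the Stone-Weierstrass theorem a function
orthogonal to all modes is annihilated by the lowest mode, which has no zero in the triangle
(`ae_eq_zero_of_forall_integral_mode`). The modes lie in `H¹₀` by a cutoff argument
(`mem_H10_of_side`).

Testing the equation against the normalized modes shows that every Fourier coefficient of a
solution is a vibration `A cos ωt + B sin ωt` (`IsWaveSolution.inner_eigL2`). For a finite sum `U`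
of modes the vertical strip `(0, α) × (0, 1)` meets three tiles only, and it is folded into the
strip region, whence `∫_{strip} U² ≤ 3 ∫_{S_α} U²` (`setIntegral_strip_le`). On the strip, `U` is a
sum of products `sin (π k x / √3) sin (π μ y)` with `k = μ + 2 l`. Integration in `y` decouples the
rows `μ = const`, and on each row an Ingham inequality with the weight `sin (π t / T)` applies to
the frequencies `π √(k² / 3 + μ²)` with `μ < l`, which have a uniform gap; the remaining waves of
the row form a nonnegative quadratic form up to a small error (`ingham_rows`). Every mode has a
wave `(μ, l) = (m, q)` with `μ < l`, and integrating its factor `sin² (π k x / √3)` over `(0, α)`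
produces `tInf α` (`observability_finite`).

A limit over finite sets of modes gives the inequality for the Fourier coefficients of arbitrary
data (`observability_coeff`). They are turned into norms by Parseval's identity in `L²` and by its
counterpart in `H⁻¹` (`dualNorm_sq_le`), which rests on the convergence of the eigenfunction
expansion in `H¹₀` for functions in the domain of the Dirichlet Laplacian.
-/

/-! ### An Ingham type inequality on rows of frequencies -/

open Real in
theorem hasDerivAt_osc (p q w t : ℝ) :
    HasDerivAt (fun t : ℝ => p * cos (w * t) + q * sin (w * t))
      (w * (q * cos (w * t) - p * sin (w * t))) t := by
  have h : HasDerivAt (fun t : ℝ => w * t) w t := by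
    simpa using (hasDerivAt_id t).const_mul w
  have h1 := (h.cos.const_mul p).add (h.sin.const_mul q)
  refine h1.congr_deriv ?_
  ring

open Real in
theorem integral_sin_mul_osc {T w : ℝ} (hT : 0 < T) (hw : (π / T) ^ 2 ≠ w ^ 2) (p q : ℝ) :
    ∫ t in (0 : ℝ)..T, sin (π * t / T) * (p * cos (w * t) + q * sin (w * t)) =
      π / T * (p * cos (w * T) + q * sin (w * T) + p) / ((π / T) ^ 2 - w ^ 2) := by
  have hne : (π / T) ^ 2 - w ^ 2 ≠ 0 := sub_ne_zero.2 hw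
  set F : ℝ → ℝ := fun t => (sin (π / T * t) * (w * (q * cos (w * t) - p * sin (w * t))) -
    π / T * cos (π / T * t) * (p * cos (w * t) + q * sin (w * t))) / ((π / T) ^ 2 - w ^ 2) with hF
  have hd : ∀ t, HasDerivAt F (sin (π * t / T) * (p * cos (w * t) + q * sin (w * t))) t := by
    intro t
    have h : HasDerivAt (fun t : ℝ => π / T * t) (π / T) t := by
      simpa using (hasDerivAt_id t).const_mul (π / T)
    have hg := hasDerivAt_osc p q w t
    have hg' : HasDerivAt (fun t : ℝ => w * (q * cos (w * t) - p * sin (w * t)))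
        (w * (w * (-p * cos (w * t) - q * sin (w * t)))) t := by
      have := (hasDerivAt_osc q (-p) w t).const_mul w
      simpa only [neg_mul, ← sub_eq_add_neg] using this
    have h1 := ((h.sin.mul hg').sub ((h.cos.const_mul (π / T)).mul hg)).div_const
      ((π / T) ^ 2 - w ^ 2)
    refine h1.congr_deriv ?_
    rw [div_eq_iff hne, show π * t / T = π / T * t by ring]
    ring
  rw [intervalIntegral.integral_eq_sub_of_hasDerivAt (fun t _ => hd t)
    (Continuous.intervalIntegrable (by fun_prop) _ _)]
  have : π / T * T = π := by field_simp
  simp only [hF, this, sin_pi, cos_pi, mul_zero, sin_zero, cos_zero]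
  ring

open Real in
theorem abs_osc_le {p q r : ℝ} (hr : 0 ≤ r) (h : p ^ 2 + q ^ 2 ≤ r ^ 2) (s : ℝ) :
    |p * cos s + q * sin s| ≤ r := by
  apply abs_le_of_sq_le_sq _ hr
  nlinarith [sin_sq_add_cos_sq s, sq_nonneg (p * sin s - q * cos s)]

open Real in
/-- Decay of the Fourier transform of the weight `sin (π t / T)` on `[0, T]`. -/
theorem abs_integral_sin_mul_osc_le {T w n p q r : ℝ} (hT : 0 < T) (hT' : 100 ≤ T ^ 2)
    (hn : 1 ≤ n) (hw : 2 * π / 3 * n ≤ |w|) (hr : 0 ≤ r) (h : p ^ 2 + q ^ 2 ≤ r ^ 2) :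
    |∫ t in (0 : ℝ)..T, sin (π * t / T) * (p * cos (w * t) + q * sin (w * t))| ≤
      r * (14 / 3 / (π * T * n ^ 2)) := by
  have hπ := pi_pos
  have h1 : (2 * π / 3 * n) ^ 2 ≤ w ^ 2 := by
    rw [← sq_abs w]; exact pow_le_pow_left₀ (by positivity) hw 2
  have h2 : (π / T) ^ 2 ≤ π ^ 2 * n ^ 2 / 100 := by
    rw [div_pow, div_le_div_iff₀ (by positivity) (by norm_num)]
    have : (1 : ℝ) ≤ n ^ 2 := one_le_pow₀ hn
    have : 1 * 100 ≤ n ^ 2 * T ^ 2 := by gcongr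
    nlinarith [sq_nonneg π]
  have h3 : 3 / 7 * (π ^ 2 * n ^ 2) ≤ w ^ 2 - (π / T) ^ 2 := by
    have : 0 ≤ π ^ 2 * n ^ 2 := by positivity
    nlinarith
  have h4 : 0 < w ^ 2 - (π / T) ^ 2 := lt_of_lt_of_le (by positivity) h3
  rw [integral_sin_mul_osc hT (by linarith : (π / T) ^ 2 < w ^ 2).ne, abs_div, abs_mul, abs_sub_comm,
    abs_of_pos h4, abs_of_pos (show 0 < π / T by positivity)]
  have h5 : |p * cos (w * T) + q * sin (w * T) + p| ≤ 2 * r := by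
    have ha := abs_osc_le hr h (w * T)
    have hb := abs_osc_le hr h 0
    simp only [cos_zero, sin_zero, mul_one, mul_zero, add_zero] at hb
    exact (abs_add_le _ _).trans (by linarith)
  calc π / T * |p * cos (w * T) + q * sin (w * T) + p| / (w ^ 2 - (π / T) ^ 2)
      ≤ π / T * (2 * r) / (3 / 7 * (π ^ 2 * n ^ 2)) := by gcongr
    _ = r * (14 / 3 / (π * T * n ^ 2)) := by field_simp; ring

open Real in
theorem intervalIntegrable_sin_mul {T : ℝ} {f : ℝ → ℝ} (hf : Continuous f) :
    IntervalIntegrable (fun t => sin (π * t / T) * f t) volume 0 T :=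
  Continuous.intervalIntegrable (by fun_prop) _ _

open Real in
/-- The interaction of two vibrations decays like the inverse square of their frequency gap. -/
theorem abs_integral_sin_mul_osc_mul_osc_le {T w w' n A B A' B' r r' : ℝ} (hT : 0 < T)
    (hT' : 100 ≤ T ^ 2) (hn : 1 ≤ n) (hw : 2 * π / 3 * n ≤ |w - w'|)
    (hw' : 2 * π / 3 * n ≤ w + w') (hr : 0 ≤ r) (hr' : 0 ≤ r') (h : A ^ 2 + B ^ 2 = r ^ 2)
    (h' : A' ^ 2 + B' ^ 2 = r' ^ 2) :
    |∫ t in (0 : ℝ)..T, sin (π * t / T) *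
      ((A * cos (w * t) + B * sin (w * t)) * (A' * cos (w' * t) + B' * sin (w' * t)))| ≤
      r * r' * (14 / 3 / (π * T * n ^ 2)) := by
  have e : ∀ t, sin (π * t / T) *
      ((A * cos (w * t) + B * sin (w * t)) * (A' * cos (w' * t) + B' * sin (w' * t))) =
      2⁻¹ * (sin (π * t / T) * ((A * A' + B * B') * cos ((w - w') * t) +
        (B * A' - A * B') * sin ((w - w') * t))) +
      2⁻¹ * (sin (π * t / T) * ((A * A' - B * B') * cos ((w + w') * t) +
        (B * A' + A * B') * sin ((w + w') * t))) := by
    intro t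
    rw [sub_mul, add_mul w, cos_sub, sin_sub, cos_add, sin_add]
    ring
  simp_rw [e]
  rw [intervalIntegral.integral_add ((intervalIntegrable_sin_mul (by fun_prop)).const_mul _)
    ((intervalIntegrable_sin_mul (by fun_prop)).const_mul _), intervalIntegral.integral_const_mul,
    intervalIntegral.integral_const_mul]
  have h1 := abs_integral_sin_mul_osc_le (p := A * A' + B * B') (q := B * A' - A * B') hT hT' hn
    hw (mul_nonneg hr hr') (by rw [mul_pow, ← h, ← h']; apply le_of_eq; ring)
  have h2 := abs_integral_sin_mul_osc_le (p := A * A' - B * B') (q := B * A' + A * B') hT hT' hn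
    (hw'.trans (le_abs_self _)) (mul_nonneg hr hr')
    (by rw [mul_pow, ← h, ← h']; apply le_of_eq; ring)
  rw [abs_le] at *
  constructor <;> linarith [h1.1, h1.2, h2.1, h2.2]

open Real in
/-- The weighted energy of a single vibration: `2 T / π` is the integral of the weight, halved
by the mean of `cos²`, and the remainder comes from the doubled frequency. -/
theorem le_integral_sin_mul_osc_sq {T w A B : ℝ} (hT : 0 < T) (hT' : 100 ≤ T ^ 2)
    (hw : π / 3 ≤ w) :
    (A ^ 2 + B ^ 2) * (T / π - 7 / 3 / (π * T)) ≤
    ∫ t in (0 : ℝ)..T, sin (π * t / T) *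
      ((A * cos (w * t) + B * sin (w * t)) * (A * cos (w * t) + B * sin (w * t))) := by
  have e : ∀ t, sin (π * t / T) *
      ((A * cos (w * t) + B * sin (w * t)) * (A * cos (w * t) + B * sin (w * t))) =
      2⁻¹ * (A ^ 2 + B ^ 2) * (sin (π * t / T) * (1 * cos (0 * t) + 0 * sin (0 * t))) +
      2⁻¹ * (sin (π * t / T) * ((A * A - B * B) * cos ((2 * w) * t) +
        (B * A + A * B) * sin ((2 * w) * t))) := by
    intro t
    rw [mul_assoc 2 w, cos_two_mul, sin_two_mul, zero_mul, cos_zero, sin_zero]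
    linear_combination (B ^ 2 * sin (π * t / T)) * sin_sq_add_cos_sq (w * t)
  simp_rw [e]
  have hTπ : (π / T) ^ 2 ≠ 0 ^ 2 := by
    rw [zero_pow two_ne_zero]
    exact pow_ne_zero 2 (div_pos pi_pos hT).ne'
  rw [intervalIntegral.integral_add ((intervalIntegrable_sin_mul (by fun_prop)).const_mul _)
    ((intervalIntegrable_sin_mul (by fun_prop)).const_mul _), intervalIntegral.integral_const_mul,
    intervalIntegral.integral_const_mul, integral_sin_mul_osc hT hTπ]
  have h2 := abs_integral_sin_mul_osc_le (p := A * A - B * B) (q := B * A + A * B) (w := 2 * w)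
    (n := 1) (r := A ^ 2 + B ^ 2) hT hT' le_rfl
    (le_trans (by linarith) (le_abs_self _)) (by positivity) (by apply le_of_eq; ring)
  have e1 : 2⁻¹ * (A ^ 2 + B ^ 2) * (π / T * (1 * cos (0 * T) + 0 * sin (0 * T) + 1) /
      ((π / T) ^ 2 - 0 ^ 2)) = (A ^ 2 + B ^ 2) * (T / π) := by
    have := pi_pos
    rw [zero_mul, cos_zero, sin_zero]
    field_simp
    ring
  have e2 : (A ^ 2 + B ^ 2) * (14 / 3 / (π * T * 1 ^ 2)) =
      2 * ((A ^ 2 + B ^ 2) * (7 / 3 / (π * T))) := by ring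
  rw [e1]
  rw [e2] at h2
  rw [abs_le] at h2
  linarith [h2.1]

theorem sum_inv_sq_int_le (s : Finset ℤ) :
    ∑ n ∈ s, 1 / (n : ℝ) ^ 2 ≤ 4 := by
  have hz := hasSum_zeta_two
  have hpi : Real.pi ^ 2 / 6 ≤ 2 := by
    nlinarith [Real.pi_lt_d2, Real.pi_pos]
  have key : ∀ u : Finset ℕ, ∑ n ∈ u, 1 / (n : ℝ) ^ 2 ≤ 2 := fun u =>
    (sum_le_hasSum u (fun i _ => by positivity) hz).trans hpi
  have hpos : ∑ n ∈ s with 0 < n, 1 / (n : ℝ) ^ 2 ≤ 2 := by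
    refine le_trans (le_of_eq ?_) (key ((s.filter (0 < ·)).image Int.natAbs))
    rw [Finset.sum_image]
    · refine Finset.sum_congr rfl fun n _ => ?_
      rw [Nat.cast_natAbs, Int.cast_abs, sq_abs]
    · intro a ha b hb h
      simp only [Finset.coe_filter, Set.mem_ofPred_eq] at ha hb
      have : a.natAbs = b.natAbs := h
      omega
  have hneg : ∑ n ∈ s with ¬ 0 < n, 1 / (n : ℝ) ^ 2 ≤ 2 := by
    refine le_trans (le_of_eq ?_) (key ((s.filter (¬ 0 < ·)).image Int.natAbs))
    rw [Finset.sum_image]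
    · refine Finset.sum_congr rfl fun n _ => ?_
      rw [Nat.cast_natAbs, Int.cast_abs, sq_abs]
    · intro a ha b hb h
      simp only [Finset.coe_filter, Set.mem_ofPred_eq] at ha hb
      have : a.natAbs = b.natAbs := h
      omega
  rw [← Finset.sum_filter_add_sum_filter_not s (0 < ·)]
  linarith

/-- The frequency `π √(k²/3 + μ²)`, `k = μ + 2l`, of `sin (π k x / √3) sin (π μ y)`. -/
noncomputable def freq (μ l : ℤ) : ℝ := Real.pi * √(((μ : ℝ) + 2 * l) ^ 2 / 3 + (μ : ℝ) ^ 2)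

/-- For `3 μ ≤ k` the slope of `k ↦ √(k² / 3 + μ²)` is bounded below, because the sum of the two
roots is at most `k + k'`. -/
theorem sqrt_gap {μ k k' : ℝ} (hμ : 0 ≤ μ) (hk : 3 * μ ≤ k) (hk0 : 0 < k) (hk' : 0 ≤ k') :
    |k - k'| / 3 ≤ |√(k ^ 2 / 3 + μ ^ 2) - √(k' ^ 2 / 3 + μ ^ 2)| := by
  set r := √(k ^ 2 / 3 + μ ^ 2)
  set r' := √(k' ^ 2 / 3 + μ ^ 2)
  have h1 : r ^ 2 = k ^ 2 / 3 + μ ^ 2 := Real.sq_sqrt (by positivity)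
  have h2 : r' ^ 2 = k' ^ 2 / 3 + μ ^ 2 := Real.sq_sqrt (by positivity)
  have hr : r ≤ 2 * k / 3 := Real.sqrt_le_iff.2 ⟨by positivity, by nlinarith⟩
  have hr' : r' ≤ 2 * k' / 3 + k / 3 := Real.sqrt_le_iff.2 ⟨by positivity, by
    nlinarith [mul_nonneg hk' hk0.le]⟩
  have hr0 : 0 < r := Real.sqrt_pos.2 (by positivity)
  have hr0' : 0 ≤ r' := Real.sqrt_nonneg _
  have hsum : r + r' ≤ k + k' := by linarith
  have e : |r - r'| * (r + r') = |k - k'| * (k + k') / 3 := by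
    rw [← abs_of_pos (show 0 < r + r' by linarith), ← abs_mul,
      show (r - r') * (r + r') = (k - k') * (k + k') / 3 by nlinarith, abs_div, abs_mul,
      abs_of_pos (show 0 < k + k' by linarith), abs_of_pos (show (0 : ℝ) < 3 by norm_num)]
  have : |k - k'| / 3 * (r + r') ≤ |r - r'| * (r + r') := by
    rw [e, div_mul_eq_mul_div]
    gcongr
  exact le_of_mul_le_mul_right this (by linarith)

/-- On a row `μ = const` every frequency with `μ < l` is separated from all the others. -/
theorem freq_gap {μ l l' : ℤ} (hμ : 0 < μ) (hl : μ < l) (hl' : 0 < μ + 2 * l') :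
    2 * Real.pi / 3 * |(l : ℝ) - l'| ≤ |freq μ l - freq μ l'| := by
  have h := sqrt_gap (μ := (μ : ℝ)) (k := μ + 2 * l) (k' := μ + 2 * l')
    (by exact_mod_cast hμ.le) (by exact_mod_cast (by linarith)) (by exact_mod_cast (by linarith))
    (by exact_mod_cast hl'.le)
  rw [freq, freq, ← mul_sub, abs_mul, abs_of_pos Real.pi_pos]
  rw [show (μ : ℝ) + 2 * l - (μ + 2 * l') = 2 * (l - l') by ring, abs_mul,
    abs_of_pos (show (0 : ℝ) < 2 by norm_num)] at h
  have := mul_le_mul_of_nonneg_left h Real.pi_pos.le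
  linarith

theorem freq_lower {μ l : ℤ} (hμ : 0 < μ) : Real.pi / 3 ≤ freq μ l := by
  have h1 : (1 : ℝ) ≤ μ := by exact_mod_cast hμ
  have : (1 : ℝ) ≤ √(((μ : ℝ) + 2 * l) ^ 2 / 3 + (μ : ℝ) ^ 2) :=
    Real.one_le_sqrt.2 (by nlinarith [sq_nonneg ((μ : ℝ) + 2 * l)])
  rw [freq]
  nlinarith [Real.pi_pos]

theorem freq_pos {μ l : ℤ} (hμ : 0 < μ) : 0 < freq μ l :=
  lt_of_lt_of_le (by have := Real.pi_pos; positivity) (freq_lower hμ)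

/-- A finite sum `∑_{a, b : μ a = μ b} f a * f b` is a sum of squares. -/
theorem sum_sum_fiber_nonneg {ι : Type*} (s : Finset ι) (μ : ι → ℤ) (f : ι → ℝ) :
    0 ≤ ∑ a ∈ s, ∑ b ∈ s, if μ a = μ b then f a * f b else 0 := by
  classical
  have : ∑ a ∈ s, ∑ b ∈ s, (if μ a = μ b then f a * f b else 0) =
      ∑ v ∈ s.image μ, (∑ a ∈ s with μ a = v, f a) ^ 2 := by
    rw [← Finset.sum_fiberwise_of_maps_to (g := μ) (t := s.image μ)
      (fun a ha => Finset.mem_image_of_mem μ ha)]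
    refine Finset.sum_congr rfl fun v _ => ?_
    rw [sq, Finset.sum_mul]
    refine Finset.sum_congr rfl fun a ha => ?_
    rw [Finset.mul_sum, Finset.sum_filter]
    refine Finset.sum_congr rfl fun b _ => ?_
    rw [(Finset.mem_filter.1 ha).2]
    simp only [eq_comm]
  rw [this]
  positivity

open Real in
/-- An Ingham type inequality for a family of vibrations indexed by pairs `(μ, l)`. Only the modes
with `μ < l`, for which the frequencies have a uniform gap on each row `μ = const`, are controlled;
the other ones enter through a small error. -/
theorem ingham_rows {ι : Type*} [Fintype ι] {T : ℝ} (hT : 0 < T) (hT' : 100 ≤ T ^ 2)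
    (μ l : ι → ℤ) (hinj : ∀ a b, μ a = μ b → l a = l b → a = b) (hμ : ∀ a, 0 < μ a)
    (hk : ∀ a, 0 < μ a + 2 * l a) (A B : ι → ℝ) :
    T / π * (∑ a with μ a < l a, (A a ^ 2 + B a ^ 2) - 21 / T ^ 2 * ∑ a, (A a ^ 2 + B a ^ 2)) ≤
    ∫ t in (0 : ℝ)..T, sin (π * t / T) * ∑ a, ∑ b, if μ a = μ b then
      (A a * cos (freq (μ a) (l a) * t) + B a * sin (freq (μ a) (l a) * t)) *
      (A b * cos (freq (μ b) (l b) * t) + B b * sin (freq (μ b) (l b) * t)) else 0 := by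
  classical
  have hπ := pi_pos
  set f : ι → ℝ → ℝ := fun a t =>
    A a * cos (freq (μ a) (l a) * t) + B a * sin (freq (μ a) (l a) * t) with hf
  have hfc : ∀ a, Continuous (f a) := fun a => by simp only [hf]; fun_prop
  set r : ι → ℝ := fun a => √(A a ^ 2 + B a ^ 2) with hr
  have hr0 : ∀ a, 0 ≤ r a := fun a => sqrt_nonneg _
  have hr2 : ∀ a, A a ^ 2 + B a ^ 2 = r a ^ 2 := fun a => (sq_sqrt (by positivity)).symm
  set good : ι → ι → Prop := fun a b => μ a = μ b ∧ (μ a < l a ∨ μ b < l b) with hgood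
  set κ : ι → ι → ℝ := fun a b => 14 / 3 / (π * T) * (1 / ((l a - l b : ℤ) : ℝ) ^ 2) with hκ
  -- the part of the double sum with at least one controlled factor
  have hpt : ∀ t, (∑ a, ∑ b, if good a b then f a t * f b t else 0) ≤
      ∑ a, ∑ b, if μ a = μ b then f a t * f b t else 0 := by
    intro t
    have h0 := sum_sum_fiber_nonneg (Finset.univ.filter fun a => ¬ μ a < l a) μ (fun a => f a t)
    rw [Finset.sum_filter] at h0
    have : (∑ a, ∑ b, if μ a = μ b then f a t * f b t else 0) =
        (∑ a, ∑ b, if good a b then f a t * f b t else 0) +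
        ∑ a, if ¬ μ a < l a then ∑ b with ¬ μ b < l b,
          (if μ a = μ b then f a t * f b t else 0) else 0 := by
      rw [← Finset.sum_add_distrib]
      refine Finset.sum_congr rfl fun a _ => ?_
      by_cases ha : μ a < l a
      · simp [hgood, ha]
      · rw [if_pos ha, Finset.sum_filter, ← Finset.sum_add_distrib]
        refine Finset.sum_congr rfl fun b _ => ?_
        by_cases hab : μ a = μ b <;> by_cases hb : μ b < l b <;> simp [hgood, ha, hab, hb]
        rw [← hab]; simp [ha]
    linarith
  have hcont : Continuous fun t => ∑ a, ∑ b, if μ a = μ b then f a t * f b t else 0 := by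
    refine continuous_finsetSum _ fun a _ => continuous_finsetSum _ fun b _ => ?_
    split_ifs
    exacts [(hfc a).mul (hfc b), continuous_const]
  have hcont' : ∀ a b, Continuous fun t => if good a b then f a t * f b t else 0 := by
    intro a b
    split_ifs
    exacts [(hfc a).mul (hfc b), continuous_const]
  have hstep : ∑ a, ∑ b, (∫ t in (0 : ℝ)..T, sin (π * t / T) * if good a b then f a t * f b t else 0) ≤
      ∫ t in (0 : ℝ)..T, sin (π * t / T) * ∑ a, ∑ b, if μ a = μ b then f a t * f b t else 0 := by
    simp_rw [← intervalIntegral.integral_finsetSum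
      (fun b _ => intervalIntegrable_sin_mul (hcont' _ b))]
    rw [← intervalIntegral.integral_finsetSum]
    swap
    · intro a _
      simp_rw [← Finset.mul_sum]
      exact intervalIntegrable_sin_mul (continuous_finsetSum _ fun b _ => hcont' a b)
    simp_rw [← Finset.mul_sum]
    refine intervalIntegral.integral_mono_on hT.le (intervalIntegrable_sin_mul
      (continuous_finsetSum _ fun a _ => continuous_finsetSum _ fun b _ => hcont' a b))
      (intervalIntegrable_sin_mul hcont) fun t ht => ?_
    refine mul_le_mul_of_nonneg_left (hpt t) (sin_nonneg_of_nonneg_of_le_pi ?_ ?_)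
    · have := ht.1; positivity
    · rw [div_le_iff₀ hT]; have := ht.2; gcongr
  refine le_trans ?_ hstep
  -- termwise lower bounds
  have hterm : ∀ a b, (if a = b then (if μ a < l a then (T / π - 7 / 3 / (π * T)) * r a ^ 2 else 0)
      else if μ a = μ b then - (κ a b * ((r a ^ 2 + r b ^ 2) / 2)) else 0) ≤
      ∫ t in (0 : ℝ)..T, sin (π * t / T) * if good a b then f a t * f b t else 0 := by
    intro a b
    have hκ0 : 0 ≤ κ a b := by simp only [hκ]; positivity
    by_cases hab : a = b
    · subst hab
      rw [if_pos rfl]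
      by_cases ha : μ a < l a
      · rw [if_pos ha]
        have hg : good a a := ⟨rfl, Or.inl ha⟩
        simp only [if_pos hg]
        rw [mul_comm, ← hr2]
        exact le_integral_sin_mul_osc_sq hT hT' (freq_lower (hμ a))
      · have hg : ¬ good a a := fun h => ha (h.2.elim id id)
        simp [ha, hg]
    · rw [if_neg hab]
      by_cases hm : μ a = μ b
      swap
      · have hg : ¬ good a b := fun h => hm h.1
        simp [hm, hg]
      rw [if_pos hm]
      by_cases hg : good a b
      swap
      · simp only [if_neg hg, mul_zero, intervalIntegral.integral_zero, Left.neg_nonpos_iff]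
        positivity
      simp only [if_pos hg]
      have hl : l a ≠ l b := fun h => hab (hinj a b hm h)
      set n : ℝ := |((l a : ℝ) - l b)| with hn
      have hn1 : 1 ≤ n := by
        rw [hn, ← Int.cast_sub, ← Int.cast_abs]
        exact_mod_cast Int.one_le_abs (sub_ne_zero.2 hl)
      have hgap : 2 * π / 3 * n ≤ |freq (μ a) (l a) - freq (μ b) (l b)| := by
        rcases hg.2 with h | h
        · have := freq_gap (hμ a) h (l' := l b) (by rw [hm]; exact hk b)
          rwa [hm] at this ⊢
        · have := freq_gap (hμ b) h (l' := l a) (by rw [← hm]; exact hk a)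
          rw [abs_sub_comm, abs_sub_comm (freq _ _)] at this
          rwa [hm]
      have hsum : 2 * π / 3 * n ≤ freq (μ a) (l a) + freq (μ b) (l b) := by
        refine hgap.trans (abs_le.2 ⟨?_, ?_⟩) <;>
          linarith [freq_pos (l := l a) (hμ a), freq_pos (l := l b) (hμ b)]
      have h1 := abs_integral_sin_mul_osc_mul_osc_le hT hT' hn1 hgap hsum (hr0 a) (hr0 b)
        (hr2 a) (hr2 b)
      have e : 14 / 3 / (π * T * n ^ 2) = κ a b := by
        simp only [hκ, hn, sq_abs]
        push_cast
        field_simp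
      rw [e] at h1
      have h2 : r a * r b * κ a b ≤ κ a b * ((r a ^ 2 + r b ^ 2) / 2) := by
        nlinarith [mul_nonneg hκ0 (sq_nonneg (r a - r b))]
      exact (neg_le_neg h2).trans (abs_le.1 h1).1
  refine le_trans ?_ (Finset.sum_le_sum fun a _ => Finset.sum_le_sum fun b _ => hterm a b)
  -- row sums of the error
  have hrow : ∀ a, ∑ b, (if μ a = μ b then κ a b else 0) ≤ 56 / 3 / (π * T) := by
    intro a
    rw [← Finset.sum_filter]
    simp only [hκ]
    rw [← Finset.mul_sum]
    have : ∑ b with μ a = μ b, 1 / ((l a - l b : ℤ) : ℝ) ^ 2 ≤ 4 := by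
      refine le_trans (le_of_eq ?_)
        (sum_inv_sq_int_le ((Finset.univ.filter fun b => μ a = μ b).image fun b => l a - l b))
      rw [Finset.sum_image]
      intro b hb c hc h
      simp only [Finset.coe_filter, Finset.mem_univ, true_and, Set.mem_ofPred_eq] at hb hc
      exact hinj b c (hb.symm.trans hc) (by simpa using h)
    calc _ ≤ 14 / 3 / (π * T) * 4 := by gcongr
      _ = _ := by ring
  have hκs : ∀ a b, κ a b = κ b a := fun a b => by
    simp only [hκ]; push_cast; rw [← neg_sub, neg_sq]
  have hrow' : ∀ a, ∑ b, (if μ b = μ a then κ b a else 0) ≤ 56 / 3 / (π * T) := fun a => by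
    refine le_trans (le_of_eq ?_) (hrow a)
    exact Finset.sum_congr rfl fun b _ => by rw [hκs]; simp only [eq_comm]
  have herr : ∑ a, ∑ b, (if μ a = μ b then κ a b * ((r a ^ 2 + r b ^ 2) / 2) else 0) ≤
      56 / 3 / (π * T) * ∑ a, r a ^ 2 := by
    have e : ∑ a, ∑ b, (if μ a = μ b then κ a b * ((r a ^ 2 + r b ^ 2) / 2) else 0) =
        (∑ a, r a ^ 2 / 2 * ∑ b, (if μ a = μ b then κ a b else 0)) +
        ∑ b, r b ^ 2 / 2 * ∑ a, (if μ a = μ b then κ a b else 0) := by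
      simp_rw [Finset.mul_sum]
      rw [Finset.sum_comm (γ := ι) (f := fun b a => r b ^ 2 / 2 * (if μ a = μ b then κ a b else 0)),
        ← Finset.sum_add_distrib]
      refine Finset.sum_congr rfl fun a _ => ?_
      rw [← Finset.sum_add_distrib]
      refine Finset.sum_congr rfl fun b _ => ?_
      split_ifs <;> ring
    rw [e, Finset.mul_sum, ← Finset.sum_add_distrib]
    refine Finset.sum_le_sum fun a _ => ?_
    nlinarith [mul_le_mul_of_nonneg_left (hrow a) (sq_nonneg (r a)),
      mul_le_mul_of_nonneg_left (hrow' a) (sq_nonneg (r a))]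
  have hsplit : ∑ a, ∑ b, (if a = b then (if μ a < l a then (T / π - 7 / 3 / (π * T)) * r a ^ 2 else 0)
      else if μ a = μ b then - (κ a b * ((r a ^ 2 + r b ^ 2) / 2)) else 0) =
      (T / π - 7 / 3 / (π * T)) * (∑ a with μ a < l a, r a ^ 2) -
      ∑ a, ∑ b, (if μ a = μ b then κ a b * ((r a ^ 2 + r b ^ 2) / 2) else 0) := by
    rw [Finset.mul_sum, Finset.sum_filter, ← Finset.sum_sub_distrib]
    refine Finset.sum_congr rfl fun a _ => ?_
    have hd : (if μ a < l a then (T / π - 7 / 3 / (π * T)) * r a ^ 2 else 0) =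
        ∑ b, if a = b then (if μ a < l a then (T / π - 7 / 3 / (π * T)) * r a ^ 2 else 0) else 0 := by
      rw [Finset.sum_ite_eq, if_pos (Finset.mem_univ a)]
    conv_rhs => rw [hd]
    rw [← Finset.sum_sub_distrib]
    refine Finset.sum_congr rfl fun b _ => ?_
    by_cases hab : a = b
    · subst hab
      simp [hκ]
    · simp only [if_neg hab]
      split_ifs <;> simp
  rw [hsplit]
  simp_rw [hr2]
  have hle : ∑ a with μ a < l a, r a ^ 2 ≤ ∑ a, r a ^ 2 :=
    Finset.sum_le_sum_of_subset_of_nonneg (Finset.filter_subset _ _) fun _ _ _ => by positivity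
  have e3 : T / π * (∑ a with μ a < l a, r a ^ 2 - 21 / T ^ 2 * ∑ a, r a ^ 2) =
      T / π * (∑ a with μ a < l a, r a ^ 2) - 7 / 3 / (π * T) * ∑ a, r a ^ 2 -
      56 / 3 / (π * T) * ∑ a, r a ^ 2 := by
    field_simp
    ring
  rw [e3, sub_mul]
  have : 7 / 3 / (π * T) * ∑ a with μ a < l a, r a ^ 2 ≤ 7 / 3 / (π * T) * ∑ a, r a ^ 2 := by
    gcongr
  linarith

/-! ### The constants `tInf`, `obsTime` and `obsConst` -/

open Real in
theorem integral_sin_mul_sq {c : ℝ} (hc : c ≠ 0) (α : ℝ) :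
    ∫ x in (0 : ℝ)..α, sin (c * x) ^ 2 = α / 2 - sin (2 * (c * α)) / (4 * c) := by
  rw [intervalIntegral.integral_comp_mul_left (fun x => sin x ^ 2) hc, integral_sin_sq,
    sin_two_mul, mul_zero, sin_zero, smul_eq_mul]
  field_simp
  ring

open Real in
/-- A quantitative form of `sin s < s`, uniform for `s` bounded away from zero. -/
theorem sin_le_mul_one_sub {s₀ s : ℝ} (h₀ : 0 < s₀) (hs : s₀ ≤ s) :
    sin s ≤ s * (1 - min (1 / 2) (s₀ ^ 2 / 36)) := by
  have hs0 : 0 < s := h₀.trans_le hs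
  rcases le_total s 2 with h | h
  · have hb := (abs_le.1 (sin_bound (x := s / 2) (by rw [abs_of_pos] <;> linarith))).2
    rw [abs_of_pos (by positivity)] at hb
    have h1 : sin (s / 2) ≤ s / 2 * (1 - s ^ 2 / 36) := by
      have : (s / 2) ^ 4 * (5 / 96) ≤ (s / 2) ^ 3 / 18 := by
        nlinarith [pow_pos hs0 3]
      nlinarith
    have h2 : 0 ≤ sin (s / 2) := sin_nonneg_of_nonneg_of_le_pi (by linarith) (by linarith [two_le_pi])
    have h3 : sin s ≤ 2 * sin (s / 2) := by
      have e : sin s = 2 * sin (s / 2) * cos (s / 2) := by rw [← sin_two_mul]; ring_nf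
      rw [e]
      nlinarith [cos_le_one (s / 2)]
    have h4 : min (1 / 2) (s₀ ^ 2 / 36) ≤ s ^ 2 / 36 :=
      (min_le_right _ _).trans (by gcongr)
    nlinarith
  · have := min_le_left (1 / 2) (s₀ ^ 2 / 36)
    nlinarith [sin_le_one s]

theorem tInf_bddBelow {α : ℝ} (hα : 0 ≤ α) :
    BddBelow (Set.range fun k : ℕ+ =>
      ∫ x in (0 : ℝ)..α, Real.sin (Real.pi * (k : ℝ) * x / √3) ^ 2) := by
  refine ⟨0, ?_⟩
  rintro _ ⟨k, rfl⟩
  exact intervalIntegral.integral_nonneg hα fun x _ => sq_nonneg _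

theorem tInf_le_integral {α : ℝ} (hα : 0 ≤ α) {k : ℤ} (hk : 0 < k) :
    tInf α ≤ ∫ x in (0 : ℝ)..α, Real.sin (k * (Real.pi * x / √3)) ^ 2 := by
  lift k to ℕ using hk.le
  have hk' : 0 < k := by exact_mod_cast hk
  refine (ciInf_le (tInf_bddBelow hα) ⟨k, hk'⟩).trans (le_of_eq ?_)
  congr 1
  ext x
  congr 2
  simp only [PNat.mk_coe, Int.cast_natCast]
  ring

open Real in
/-- The infimum defining `tInf` is positive: with `s = 2 π k α / √3` the integrals equal
`(α / 2) (1 - sin s / s)`, and `s` is bounded away from zero. -/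
theorem tInf_pos {α : ℝ} (hα : 0 < α) : 0 < tInf α := by
  have h3 : (0 : ℝ) < √3 := by positivity
  have hπ := pi_pos
  set s₀ : ℝ := 2 * (π / √3 * α) with hs₀
  have hs : 0 < s₀ := by positivity
  refine lt_of_lt_of_le (show 0 < α / 2 * min (1 / 2) (s₀ ^ 2 / 36) by positivity)
    (le_ciInf fun k => ?_)
  have hk : (1 : ℝ) ≤ k := by exact_mod_cast k.pos
  have e : ∀ x : ℝ, π * (k : ℝ) * x / √3 = (π / √3 * k) * x := fun x => by ring
  simp_rw [e]
  have hc : 0 < π / √3 * k := by positivity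
  rw [integral_sin_mul_sq hc.ne']
  set c := π / √3 * k with hcdef
  have hle : s₀ ≤ 2 * (c * α) := by
    have : π / √3 * 1 ≤ c := by rw [hcdef]; gcongr
    rw [hs₀]; nlinarith
  have h1 := sin_le_mul_one_sub hs hle
  have h2 : sin (2 * (c * α)) / (4 * c) ≤
      2 * (c * α) * (1 - min (1 / 2) (s₀ ^ 2 / 36)) / (4 * c) := by gcongr
  have h4 : 2 * (c * α) * (1 - min (1 / 2) (s₀ ^ 2 / 36)) / (4 * c) =
      α / 2 * (1 - min (1 / 2) (s₀ ^ 2 / 36)) := by field_simp; ring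
  linarith

open Real in
theorem tInf_le {α : ℝ} (hα : 0 ≤ α) : tInf α ≤ α := by
  refine (tInf_le_integral hα one_pos).trans ?_
  have : ∫ x in (0 : ℝ)..α, sin (((1 : ℤ) : ℝ) * (π * x / √3)) ^ 2 ≤ ∫ x in (0 : ℝ)..α, (1 : ℝ) :=
    intervalIntegral.integral_mono_on hα (Continuous.intervalIntegrable (by fun_prop) _ _)
      (by simp) fun x _ => sin_sq_le_one _
  simpa using this

/-- Numerical bound for `α`, as `1 / (3 + √3) = 0.211…`. -/
theorem width_le {α : ℝ} (hα₁ : α ≤ 1 / (3 + √3)) : α ≤ 22 / 100 := by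
  have : (1.73 : ℝ) ≤ √3 := Real.le_sqrt_of_sq_le (by norm_num)
  refine hα₁.trans ?_
  rw [div_le_div_iff₀ (by positivity) (by norm_num)]
  linarith

theorem obsTime_bounds {α T : ℝ} (hα₀ : 0 < α) (hα₁ : α ≤ 1 / (3 + √3)) (hT : obsTime α < T) :
    0 < T ∧ 100 ≤ T ^ 2 ∧ 0 < obsConst α T := by
  have ht := tInf_pos hα₀
  have h3 : (0 : ℝ) < √3 := by positivity
  have h3' : √3 ≤ 1.74 := Real.sqrt_le_iff.2 ⟨by norm_num, by norm_num⟩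
  have hT0 : 0 < T := lt_of_le_of_lt (Real.sqrt_nonneg _) hT
  have h1 : 40 / (√3 * tInf α) < T ^ 2 := (Real.sqrt_lt' hT0).1 hT
  rw [div_lt_iff₀ (by positivity)] at h1
  refine ⟨hT0, ?_, ?_⟩
  · have h2 : tInf α ≤ 22 / 100 := (tInf_le hα₀.le).trans (width_le hα₁)
    have : √3 * tInf α ≤ 1.74 * (22 / 100) := by gcongr
    nlinarith [sq_nonneg T]
  · rw [obsConst]
    have hπ := Real.pi_pos
    refine mul_pos (by positivity) (sub_pos.2 ?_)
    rw [div_lt_div_iff₀ (by positivity) h3]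
    have := Real.mul_self_sqrt (show (0 : ℝ) ≤ 3 by norm_num)
    nlinarith

/-- Comparison of the constants: `obsConst` is weaker than what the row inequality gives. -/
theorem obsConst_mul_le {α T : ℝ} (hα₁ : α ≤ 1 / (3 + √3)) (hT : 0 < T)
    (ht : 0 ≤ tInf α) :
    obsConst α T * (√3 / 8) ≤ 1 / 6 * (T / Real.pi * (tInf α - 63 * α / T ^ 2)) := by
  have hπ := Real.pi_pos
  have h3 : (0 : ℝ) < √3 := by positivity
  have h3' : (1.73 : ℝ) ≤ √3 := Real.le_sqrt_of_sq_le (by norm_num)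
  have hα := width_le hα₁
  have e : obsConst α T * (√3 / 8) = T / Real.pi * (tInf α / 8 - 5 * √3 / 3 / T ^ 2) := by
    rw [obsConst]; field_simp; ring
  rw [e, mul_left_comm]
  refine mul_le_mul_of_nonneg_left ?_ (by positivity)
  have : 1 / 6 * (63 * α / T ^ 2) ≤ 5 * √3 / 3 / T ^ 2 := by
    rw [← mul_div_assoc]
    gcongr
    linarith
  linarith

/-! ### The eigenfunctions of the triangle -/

open Real in
/-- The alternating sum of plane waves attached to the integer weight `(m, q, -m - q)`, in the
coordinates `a = π x / √3`, `b = π (1 - y)`. -/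
noncomputable def trigMode (m q : ℤ) (a b : ℝ) : ℝ :=
  sin ((m + 2 * q) * a) * sin (m * b) - sin ((q + 2 * m) * a) * sin (q * b) +
    sin ((q - m) * a) * sin ((m + q) * b)

theorem trigMode_swap (m q : ℤ) (a b : ℝ) : trigMode q m a b = -trigMode m q a b := by
  have h : ((m : ℝ) - q) * a = -((q - m) * a) := by ring
  rw [trigMode, trigMode, h, Real.sin_neg, add_comm (q : ℝ) m]
  ring

theorem trigMode_neg (m q : ℤ) (a b : ℝ) : trigMode (-m) (-q) a b = trigMode m q a b := by
  simp only [trigMode]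
  push_cast
  rw [show (-(m : ℝ) + 2 * -q) * a = -((m + 2 * q) * a) by ring,
    show (-(q : ℝ) + 2 * -m) * a = -((q + 2 * m) * a) by ring,
    show (-(q : ℝ) - -m) * a = -((q - m) * a) by ring,
    show (-(m : ℝ) + -q) * b = -((m + q) * b) by ring, neg_mul, neg_mul]
  simp only [Real.sin_neg]
  ring

theorem trigMode_rotate (m q : ℤ) (a b : ℝ) : trigMode q (-m - q) a b = trigMode m q a b := by
  simp only [trigMode]
  push_cast
  rw [show ((q : ℝ) + 2 * (-m - q)) * a = -((q + 2 * m) * a) by ring,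
    show ((-m - q : ℝ) + 2 * q) * a = (q - m) * a by ring,
    show (-(m : ℝ) - q - q) * a = -((m + 2 * q) * a) by ring,
    show (-(m : ℝ) - q) * b = -((m + q) * b) by ring,
    show ((q : ℝ) + (-m - q)) * b = -(m * b) by ring]
  simp only [Real.sin_neg]
  ring

theorem trigMode_self (m : ℤ) (a b : ℝ) : trigMode m m a b = 0 := by
  have := trigMode_swap m m a b
  linarith

theorem trigMode_zero (q : ℤ) (a b : ℝ) : trigMode 0 q a b = 0 := by
  simp only [trigMode]
  push_cast
  simp

/-- Up to sign, every nonzero mode is one with `0 < m < q`. -/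
theorem trigMode_reduce {Z : (ℝ → ℝ → ℝ) → Prop} (h0 : Z fun _ _ => 0)
    (hneg : ∀ f, Z f → Z fun a b => -f a b) (h : ∀ m q : ℤ, 0 < m → m < q → Z (trigMode m q))
    (m q : ℤ) : Z (trigMode m q) := by
  have swap : ∀ m q : ℤ, Z (trigMode q m) → Z (trigMode m q) := fun m q h => by
    have := hneg _ h
    simpa only [← trigMode_swap] using this
  have neg : ∀ m q : ℤ, Z (trigMode (-m) (-q)) → Z (trigMode m q) := fun m q h => by
    convert h using 1
    ext a b
    exact (trigMode_neg m q a b).symm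
  have rot : ∀ m q : ℤ, Z (trigMode q (-m - q)) → Z (trigMode m q) := fun m q h => by
    convert h using 1
    ext a b
    exact (trigMode_rotate m q a b).symm
  have zero : ∀ q : ℤ, Z (trigMode 0 q) := fun q => by
    convert h0 using 1
    ext a b
    exact trigMode_zero q a b
  have self : ∀ q : ℤ, Z (trigMode q q) := fun q => by
    convert h0 using 1
    ext a b
    exact trigMode_self q a b
  have pos : ∀ m q : ℤ, 0 < m → 0 < q → Z (trigMode m q) := by
    intro m q hm hq
    rcases lt_trichotomy m q with hlt | rfl | hlt
    · exact h m q hm hlt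
    · exact self _
    · exact swap _ _ (h q m hq hlt)
  have same : ∀ m q : ℤ, 0 < m * q → Z (trigMode m q) := by
    intro m q hmq
    rcases pos_and_pos_or_neg_and_neg_of_mul_pos hmq with ⟨h1, h2⟩ | ⟨h1, h2⟩
    · exact pos m q h1 h2
    · exact neg _ _ (pos _ _ (by omega) (by omega))
  -- among three integers with zero sum, either one vanishes or two have the same sign
  rcases eq_or_ne m 0 with rfl | hm
  · exact zero q
  rcases eq_or_ne q 0 with rfl | hq
  · exact swap _ _ (zero m)
  rcases eq_or_ne (m + q) 0 with hr | hr
  · exact rot _ _ (by rw [show -m - q = 0 by omega]; exact swap _ _ (zero q))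
  by_cases h1 : 0 < m * q
  · exact same m q h1
  by_cases h2 : 0 < q * (-m - q)
  · exact rot _ _ (same _ _ h2)
  refine rot _ _ (rot _ _ (same _ _ ?_))
  rw [show -q - (-m - q) = m by ring]
  have h3 : 0 < (m + q) ^ 2 := by positivity
  have : 0 < m ^ 2 := by positivity
  have : 0 < q ^ 2 := by positivity
  nlinarith

open Real in
/-- Multiplication by the orbit sum of the short weights permutes the modes: the six terms are
the translates of `(m, q, -m - q)` by the roots of type `A₂`. -/
theorem trigMode_mul_short (m q : ℤ) (a b : ℝ) :
    trigMode m q a b * (cos (2 * a) + 2 * cos a * cos b) =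
      2⁻¹ * (trigMode m (q + 1) a b + trigMode m (q - 1) a b + trigMode (m + 1) q a b +
        trigMode (m - 1) q a b + trigMode (m - 1) (q + 1) a b + trigMode (m + 1) (q - 1) a b) := by
  simp only [trigMode]
  push_cast
  simp only [show ((m : ℝ) + 2 * (q + 1)) * a = (m + 2 * q) * a + 2 * a by ring,
    show ((m : ℝ) + 2 * (q - 1)) * a = (m + 2 * q) * a - 2 * a by ring,
    show ((m : ℝ) + 1 + 2 * q) * a = (m + 2 * q) * a + a by ring,
    show ((m : ℝ) - 1 + 2 * q) * a = (m + 2 * q) * a - a by ring,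
    show ((m : ℝ) - 1 + 2 * (q + 1)) * a = (m + 2 * q) * a + a by ring,
    show ((m : ℝ) + 1 + 2 * (q - 1)) * a = (m + 2 * q) * a - a by ring,
    show ((q : ℝ) + 1 + 2 * m) * a = (q + 2 * m) * a + a by ring,
    show ((q : ℝ) - 1 + 2 * m) * a = (q + 2 * m) * a - a by ring,
    show ((q : ℝ) + 2 * (m + 1)) * a = (q + 2 * m) * a + 2 * a by ring,
    show ((q : ℝ) + 2 * (m - 1)) * a = (q + 2 * m) * a - 2 * a by ring,
    show ((q : ℝ) + 1 + 2 * (m - 1)) * a = (q + 2 * m) * a - a by ring,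
    show ((q : ℝ) - 1 + 2 * (m + 1)) * a = (q + 2 * m) * a + a by ring,
    show ((q : ℝ) + 1 - m) * a = (q - m) * a + a by ring,
    show ((q : ℝ) - 1 - m) * a = (q - m) * a - a by ring,
    show ((q : ℝ) - (m + 1)) * a = (q - m) * a - a by ring,
    show ((q : ℝ) - (m - 1)) * a = (q - m) * a + a by ring,
    show ((q : ℝ) + 1 - (m - 1)) * a = (q - m) * a + 2 * a by ring,
    show ((q : ℝ) - 1 - (m + 1)) * a = (q - m) * a - 2 * a by ring,
    show ((m : ℝ) + 1) * b = m * b + b by ring, show ((m : ℝ) - 1) * b = m * b - b by ring,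
    show ((q : ℝ) + 1) * b = q * b + b by ring, show ((q : ℝ) - 1) * b = q * b - b by ring,
    show ((m : ℝ) + (q + 1)) * b = (m + q) * b + b by ring,
    show ((m : ℝ) + (q - 1)) * b = (m + q) * b - b by ring,
    show ((m : ℝ) + 1 + q) * b = (m + q) * b + b by ring,
    show ((m : ℝ) - 1 + q) * b = (m + q) * b - b by ring,
    show ((m : ℝ) - 1 + (q + 1)) * b = (m + q) * b by ring,
    show ((m : ℝ) + 1 + (q - 1)) * b = (m + q) * b by ring, sin_add, sin_sub]
  ring

open Real in
/-- The analogue of `trigMode_mul_short` for the orbit of `(2, -1, -1)` and its negative. -/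
theorem trigMode_mul_long (m q : ℤ) (a b : ℝ) :
    trigMode m q a b * (cos (2 * b) + 2 * cos (3 * a) * cos b) =
      2⁻¹ * (trigMode (m + 2) (q - 1) a b + trigMode (m - 2) (q + 1) a b +
        trigMode (m + 1) (q + 1) a b + trigMode (m - 1) (q - 1) a b +
        trigMode (m - 1) (q + 2) a b + trigMode (m + 1) (q - 2) a b) := by
  simp only [trigMode]
  push_cast
  simp only [show ((m : ℝ) + 2 + 2 * (q - 1)) * a = (m + 2 * q) * a by ring,
    show ((m : ℝ) - 2 + 2 * (q + 1)) * a = (m + 2 * q) * a by ring,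
    show ((m : ℝ) + 1 + 2 * (q + 1)) * a = (m + 2 * q) * a + 3 * a by ring,
    show ((m : ℝ) - 1 + 2 * (q - 1)) * a = (m + 2 * q) * a - 3 * a by ring,
    show ((m : ℝ) - 1 + 2 * (q + 2)) * a = (m + 2 * q) * a + 3 * a by ring,
    show ((m : ℝ) + 1 + 2 * (q - 2)) * a = (m + 2 * q) * a - 3 * a by ring,
    show ((q : ℝ) - 1 + 2 * (m + 2)) * a = (q + 2 * m) * a + 3 * a by ring,
    show ((q : ℝ) + 1 + 2 * (m - 2)) * a = (q + 2 * m) * a - 3 * a by ring,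
    show ((q : ℝ) + 1 + 2 * (m + 1)) * a = (q + 2 * m) * a + 3 * a by ring,
    show ((q : ℝ) - 1 + 2 * (m - 1)) * a = (q + 2 * m) * a - 3 * a by ring,
    show ((q : ℝ) + 2 + 2 * (m - 1)) * a = (q + 2 * m) * a by ring,
    show ((q : ℝ) - 2 + 2 * (m + 1)) * a = (q + 2 * m) * a by ring,
    show ((q : ℝ) - 1 - (m + 2)) * a = (q - m) * a - 3 * a by ring,
    show ((q : ℝ) + 1 - (m - 2)) * a = (q - m) * a + 3 * a by ring,
    show ((q : ℝ) + 1 - (m + 1)) * a = (q - m) * a by ring,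
    show ((q : ℝ) - 1 - (m - 1)) * a = (q - m) * a by ring,
    show ((q : ℝ) + 2 - (m - 1)) * a = (q - m) * a + 3 * a by ring,
    show ((q : ℝ) - 2 - (m + 1)) * a = (q - m) * a - 3 * a by ring,
    show ((m : ℝ) + 2) * b = m * b + 2 * b by ring, show ((m : ℝ) - 2) * b = m * b - 2 * b by ring,
    show ((m : ℝ) + 1) * b = m * b + b by ring, show ((m : ℝ) - 1) * b = m * b - b by ring,
    show ((q : ℝ) + 2) * b = q * b + 2 * b by ring, show ((q : ℝ) - 2) * b = q * b - 2 * b by ring,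
    show ((q : ℝ) + 1) * b = q * b + b by ring, show ((q : ℝ) - 1) * b = q * b - b by ring,
    show ((m : ℝ) + 2 + (q - 1)) * b = (m + q) * b + b by ring,
    show ((m : ℝ) - 2 + (q + 1)) * b = (m + q) * b - b by ring,
    show ((m : ℝ) + 1 + (q + 1)) * b = (m + q) * b + 2 * b by ring,
    show ((m : ℝ) - 1 + (q - 1)) * b = (m + q) * b - 2 * b by ring,
    show ((m : ℝ) - 1 + (q + 2)) * b = (m + q) * b + b by ring,
    show ((m : ℝ) + 1 + (q - 2)) * b = (m + q) * b - b by ring, sin_add, sin_sub]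
  ring

open Real in
/-- The lowest mode is a product, the analogue of the Weyl denominator. -/
theorem trigMode_one_two (a b : ℝ) :
    trigMode 1 2 a b = 4 * sin a * sin b * (cos b - cos a) * (cos b - cos (3 * a)) := by
  have h5 : sin (5 * a) = sin a * (16 * cos a ^ 4 - 12 * cos a ^ 2 + 1) := by
    rw [show 5 * a = 3 * a + 2 * a by ring, sin_add, sin_three_mul, cos_three_mul, sin_two_mul,
      cos_two_mul]
    linear_combination (-4 * sin a * (2 * cos a ^ 2 - 1)) * sin_sq_add_cos_sq a
  have h4 : sin (4 * a) = sin a * (8 * cos a ^ 3 - 4 * cos a) := by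
    rw [show 4 * a = 2 * (2 * a) by ring, sin_two_mul, sin_two_mul, cos_two_mul]
    ring
  have h3 : sin (3 * b) = sin b * (4 * cos b ^ 2 - 1) := by
    rw [sin_three_mul]
    linear_combination (-4 * sin b) * sin_sq_add_cos_sq b
  simp only [trigMode]
  push_cast
  rw [show (1 + 2 * 2 : ℝ) * a = 5 * a by ring, show (2 + 2 * 1 : ℝ) * a = 4 * a by ring,
    show (2 - 1 : ℝ) * a = a by ring, show (1 + 2 : ℝ) * b = 3 * b by ring, one_mul, h5, h4, h3,
    sin_two_mul, cos_three_mul]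
  ring

open Real in
theorem two_mul_trigMode (m q : ℤ) (a b : ℝ) : 2 * trigMode m q a b =
    (cos ((m + 2 * q) * a - m * b) - cos ((m + 2 * q) * a + m * b)) -
    (cos ((q + 2 * m) * a - q * b) - cos ((q + 2 * m) * a + q * b)) +
    (cos ((q - m) * a - (m + q) * b) - cos ((q - m) * a + (m + q) * b)) := by
  simp only [trigMode, cos_sub, cos_add]
  ring

/-- Modes are odd under the reflection in the hypotenuse of the triangle. -/
theorem trigMode_reflect (m q : ℤ) (a b : ℝ) :
    trigMode m q ((b - a) / 2) ((3 * a + b) / 2) = -trigMode m q a b := by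
  have h1 := two_mul_trigMode m q ((b - a) / 2) ((3 * a + b) / 2)
  rw [show ((m : ℝ) + 2 * q) * ((b - a) / 2) - m * ((3 * a + b) / 2) =
      -((q + 2 * m) * a - q * b) by ring,
    show ((m : ℝ) + 2 * q) * ((b - a) / 2) + m * ((3 * a + b) / 2) =
      -((q - m) * a - (m + q) * b) by ring,
    show ((q : ℝ) + 2 * m) * ((b - a) / 2) - q * ((3 * a + b) / 2) =
      -((m + 2 * q) * a - m * b) by ring,
    show ((q : ℝ) + 2 * m) * ((b - a) / 2) + q * ((3 * a + b) / 2) =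
      (q - m) * a + (m + q) * b by ring,
    show ((q : ℝ) - m) * ((b - a) / 2) - (m + q) * ((3 * a + b) / 2) =
      -((m + 2 * q) * a + m * b) by ring,
    show ((q : ℝ) - m) * ((b - a) / 2) + (m + q) * ((3 * a + b) / 2) =
      (q + 2 * m) * a + q * b by ring] at h1
  simp only [Real.cos_neg] at h1
  have h2 := two_mul_trigMode m q a b
  linarith

theorem trigMode_neg_left (m q : ℤ) (a b : ℝ) : trigMode m q (-a) b = -trigMode m q a b := by
  simp only [trigMode, mul_neg, Real.sin_neg]
  ring

open Real in
theorem trigMode_pi_sub (m q : ℤ) (a b : ℝ) :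
    trigMode m q (π - a) (π - b) = trigMode m q a b := by
  have key : ∀ (n : ℤ) (x y : ℝ), x = n * (2 * π) - y → cos x = cos y := by
    rintro n x y rfl
    rw [cos_int_mul_two_pi_sub]
  have h1 := two_mul_trigMode m q (π - a) (π - b)
  rw [key q ((m + 2 * q) * (π - a) - m * (π - b)) ((m + 2 * q) * a - m * b) (by ring),
    key (m + q) ((m + 2 * q) * (π - a) + m * (π - b)) ((m + 2 * q) * a + m * b)
      (by push_cast; ring),
    key m ((q + 2 * m) * (π - a) - q * (π - b)) ((q + 2 * m) * a - q * b) (by ring),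
    key (m + q) ((q + 2 * m) * (π - a) + q * (π - b)) ((q + 2 * m) * a + q * b)
      (by push_cast; ring),
    key (-m) ((q - m) * (π - a) - (m + q) * (π - b)) ((q - m) * a - (m + q) * b)
      (by push_cast; ring),
    key q ((q - m) * (π - a) + (m + q) * (π - b)) ((q - m) * a + (m + q) * b)
      (by ring)] at h1
  have h2 := two_mul_trigMode m q a b
  linarith

/-- The mode `trigMode m q` as a function on the plane: a Dirichlet eigenfunction of the
triangle. -/
noncomputable def mode (m q : ℤ) (p : Plane) : ℝ :=
  trigMode m q (Real.pi / √3 * p 0) (Real.pi * (1 - p 1))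

/-- The eigenvalue of `mode m q`. -/
noncomputable def eigenvalue (m q : ℤ) : ℝ :=
  4 * Real.pi ^ 2 / 3 * (m ^ 2 + m * q + q ^ 2)

theorem contDiff_mode (m q : ℤ) {n : ℕ∞} : ContDiff ℝ n (mode m q) := by
  unfold mode trigMode
  fun_prop

theorem continuous_mode (m q : ℤ) : Continuous (mode m q) := (contDiff_mode m q (n := 0)).continuous

/-! ### The Laplacian of the modes -/

/-- The partial derivative in the direction of the `i`-th coordinate. -/
noncomputable def partialDeriv (i : Fin 2) (w : Plane → ℝ) (p : Plane) : ℝ :=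
  fderiv ℝ w p (EuclideanSpace.single i 1)

theorem partialDeriv_prod {g h : ℝ → ℝ} {g' h' : ℝ → ℝ} (hg : ∀ x, HasDerivAt g (g' x) x)
    (hh : ∀ x, HasDerivAt h (h' x) x) :
    partialDeriv 0 (fun p => g (p 0) * h (p 1)) = (fun p => g' (p 0) * h (p 1)) ∧
    partialDeriv 1 (fun p => g (p 0) * h (p 1)) = (fun p => g (p 0) * h' (p 1)) := by
  have key : ∀ p : Plane, HasFDerivAt (fun p : Plane => g (p 0) * h (p 1))
      (g (p 0) • (h' (p 1) • (EuclideanSpace.proj 1 : Plane →L[ℝ] ℝ)) +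
        h (p 1) • (g' (p 0) • (EuclideanSpace.proj 0 : Plane →L[ℝ] ℝ))) p := by
    intro p
    have h0 : HasFDerivAt (fun p : Plane => p 0) (EuclideanSpace.proj 0 : Plane →L[ℝ] ℝ) p :=
      (EuclideanSpace.proj 0 : Plane →L[ℝ] ℝ).hasFDerivAt
    have h1 : HasFDerivAt (fun p : Plane => p 1) (EuclideanSpace.proj 1 : Plane →L[ℝ] ℝ) p :=
      (EuclideanSpace.proj 1 : Plane →L[ℝ] ℝ).hasFDerivAt
    exact ((hg (p 0)).comp_hasFDerivAt p h0).mul ((hh (p 1)).comp_hasFDerivAt p h1)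
  constructor <;> ext p <;> rw [partialDeriv, (key p).fderiv] <;> simp [mul_comm]

theorem partialDeriv_add {i : Fin 2} {f g : Plane → ℝ} (hf : Differentiable ℝ f)
    (hg : Differentiable ℝ g) :
    partialDeriv i (fun p => f p + g p) = fun p => partialDeriv i f p + partialDeriv i g p := by
  ext p
  simp only [partialDeriv]
  rw [fderiv_fun_add (hf p) (hg p)]
  rfl

theorem partialDeriv_const_mul {i : Fin 2} {f : Plane → ℝ} (c : ℝ) (hf : Differentiable ℝ f) :
    partialDeriv i (fun p => c * f p) = fun p => c * partialDeriv i f p := by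
  ext p
  simp only [partialDeriv]
  rw [fderiv_const_mul (hf p)]
  rfl

/-- The Laplacian of a smooth function on the plane. -/
noncomputable def lap (w : Plane → ℝ) (p : Plane) : ℝ := ∑ i, partialDeriv i (partialDeriv i w) p

theorem contDiff_partialDeriv {w : Plane → ℝ} (hw : ContDiff ℝ (⊤ : ℕ∞) w) (i : Fin 2) :
    ContDiff ℝ (⊤ : ℕ∞) (partialDeriv i w) :=
  (hw.fderiv_right le_rfl).clm_apply contDiff_const

theorem lap_add {f g : Plane → ℝ} (hf : ContDiff ℝ (⊤ : ℕ∞) f) (hg : ContDiff ℝ (⊤ : ℕ∞) g) :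
    lap (fun p => f p + g p) = fun p => lap f p + lap g p := by
  have hd : ∀ {f : Plane → ℝ}, ContDiff ℝ (⊤ : ℕ∞) f → Differentiable ℝ f :=
    fun h => h.differentiable (by simp)
  ext p
  simp only [lap]
  rw [← Finset.sum_add_distrib]
  refine Finset.sum_congr rfl fun i _ => ?_
  rw [partialDeriv_add (hd hf) (hd hg),
    partialDeriv_add (hd (contDiff_partialDeriv hf i)) (hd (contDiff_partialDeriv hg i))]

theorem lap_const_mul {f : Plane → ℝ} (c : ℝ) (hf : ContDiff ℝ (⊤ : ℕ∞) f) :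
    lap (fun p => c * f p) = fun p => c * lap f p := by
  have hd : ∀ {f : Plane → ℝ}, ContDiff ℝ (⊤ : ℕ∞) f → Differentiable ℝ f :=
    fun h => h.differentiable (by simp)
  ext p
  simp only [lap]
  rw [Finset.mul_sum]
  refine Finset.sum_congr rfl fun i _ => ?_
  rw [partialDeriv_const_mul c (hd hf), partialDeriv_const_mul c (hd (contDiff_partialDeriv hf i))]

open Real in
theorem lap_sin_mul_sin (k μ : ℝ) :
    lap (fun p => sin (k * (π / √3 * p 0)) * sin (μ * (π * (1 - p 1)))) =
      fun p => -(π ^ 2 * (k ^ 2 / 3 + μ ^ 2)) *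
        (sin (k * (π / √3 * p 0)) * sin (μ * (π * (1 - p 1)))) := by
  have h1 : ∀ x : ℝ, HasDerivAt (fun x => k * (π / √3 * x)) (k * (π / √3)) x := fun x => by
    simpa using ((hasDerivAt_id x).const_mul (π / √3)).const_mul k
  have h2 : ∀ x : ℝ, HasDerivAt (fun x => μ * (π * (1 - x))) (-(μ * π)) x := fun x => by
    simpa using (((hasDerivAt_id x).const_sub 1).const_mul π).const_mul μ
  have hs := fun x => (h1 x).sin
  have hc := fun x => (h1 x).cos.mul_const (k * (π / √3))
  have hs' := fun x => (h2 x).sin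
  have hc' := fun x => (h2 x).cos.mul_const (-(μ * π))
  ext p
  have e : (√3 : ℝ) ^ 2 = 3 := sq_sqrt (by norm_num)
  simp only [lap, Fin.sum_univ_two]
  rw [(partialDeriv_prod hs hs').1, (partialDeriv_prod hc hs').1, (partialDeriv_prod hs hs').2,
    (partialDeriv_prod hs hc').2]
  have : (k * (π / √3)) ^ 2 = π ^ 2 * (k ^ 2 / 3) := by rw [mul_pow, div_pow, e]; ring
  linear_combination -(sin (k * (π / √3 * p 0)) * sin (μ * (π * (1 - p 1)))) * this

open Real in
/-- Modes are eigenfunctions of the Laplacian. -/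
theorem lap_mode (m q : ℤ) : lap (mode m q) = fun p => -eigenvalue m q * mode m q p := by
  set S : ℝ → ℝ → Plane → ℝ := fun k μ p => sin (k * (π / √3 * p 0)) * sin (μ * (π * (1 - p 1)))
    with hS
  have hc : ∀ k μ, ContDiff ℝ (⊤ : ℕ∞) (S k μ) := fun k μ => by simp only [hS]; fun_prop
  have e : mode m q = fun p => (S (m + 2 * q) m p + (-1) * S (q + 2 * m) q p) +
      S (q - m) (m + q) p := by
    ext p; simp only [mode, trigMode, hS]; ring
  rw [e, lap_add ((hc _ _).add (contDiff_const.mul (hc _ _))) (hc _ _),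
    lap_add (hc _ _) (contDiff_const.mul (hc _ _)), lap_const_mul _ (hc _ _)]
  simp only [hS, lap_sin_mul_sin, eigenvalue]
  ext p
  ring

/-! ### Integration over rectangles -/

/-- The affine map of the plane with given matrix and translation part. -/
noncomputable def planeMap (a b c d e h : ℝ) (p : Plane) : Plane :=
  !₂[a * p 0 + b * p 1 + e, c * p 0 + d * p 1 + h]

theorem planeMap_zero (a b c d e h : ℝ) (p : Plane) :
    planeMap a b c d e h p 0 = a * p 0 + b * p 1 + e := rfl

theorem planeMap_one (a b c d e h : ℝ) (p : Plane) :
    planeMap a b c d e h p 1 = c * p 0 + d * p 1 + h := rfl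

theorem measurePreserving_planeMap {a b c d : ℝ} (h1 : a ^ 2 + c ^ 2 = 1) (h2 : b ^ 2 + d ^ 2 = 1)
    (h3 : a * b + c * d = 0) (e h : ℝ) :
    MeasurePreserving (planeMap a b c d e h) ∧ MeasurableEmbedding (planeMap a b c d e h) := by
  let L : Plane →ₗ[ℝ] Plane :=
    { toFun := fun p => !₂[a * p 0 + b * p 1, c * p 0 + d * p 1]
      map_add' := fun p q => by ext i; fin_cases i <;> simp <;> ring
      map_smul' := fun r p => by ext i; fin_cases i <;> simp <;> ring }
  have hL : ∀ p, ‖L p‖ = ‖p‖ := fun p => by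
    rw [EuclideanSpace.norm_eq, EuclideanSpace.norm_eq]
    congr 1
    simp only [L, LinearMap.coe_mk, AddHom.coe_mk, Fin.sum_univ_two, Real.norm_eq_abs, sq_abs]
    simp
    linear_combination (p 0) ^ 2 * h1 + (p 1) ^ 2 * h2 + 2 * p 0 * p 1 * h3
  let Li : Plane →ₗᵢ[ℝ] Plane := ⟨L, hL⟩
  let Le : Plane ≃ₗᵢ[ℝ] Plane := Li.toLinearIsometryEquiv rfl
  have key : planeMap a b c d e h = fun p => Le p + !₂[e, h] := by
    ext p i
    fin_cases i <;> simp [planeMap, Le, Li, L]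
  rw [key]
  refine ⟨(measurePreserving_add_right volume !₂[e, h]).comp Le.measurePreserving, ?_⟩
  exact (measurableEmbedding_addRight (!₂[e, h] : Plane)).comp
    Le.toHomeomorph.measurableEmbedding

/-- The plane as a product, measurably. -/
noncomputable def planeEquiv : Plane ≃ᵐ ℝ × ℝ :=
  (MeasurableEquiv.toLp 2 (Fin 2 → ℝ)).symm.trans MeasurableEquiv.finTwoArrow

theorem planeEquiv_apply (p : Plane) : planeEquiv p = (p 0, p 1) := rfl

theorem measurePreserving_planeEquiv : MeasurePreserving planeEquiv :=
  (EuclideanSpace.volume_preserving_symm_measurableEquiv_toLp (Fin 2)).trans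
    (volume_preserving_finTwoArrow ℝ)

theorem volume_line_eq_zero (a b c : ℝ) (hb : b ≠ 0) :
    volume {p : Plane | a * p 0 + b * p 1 = c} = 0 := by
  have hm : MeasurableSet {z : ℝ × ℝ | a * z.1 + b * z.2 = c} :=
    measurableSet_eq_fun (by fun_prop) (by fun_prop)
  have e : {p : Plane | a * p 0 + b * p 1 = c} =
      planeEquiv ⁻¹' {z : ℝ × ℝ | a * z.1 + b * z.2 = c} := rfl
  rw [e, measurePreserving_planeEquiv.measure_preimage hm.nullMeasurableSet,
    Measure.volume_eq_prod, Measure.measure_prod_null hm]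
  refine Filter.Eventually.of_forall fun x => ?_
  refine measure_mono_null (t := {(c - a * x) / b}) (fun y hy => ?_) (by simp)
  have hy : a * x + b * y = c := hy
  rw [Set.mem_singleton_iff, eq_div_iff hb]
  linarith

/-- The open rectangle `(0, A) × (0, B)`. -/
def rect (A B : ℝ) : Set Plane := {p | 0 < p 0 ∧ p 0 < A ∧ 0 < p 1 ∧ p 1 < B}

theorem isOpen_rect (A B : ℝ) : IsOpen (rect A B) := by
  have h0 : Continuous fun p : Plane => p 0 := by fun_prop
  have h1 : Continuous fun p : Plane => p 1 := by fun_prop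
  exact (isOpen_lt continuous_const h0).inter ((isOpen_lt h0 continuous_const).inter
    ((isOpen_lt continuous_const h1).inter (isOpen_lt h1 continuous_const)))

theorem rect_subset_closedBall (A B : ℝ) :
    rect A B ⊆ Metric.closedBall (0 : Plane) (√(A ^ 2 + B ^ 2)) := by
  rintro p ⟨h1, h2, h3, h4⟩
  rw [mem_closedBall_zero_iff, EuclideanSpace.norm_eq]
  apply Real.sqrt_le_sqrt
  simp only [Fin.sum_univ_two, Real.norm_eq_abs, sq_abs]
  gcongr

theorem integrableOn_rect {F : Plane → ℝ} (hF : Continuous F) (A B : ℝ) :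
    IntegrableOn F (rect A B) :=
  (hF.continuousOn.integrableOn_compact (isCompact_closedBall _ _)).mono_set
    (rect_subset_closedBall A B)

theorem setIntegral_rect {F : Plane → ℝ} (hF : Continuous F) {A B : ℝ} (hA : 0 ≤ A) (hB : 0 ≤ B) :
    ∫ p in rect A B, F p = ∫ x in (0 : ℝ)..A, ∫ y in (0 : ℝ)..B, F !₂[x, y] := by
  have e : rect A B = planeEquiv ⁻¹' (Set.Ioo 0 A ×ˢ Set.Ioo 0 B) := by
    ext p
    simp only [rect, Set.mem_ofPred_eq, Set.mem_preimage, planeEquiv_apply, Set.mem_prod,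
      Set.mem_Ioo, and_assoc]
  have e2 : ∀ p : Plane, F p = (fun z : ℝ × ℝ => F !₂[z.1, z.2]) (planeEquiv p) := fun p => by
    simp only [planeEquiv_apply]
    congr 1
    ext i; fin_cases i <;> rfl
  have hint : IntegrableOn (fun z : ℝ × ℝ => F !₂[z.1, z.2]) (Set.Ioo 0 A ×ˢ Set.Ioo 0 B) := by
    rw [← measurePreserving_planeEquiv.integrableOn_comp_preimage planeEquiv.measurableEmbedding,
      ← e]
    exact (integrableOn_rect hF A B).congr_fun (fun p _ => e2 p) (isOpen_rect A B).measurableSet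
  refine (integral_congr_ae (Filter.Eventually.of_forall e2)).trans ?_
  rw [e, measurePreserving_planeEquiv.setIntegral_preimage_emb planeEquiv.measurableEmbedding
    (fun z : ℝ × ℝ => F !₂[z.1, z.2]), Measure.volume_eq_prod, setIntegral_prod _ hint,
    intervalIntegral.integral_of_le hA, integral_Ioc_eq_integral_Ioo]
  simp_rw [intervalIntegral.integral_of_le hB, integral_Ioc_eq_integral_Ioo]

/-! ### Folding the rectangle into the triangle -/

/-- The reflection of the plane in the hypotenuse of the triangle. -/
noncomputable def foldRefl : Plane → Plane :=
  planeMap (-1 / 2) (-√3 / 2) (-√3 / 2) (1 / 2) (√3 / 2) (1 / 2)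

/-- The rotation by `60°` about the vertex `(0, 1)` of the triangle. -/
noncomputable def foldRot : Plane → Plane :=
  planeMap (1 / 2) (√3 / 2) (-√3 / 2) (1 / 2) (-√3 / 2) (1 / 2)

/-- The half-turn about the centre of the rectangle `(0, √3) × (0, 1)`. -/
noncomputable def foldTurn : Plane → Plane := planeMap (-1) 0 0 (-1) √3 1

theorem sqrt_three_sq : (√3 : ℝ) ^ 2 = 3 := Real.sq_sqrt (by norm_num)

theorem foldRefl_mp : MeasurePreserving foldRefl ∧ MeasurableEmbedding foldRefl :=
  measurePreserving_planeMap (by linarith [sqrt_three_sq, show (-√3 / 2 : ℝ) ^ 2 = √3 ^ 2 / 4 by ring])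
    (by linarith [sqrt_three_sq, show (-√3 / 2 : ℝ) ^ 2 = √3 ^ 2 / 4 by ring]) (by ring) _ _

theorem foldRot_mp : MeasurePreserving foldRot ∧ MeasurableEmbedding foldRot :=
  measurePreserving_planeMap (by linarith [sqrt_three_sq, show (-√3 / 2 : ℝ) ^ 2 = √3 ^ 2 / 4 by ring])
    (by linarith [sqrt_three_sq, show (√3 / 2 : ℝ) ^ 2 = √3 ^ 2 / 4 by ring]) (by ring) _ _

theorem foldTurn_mp : MeasurePreserving foldTurn ∧ MeasurableEmbedding foldTurn :=
  measurePreserving_planeMap (by ring) (by ring) (by ring) _ _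

/-- Functions on the plane that are invariant under the three folding maps. -/
structure FoldInvariant (F : Plane → ℝ) : Prop where
  refl : ∀ p, F (foldRefl p) = F p
  rot : ∀ p, F (foldRot p) = F p
  turn : ∀ p, F (foldTurn p) = F p

theorem mode_foldRefl (m q : ℤ) (p : Plane) : mode m q (foldRefl p) = -mode m q p := by
  have h : (√3 : ℝ) ≠ 0 := by positivity
  have h3 := sqrt_three_sq
  rw [mode, mode, ← trigMode_reflect]
  congr 1
  · simp only [foldRefl, planeMap_zero]
    field_simp
    ring
  · simp only [foldRefl, planeMap_one]
    field_simp
    linear_combination p 0 * h3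

theorem mode_foldRot (m q : ℤ) (p : Plane) : mode m q (foldRot p) = mode m q p := by
  have e : mode m q (foldRot p) = -mode m q (foldRefl p) := by
    rw [mode, mode, ← trigMode_neg_left]
    congr 1
    · simp only [foldRot, foldRefl, planeMap_zero]
      ring
  rw [e, mode_foldRefl, neg_neg]

theorem mode_foldTurn (m q : ℤ) (p : Plane) : mode m q (foldTurn p) = mode m q p := by
  have h : (√3 : ℝ) ≠ 0 := by positivity
  rw [mode, mode, ← trigMode_pi_sub]
  congr 1
  · simp only [foldTurn, planeMap_zero]
    field_simp
    ring
  · simp only [foldTurn, planeMap_one]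
    ring

theorem setIntegral_preimage_eq {f : Plane → Plane}
    (hf : MeasurePreserving f ∧ MeasurableEmbedding f) {F : Plane → ℝ} (hF : ∀ p, F (f p) = F p)
    (s : Set Plane) : ∫ p in f ⁻¹' s, F p = ∫ p in s, F p := by
  have := hf.1.setIntegral_preimage_emb hf.2 F s
  simpa only [hF] using this

theorem isOpen_triangle : IsOpen triangle := by
  have h0 : Continuous fun p : Plane => p 0 := by fun_prop
  have h1 : Continuous fun p : Plane => p 1 := by fun_prop
  exact (isOpen_lt continuous_const h0).inter ((isOpen_lt continuous_const h1).inter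
    (isOpen_lt ((continuous_const.mul h0).add h1) continuous_const))

theorem mem_triangle {p : Plane} : p ∈ triangle ↔ 0 < √3 * p 0 ∧ 0 < p 1 ∧ √3 * p 0 + p 1 < 1 := by
  have h : (0 : ℝ) < √3 := by positivity
  simp [triangle, h]

theorem mem_rect_iff {p : Plane} : p ∈ rect √3 1 ↔
    0 < √3 * p 0 ∧ √3 * p 0 < 3 ∧ 0 < p 1 ∧ p 1 < 1 := by
  have h : (0 : ℝ) < √3 := by positivity
  have e : √3 * p 0 < 3 ↔ p 0 < √3 := by
    have h2 : √3 * p 0 < √3 * √3 ↔ p 0 < √3 := mul_lt_mul_iff_right₀ h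
    rwa [Real.mul_self_sqrt (by norm_num)] at h2
  simp [rect, h, e]

theorem foldRefl_mem {p : Plane} : foldRefl p ∈ triangle ↔
    √3 * p 0 + 3 * p 1 < 3 ∧ √3 * p 0 < p 1 + 1 ∧ 1 < √3 * p 0 + p 1 := by
  have h3 := sqrt_three_sq
  rw [mem_triangle]
  simp only [foldRefl, planeMap_zero, planeMap_one]
  have e : √3 * (-1 / 2 * p 0 + -√3 / 2 * p 1 + √3 / 2) = (3 - √3 * p 0 - 3 * p 1) / 2 := by
    linear_combination (1 - p 1) / 2 * h3
  rw [e]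
  constructor
  · rintro ⟨h1, h2, h4⟩
    refine ⟨?_, ?_, ?_⟩ <;> linarith
  · rintro ⟨h1, h2, h4⟩
    refine ⟨?_, ?_, ?_⟩ <;> linarith

theorem foldRot_mem {p : Plane} : foldRot p ∈ triangle ↔
    3 < √3 * p 0 + 3 * p 1 ∧ √3 * p 0 < p 1 + 1 ∧ p 1 < 1 := by
  have h3 := sqrt_three_sq
  rw [mem_triangle]
  simp only [foldRot, planeMap_zero, planeMap_one]
  have e : √3 * (1 / 2 * p 0 + √3 / 2 * p 1 + -√3 / 2) = -(3 - √3 * p 0 - 3 * p 1) / 2 := by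
    linear_combination (p 1 - 1) / 2 * h3
  rw [e]
  constructor
  · rintro ⟨h1, h2, h4⟩
    refine ⟨?_, ?_, ?_⟩ <;> linarith
  · rintro ⟨h1, h2, h4⟩
    refine ⟨?_, ?_, ?_⟩ <;> linarith

/-- The part of the rectangle `(0, √3) × (0, 1)` above the line `y = √3 x - 1`, which is tiled by
three copies of the triangle. -/
def halfRect : Set Plane := {p | p ∈ rect √3 1 ∧ √3 * p 0 < p 1 + 1}

theorem ae_not_line (a b c : ℝ) (hb : b ≠ 0) : ∀ᵐ p : Plane, a * p 0 + b * p 1 ≠ c :=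
  measure_eq_zero_iff_ae_notMem.1 (volume_line_eq_zero a b c hb)

theorem halfRect_ae_eq :
    halfRect =ᵐ[volume] ((triangle ∪ foldRefl ⁻¹' triangle) ∪ foldRot ⁻¹' triangle : Set Plane) := by
  filter_upwards [ae_not_line √3 1 1 one_ne_zero, ae_not_line √3 3 3 three_ne_zero] with p h1 h2
  refine propext ?_
  change p ∈ halfRect ↔ (p ∈ triangle ∨ foldRefl p ∈ triangle) ∨ foldRot p ∈ triangle
  rw [foldRefl_mem, foldRot_mem, mem_triangle]
  change p ∈ rect √3 1 ∧ _ ↔ _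
  rw [mem_rect_iff]
  rw [one_mul] at h1
  constructor
  · rintro ⟨⟨ha, hb, hc, hd⟩, he⟩
    rcases lt_or_gt_of_ne h1 with h1 | h1
    · exact Or.inl (Or.inl ⟨ha, hc, h1⟩)
    rcases lt_or_gt_of_ne h2 with h2 | h2
    · exact Or.inl (Or.inr ⟨h2, he, h1⟩)
    · exact Or.inr ⟨h2, he, hd⟩
  · rintro ((⟨ha, hb, hc⟩ | ⟨ha, hb, hc⟩) | ⟨ha, hb, hc⟩) <;>
      refine ⟨⟨?_, ?_, ?_, ?_⟩, ?_⟩ <;> linarith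

theorem triangle_subset_rect : triangle ⊆ rect √3 1 := by
  intro p hp
  rw [mem_triangle] at hp
  rw [mem_rect_iff]
  obtain ⟨h1, h2, h3⟩ := hp
  refine ⟨?_, ?_, ?_, ?_⟩ <;> linarith

/-- The rectangle `(0, √3) × (0, 1)` above the line `y = √3 x - 1` is three copies of the
triangle. -/
theorem setIntegral_halfRect {F : Plane → ℝ} (hF : Continuous F) (hi : FoldInvariant F) :
    ∫ p in halfRect, F p = 3 * ∫ p in triangle, F p := by
  have hT := isOpen_triangle.measurableSet
  have m1 : MeasurableSet (foldRefl ⁻¹' triangle) := foldRefl_mp.1.measurable hT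
  have m2 : MeasurableSet (foldRot ⁻¹' triangle) := foldRot_mp.1.measurable hT
  have hsub : foldRefl ⁻¹' triangle ⊆ rect √3 1 := fun p hp => by
    have hp : foldRefl p ∈ triangle := hp
    rw [foldRefl_mem] at hp
    rw [mem_rect_iff]
    obtain ⟨h1, h2, h3⟩ := hp
    refine ⟨?_, ?_, ?_, ?_⟩ <;> linarith
  have hsub2 : foldRot ⁻¹' triangle ⊆ rect √3 1 := fun p hp => by
    have hp : foldRot p ∈ triangle := hp
    rw [foldRot_mem] at hp
    rw [mem_rect_iff]
    obtain ⟨h1, h2, h3⟩ := hp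
    refine ⟨?_, ?_, ?_, ?_⟩ <;> linarith
  have hR := integrableOn_rect hF √3 1
  have i0 := hR.mono_set triangle_subset_rect
  have i1 := hR.mono_set hsub
  have i2 := hR.mono_set hsub2
  rw [setIntegral_congr_set halfRect_ae_eq, setIntegral_union _ m2 (i0.union i1) i2,
    setIntegral_union _ m1 i0 i1, setIntegral_preimage_eq foldRefl_mp hi.refl,
    setIntegral_preimage_eq foldRot_mp hi.rot]
  · ring
  · refine Set.disjoint_left.2 fun p hp hp' => ?_
    have hp' : foldRefl p ∈ triangle := hp'
    rw [foldRefl_mem] at hp'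
    rw [mem_triangle] at hp
    linarith [hp.2.2, hp'.2.2]
  · refine Set.disjoint_left.2 fun p hp hp' => ?_
    have hp' : foldRot p ∈ triangle := hp'
    rw [foldRot_mem] at hp'
    rcases hp with hp | hp
    · rw [mem_triangle] at hp
      obtain ⟨h1, h2, h3⟩ := hp
      obtain ⟨h4, h5, h6⟩ := hp'
      linarith
    · have hp : foldRefl p ∈ triangle := hp
      rw [foldRefl_mem] at hp
      linarith [hp.1, hp'.1]

/-- Six copies of the triangle tile the rectangle `(0, √3) × (0, 1)`. -/
theorem setIntegral_rect_eq {F : Plane → ℝ} (hF : Continuous F) (hi : FoldInvariant F) :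
    ∫ p in rect √3 1, F p = 6 * ∫ p in triangle, F p := by
  have hm : MeasurableSet halfRect := by
    have : IsOpen {p : Plane | √3 * p 0 < p 1 + 1} :=
      isOpen_lt (by fun_prop) (by fun_prop)
    exact ((isOpen_rect _ _).inter this).measurableSet
  have mt : ∀ p : Plane, foldTurn p ∈ halfRect ↔ p ∈ rect √3 1 ∧ p 1 + 1 < √3 * p 0 := by
    intro p
    change foldTurn p ∈ rect √3 1 ∧ _ ↔ _
    rw [mem_rect_iff, mem_rect_iff]
    simp only [foldTurn, planeMap_zero, planeMap_one]
    have e : √3 * (-1 * p 0 + 0 * p 1 + √3) = 3 - √3 * p 0 := by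
      linear_combination sqrt_three_sq
    rw [e]
    constructor <;> rintro ⟨⟨h1, h2, h3, h4⟩, h5⟩ <;> refine ⟨⟨?_, ?_, ?_, ?_⟩, ?_⟩ <;> linarith
  have hae : (rect √3 1) =ᵐ[volume] (halfRect ∪ foldTurn ⁻¹' halfRect : Set Plane) := by
    filter_upwards [ae_not_line √3 (-1) 1 (by norm_num)] with p h1
    refine propext ?_
    change p ∈ rect √3 1 ↔ p ∈ halfRect ∨ foldTurn p ∈ halfRect
    rw [mt]
    constructor
    · intro h
      rcases lt_or_gt_of_ne h1 with h1 | h1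
      · exact Or.inl ⟨h, by linarith⟩
      · exact Or.inr ⟨h, by linarith⟩
    · rintro (h | h)
      exacts [h.1, h.1]
  have hR := integrableOn_rect hF √3 1
  rw [setIntegral_congr_set hae, setIntegral_union _ (foldTurn_mp.1.measurable hm)
    (hR.mono_set fun p hp => hp.1) (hR.mono_set fun p hp => ((mt p).1 hp).1),
    setIntegral_preimage_eq foldTurn_mp hi.turn, setIntegral_halfRect hF hi]
  · ring
  · refine Set.disjoint_left.2 fun p hp hp' => ?_
    linarith [((mt p).1 hp').2, hp.2]

/-- Points of the triangle close to the vertical leg, or to the hypotenuse, lie in the strip region.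
At the hypotenuse `√3 x + y = 1` the width in terms of `√3 x + y` is `2 α`. -/
theorem mem_stripRegion {α : ℝ} (hα₁ : α ≤ 1 / (3 + √3)) {p : Plane} (hp : p ∈ triangle)
    (h : p 0 < α ∨ 1 - 2 * α < √3 * p 0 + p 1) : p ∈ stripRegion α := by
  refine ⟨hp, fun hc => ?_⟩
  have hr : 0 ≤ ratio α := by
    rw [ratio]
    rw [le_div_iff₀ (by positivity)] at hα₁
    linarith
  have hcl : IsClosed {p : Plane | α ≤ p 0 ∧ √3 * p 0 + p 1 ≤ 1 - 2 * α} :=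
    (isClosed_le (g := fun p : Plane => p 0) continuous_const (by fun_prop)).inter
      (isClosed_le (f := fun p : Plane => √3 * p 0 + p 1) (by fun_prop) continuous_const)
  have hsub : (fun x : Plane => ratio α • x + !₂[α, α]) '' triangle ⊆
      {p : Plane | α ≤ p 0 ∧ √3 * p 0 + p 1 ≤ 1 - 2 * α} := by
    rintro _ ⟨x, ⟨h1, h2, h3⟩, rfl⟩
    simp only [Set.mem_ofPred_eq, PiLp.add_apply, PiLp.smul_apply, smul_eq_mul,
      Matrix.cons_val_zero, Matrix.cons_val_one]
    constructor
    · nlinarith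
    · have : ratio α * (√3 * x 0 + x 1) ≤ ratio α * 1 := by gcongr
      have e : ratio α = 1 - α * (3 + √3) := rfl
      nlinarith
  have := closure_minimal hsub hcl hc
  rcases h with h | h
  · exact absurd this.1 (not_le.2 h)
  · exact absurd this.2 (not_le.2 h)

theorem measurableSet_stripRegion (α : ℝ) : MeasurableSet (stripRegion α) :=
  isOpen_triangle.measurableSet.diff isClosed_closure.measurableSet

theorem setIntegral_union_le_add {F : Plane → ℝ} (hF : ∀ p, 0 ≤ F p) {s t : Set Plane}
    (ht : MeasurableSet t) (hs : IntegrableOn F s) (hti : IntegrableOn F t) (hms : MeasurableSet s) :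
    ∫ p in s ∪ t, F p ≤ (∫ p in s, F p) + ∫ p in t, F p := by
  rw [← Set.union_sdiff_self, setIntegral_union Set.disjoint_sdiff_right (ht.diff hms) hs
    (hti.mono_set Set.sdiff_subset)]
  refine add_le_add le_rfl ?_
  exact setIntegral_mono_set hti (Filter.Eventually.of_forall hF)
    (Set.sdiff_subset).eventuallyLE

/-- The vertical strip of width `α` meets three tiles only, and is folded into the strip
region of the triangle. -/
theorem setIntegral_strip_le {F : Plane → ℝ} (hF : Continuous F) (h0 : ∀ p, 0 ≤ F p)
    (hi : FoldInvariant F) {α : ℝ} (hα₀ : 0 < α) (hα₁ : α ≤ 1 / (3 + √3)) :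
    ∫ p in rect α 1, F p ≤ 3 * ∫ p in stripRegion α, F p := by
  have h3 := sqrt_three_sq
  have hs3 : (0 : ℝ) < √3 := by positivity
  have hs3' : √3 ≤ 1.74 := Real.sqrt_le_iff.2 ⟨by norm_num, by norm_num⟩
  have hα := width_le hα₁
  have hS := measurableSet_stripRegion α
  have hsubT : stripRegion α ⊆ triangle := Set.sdiff_subset
  have hiS : IntegrableOn F (stripRegion α) :=
    (integrableOn_rect hF √3 1).mono_set (hsubT.trans triangle_subset_rect)
  have himg : ∀ {f : Plane → Plane}, MeasurePreserving f ∧ MeasurableEmbedding f →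
      (∀ p, F (f p) = F p) → IntegrableOn F (f ⁻¹' stripRegion α) := by
    intro f hf hfF
    have := (hf.1.integrableOn_comp_preimage hf.2).2 hiS
    have e : F ∘ f = F := funext hfF
    rwa [e] at this
  have hae : (rect α 1) ≤ᵐ[volume] ((stripRegion α ∪ foldRefl ⁻¹' stripRegion α) ∪
      foldRot ⁻¹' stripRegion α : Set Plane) := by
    filter_upwards [ae_not_line √3 1 1 one_ne_zero, ae_not_line √3 3 3 three_ne_zero] with p h1 h2
    rintro ⟨ha, hb, hc, hd⟩
    rw [one_mul] at h1
    have hX : √3 * p 0 < √3 * α := by gcongr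
    have hX0 : 0 < √3 * p 0 := by positivity
    have hX1 : √3 * p 0 < 1 := by nlinarith
    rcases lt_or_gt_of_ne h1 with h1 | h1
    · exact Or.inl (Or.inl (mem_stripRegion hα₁ (mem_triangle.2 ⟨hX0, hc, h1⟩) (Or.inl hb)))
    rcases lt_or_gt_of_ne h2 with h2 | h2
    · refine Or.inl (Or.inr (mem_stripRegion hα₁ (foldRefl_mem.2 ⟨h2, by linarith, h1⟩)
        (Or.inr ?_)))
      simp only [foldRefl, planeMap_zero, planeMap_one]
      have e : √3 * (-1 / 2 * p 0 + -√3 / 2 * p 1 + √3 / 2) = (3 - √3 * p 0 - 3 * p 1) / 2 := by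
        linear_combination (1 - p 1) / 2 * h3
      rw [e]
      nlinarith
    · refine Or.inr (mem_stripRegion hα₁ (foldRot_mem.2 ⟨h2, by linarith, hd⟩) (Or.inl ?_))
      simp only [foldRot, planeMap_zero]
      nlinarith
  have i1 := himg foldRefl_mp hi.refl
  have i2 := himg foldRot_mp hi.rot
  have m1 := foldRefl_mp.1.measurable hS
  have m2 := foldRot_mp.1.measurable hS
  calc ∫ p in rect α 1, F p ≤ ∫ p in (stripRegion α ∪ foldRefl ⁻¹' stripRegion α) ∪
      foldRot ⁻¹' stripRegion α, F p :=
        setIntegral_mono_set ((hiS.union i1).union i2) (Filter.Eventually.of_forall h0) hae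
    _ ≤ ((∫ p in stripRegion α, F p) + ∫ p in foldRefl ⁻¹' stripRegion α, F p) +
        ∫ p in foldRot ⁻¹' stripRegion α, F p :=
      (setIntegral_union_le_add h0 m2 (hiS.union i1) i2 (hS.union m1)).trans
        (add_le_add (setIntegral_union_le_add h0 m1 hiS i1 hS) le_rfl)
    _ = _ := by
      rw [setIntegral_preimage_eq foldRefl_mp hi.refl, setIntegral_preimage_eq foldRot_mp hi.rot]
      ring

/-! ### Orthogonality of the modes -/

/-- Row data `(μ, l)` of the three plane waves in a mode, whose wave numbers are
`(μ + 2 l, μ)`. -/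
def row (m q : ℤ) : Fin 3 → ℤ × ℤ := ![(m, q), (q, m), (m + q, -m)]

/-- The signs of the three plane waves in a mode. -/
def rowSign : Fin 3 → ℝ := ![1, -1, 1]

theorem rowSign_sq (i : Fin 3) : rowSign i ^ 2 = 1 := by
  fin_cases i <;> simp [rowSign]

open Real in
theorem mode_eq_sum (m q : ℤ) (p : Plane) : mode m q p = ∑ i, rowSign i *
    (sin (((row m q i).1 + 2 * (row m q i).2 : ℤ) * (π / √3 * p 0)) *
      sin ((row m q i).1 * (π * (1 - p 1)))) := by
  rw [Fin.sum_univ_three]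
  simp [mode, trigMode, row, rowSign]
  ring_nf

theorem row_pos {m q : ℤ} (hm : 0 < m) (hq : m < q) (i : Fin 3) :
    0 < (row m q i).1 ∧ 0 < (row m q i).1 + 2 * (row m q i).2 := by
  fin_cases i <;> simp [row] <;> constructor <;> omega

theorem row_inj {m q m' q' : ℤ} (hm : 0 < m) (hq : m < q) (hm' : 0 < m') (hq' : m' < q')
    {i i' : Fin 3} (h : row m q i = row m' q' i') : m = m' ∧ q = q' ∧ i = i' := by
  fin_cases i <;> fin_cases i' <;> simp [row] at h ⊢ <;> omega

theorem row_zero_lt {m q : ℤ} (hq : m < q) : (row m q 0).1 < (row m q 0).2 := by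
  simpa [row] using hq

theorem eigenvalue_row (m q : ℤ) (i : Fin 3) :
    freq (row m q i).1 (row m q i).2 = √(eigenvalue m q) := by
  have e : eigenvalue m q = Real.pi ^ 2 *
      ((((row m q i).1 : ℝ) + 2 * (row m q i).2) ^ 2 / 3 + ((row m q i).1 : ℝ) ^ 2) := by
    fin_cases i <;> simp [row, eigenvalue] <;> ring
  rw [e, Real.sqrt_mul (by positivity), Real.sqrt_sq Real.pi_pos.le, freq]

open Real in
theorem integral_sin_mul_sin {L : ℝ} (hL : 0 < L) {k k' : ℤ} (hk : 0 < k) (hk' : 0 < k') :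
    ∫ x in (0 : ℝ)..L, sin (k * (π / L * x)) * sin (k' * (π / L * x)) =
      if k = k' then L / 2 else 0 := by
  have hπ := pi_pos
  have hcos : ∀ n : ℤ, n ≠ 0 → ∫ x in (0 : ℝ)..L, cos (n * (π / L * x)) = 0 := by
    intro n hn
    have hn' : (n : ℝ) ≠ 0 := by exact_mod_cast hn
    have hne : (n : ℝ) * (π / L) ≠ 0 := by positivity
    simp_rw [← mul_assoc]
    rw [intervalIntegral.integral_comp_mul_left (fun x => cos x) hne, integral_cos, mul_zero,
      sin_zero, mul_assoc (n : ℝ), div_mul_cancel₀ _ hL.ne', sin_int_mul_pi]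
    simp
  have e : ∀ x, sin (k * (π / L * x)) * sin (k' * (π / L * x)) =
      2⁻¹ * (cos ((k - k' : ℤ) * (π / L * x)) - cos ((k + k' : ℤ) * (π / L * x))) := by
    intro x
    push_cast
    rw [sub_mul, add_mul, cos_sub, cos_add]
    ring
  simp_rw [e]
  rw [intervalIntegral.integral_const_mul, intervalIntegral.integral_sub
    (Continuous.intervalIntegrable (by fun_prop) _ _)
    (Continuous.intervalIntegrable (by fun_prop) _ _), hcos (k + k') (by omega)]
  split_ifs with h
  · subst h
    simp
    ring
  · rw [hcos _ (sub_ne_zero.2 h)]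
    simp

open Real in
theorem integral_sin_mul_sin' {k k' : ℤ} (hk : 0 < k) (hk' : 0 < k') :
    ∫ y in (0 : ℝ)..1, sin (k * (π * (1 - y))) * sin (k' * (π * (1 - y))) =
      if k = k' then 1 / 2 else 0 := by
  rw [intervalIntegral.integral_comp_sub_left (fun y => sin (k * (π * y)) * sin (k' * (π * y)))]
  have := integral_sin_mul_sin one_pos hk hk'
  simpa using this

open Real in
theorem integral_rect_sin {k k' μ μ' : ℤ} (hk : 0 < k) (hk' : 0 < k') (hμ : 0 < μ) (hμ' : 0 < μ') :
    ∫ p in rect √3 1, (sin (k * (π / √3 * p 0)) * sin (μ * (π * (1 - p 1)))) *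
      (sin (k' * (π / √3 * p 0)) * sin (μ' * (π * (1 - p 1)))) =
      if k = k' ∧ μ = μ' then √3 / 4 else 0 := by
  rw [setIntegral_rect (by fun_prop) (by positivity) zero_le_one]
  have e : ∀ x : ℝ, ∫ y in (0 : ℝ)..1, (sin (k * (π / √3 * (!₂[x, y] : Plane) 0)) *
      sin (μ * (π * (1 - (!₂[x, y] : Plane) 1)))) *
      (sin (k' * (π / √3 * (!₂[x, y] : Plane) 0)) * sin (μ' * (π * (1 - (!₂[x, y] : Plane) 1)))) =
      (if μ = μ' then 1 / 2 else 0) * (sin (k * (π / √3 * x)) * sin (k' * (π / √3 * x))) := by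
    intro x
    rw [← integral_sin_mul_sin' hμ hμ', ← intervalIntegral.integral_mul_const]
    refine intervalIntegral.integral_congr fun y _ => ?_
    simp only [Matrix.cons_val_zero, Matrix.cons_val_one]
    ring
  simp_rw [e]
  rw [intervalIntegral.integral_const_mul, integral_sin_mul_sin (by positivity) hk hk']
  by_cases h1 : k = k' <;> by_cases h2 : μ = μ' <;> simp [h1, h2]
  ring

theorem foldInvariant_mode_mul (m q m' q' : ℤ) :
    FoldInvariant fun p => mode m q p * mode m' q' p where
  refl p := by simp only [mode_foldRefl]; ring
  rot p := by simp only [mode_foldRot]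
  turn p := by simp only [mode_foldTurn]

/-- Orthogonality of the modes in the triangle. -/
theorem integral_mode_mul_mode {m q m' q' : ℤ} (hm : 0 < m) (hq : m < q) (hm' : 0 < m')
    (hq' : m' < q') : ∫ p in triangle, mode m q p * mode m' q' p =
      if m = m' ∧ q = q' then √3 / 8 else 0 := by
  have h6 := setIntegral_rect_eq (F := fun p => mode m q p * mode m' q' p)
    ((continuous_mode m q).mul (continuous_mode m' q')) (foldInvariant_mode_mul m q m' q')
  have e : ∫ p in rect √3 1, mode m q p * mode m' q' p =
      ∑ i : Fin 3, ∑ i' : Fin 3, if i = i' ∧ m = m' ∧ q = q' then √3 / 4 else 0 := by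
    simp_rw [mode_eq_sum, Finset.sum_mul_sum]
    rw [integral_finsetSum]
    swap
    · intro i _
      exact integrableOn_rect (by fun_prop) _ _
    refine Finset.sum_congr rfl fun i _ => ?_
    rw [integral_finsetSum]
    swap
    · intro i' _
      exact integrableOn_rect (by fun_prop) _ _
    refine Finset.sum_congr rfl fun i' _ => ?_
    obtain ⟨h1, h2⟩ := row_pos hm hq i
    obtain ⟨h1', h2'⟩ := row_pos hm' hq' i'
    have := integral_rect_sin h2 h2' h1 h1'
    simp_rw [mul_mul_mul_comm (rowSign i)]
    rw [integral_const_mul, this]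
    by_cases h : i = i' ∧ m = m' ∧ q = q'
    · obtain ⟨rfl, rfl, rfl⟩ := h
      simp [← sq, rowSign_sq]
    · rw [if_neg h, if_neg, mul_zero]
      rintro ⟨ha, hb⟩
      have hr : row m q i = row m' q' i' := Prod.ext hb (by omega)
      obtain ⟨h3, h4, h5⟩ := row_inj hm hq hm' hq' hr
      exact h ⟨h5, h3, h4⟩
  rw [e] at h6
  by_cases h : m = m' ∧ q = q'
  · simp only [h, and_self, and_true, if_true, Finset.sum_ite_eq, Finset.mem_univ,
      Finset.sum_const, Finset.card_univ, Fintype.card_fin, nsmul_eq_mul] at h6 ⊢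
    push_cast at h6
    linarith
  · simp only [h, and_false, if_false, Finset.sum_const_zero] at h6 ⊢
    linarith

/-! ### Observability for finite sums of modes -/

/-- Indices of the modes in the orthogonal basis. -/
abbrev ModeIdx : Type := {j : ℤ × ℤ // 0 < j.1 ∧ j.1 < j.2}

/-- The modes of the orthogonal basis. -/
noncomputable def modeOf (j : ModeIdx) : Plane → ℝ := mode j.1.1 j.1.2

/-- The square roots of the eigenvalues. -/
noncomputable def omega (j : ModeIdx) : ℝ := √(eigenvalue j.1.1 j.1.2)

theorem eigenvalue_pos (j : ModeIdx) : 0 < eigenvalue j.1.1 j.1.2 := by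
  have h1 : (0 : ℝ) < j.1.1 := by exact_mod_cast j.2.1
  have h2 : (0 : ℝ) < j.1.2 := by exact_mod_cast j.2.1.trans j.2.2
  have := Real.pi_pos
  unfold eigenvalue
  positivity

theorem omega_pos (j : ModeIdx) : 0 < omega j := Real.sqrt_pos.2 (eigenvalue_pos j)

theorem omega_sq (j : ModeIdx) : omega j ^ 2 = eigenvalue j.1.1 j.1.2 :=
  Real.sq_sqrt (eigenvalue_pos j).le

/-- The row `(μ, l)` of a plane wave occurring in a basis mode. -/
def waveRow (a : ModeIdx × Fin 3) : ℤ × ℤ := row a.1.1.1 a.1.1.2 a.2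

open Real in
/-- The trace on a vertical line of the `x`-factor of a plane wave, with its sign. -/
noncomputable def waveFactor (a : ModeIdx × Fin 3) (x : ℝ) : ℝ :=
  rowSign a.2 * sin (((waveRow a).1 + 2 * (waveRow a).2 : ℤ) * (π / √3 * x))

theorem continuous_waveFactor (a : ModeIdx × Fin 3) : Continuous (waveFactor a) := by
  unfold waveFactor
  fun_prop

open Real in
theorem waveFactor_sq (a : ModeIdx × Fin 3) (x : ℝ) : waveFactor a x ^ 2 =
    sin (((waveRow a).1 + 2 * (waveRow a).2 : ℤ) * (π * x / √3)) ^ 2 := by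
  rw [waveFactor, mul_pow, rowSign_sq, one_mul]
  congr 3
  ring

theorem waveRow_inj {a b : ModeIdx × Fin 3} (h1 : (waveRow a).1 = (waveRow b).1)
    (h2 : (waveRow a).2 = (waveRow b).2) : a = b := by
  obtain ⟨⟨⟨m, q⟩, h⟩, i⟩ := a
  obtain ⟨⟨⟨m', q'⟩, h'⟩, i'⟩ := b
  obtain ⟨h3, h4, h5⟩ := row_inj h.1 h.2 h'.1 h'.2 (Prod.ext h1 h2)
  simp only at h3 h4
  subst h3 h4 h5
  rfl

theorem waveRow_pos (a : ModeIdx × Fin 3) :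
    0 < (waveRow a).1 ∧ 0 < (waveRow a).1 + 2 * (waveRow a).2 :=
  row_pos a.1.2.1 a.1.2.2 a.2

theorem freq_waveRow (a : ModeIdx × Fin 3) : freq (waveRow a).1 (waveRow a).2 = omega a.1 :=
  eigenvalue_row _ _ _

/-- A finite linear combination of basis modes. -/
noncomputable def modeSum (s : Finset ModeIdx) (C : ModeIdx → ℝ) (p : Plane) : ℝ :=
  ∑ j ∈ s, C j * modeOf j p

/-- Twice the integral of the square of a combination of modes over the segment `{x} × (0, 1)`. -/
noncomputable def lineForm (s : Finset ModeIdx) (C : ModeIdx → ℝ) (x : ℝ) : ℝ :=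
  ∑ a ∈ s ×ˢ Finset.univ, ∑ b ∈ s ×ˢ Finset.univ,
    if (waveRow a).1 = (waveRow b).1 then (C a.1 * waveFactor a x) * (C b.1 * waveFactor b x) else 0

theorem continuous_modeSum (s : Finset ModeIdx) (C : ModeIdx → ℝ) : Continuous (modeSum s C) :=
  continuous_finsetSum _ fun _ _ => continuous_const.mul (continuous_mode _ _)

theorem foldInvariant_modeSum_sq (s : Finset ModeIdx) (C : ModeIdx → ℝ) :
    FoldInvariant fun p => modeSum s C p ^ 2 where
  refl p := by
    have : modeSum s C (foldRefl p) = -modeSum s C p := by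
      simp only [modeSum, modeOf, mode_foldRefl, mul_neg, Finset.sum_neg_distrib]
    simp only [this, neg_sq]
  rot p := by simp only [modeSum, modeOf, mode_foldRot]
  turn p := by simp only [modeSum, modeOf, mode_foldTurn]

open Real in
theorem modeSum_line (s : Finset ModeIdx) (C : ModeIdx → ℝ) (x y : ℝ) :
    modeSum s C !₂[x, y] = ∑ a ∈ s ×ˢ (Finset.univ : Finset (Fin 3)),
      C a.1 * waveFactor a x * sin ((waveRow a).1 * (π * (1 - y))) := by
  rw [Finset.sum_product, modeSum]
  refine Finset.sum_congr rfl fun j _ => ?_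
  rw [modeOf, mode_eq_sum, Finset.mul_sum]
  refine Finset.sum_congr rfl fun i _ => ?_
  simp only [waveFactor, waveRow, Matrix.cons_val_zero, Matrix.cons_val_one]
  ring

open Real in
theorem integral_modeSum_line (s : Finset ModeIdx) (C : ModeIdx → ℝ) (x : ℝ) :
    ∫ y in (0 : ℝ)..1, modeSum s C !₂[x, y] ^ 2 = 1 / 2 * lineForm s C x := by
  simp_rw [modeSum_line, sq, Finset.sum_mul_sum]
  rw [intervalIntegral.integral_finsetSum
    (fun a _ => Continuous.intervalIntegrable (by fun_prop) _ _), lineForm, Finset.mul_sum]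
  refine Finset.sum_congr rfl fun a _ => ?_
  rw [intervalIntegral.integral_finsetSum
    (fun b _ => Continuous.intervalIntegrable (by fun_prop) _ _), Finset.mul_sum]
  refine Finset.sum_congr rfl fun b _ => ?_
  have := integral_sin_mul_sin' (waveRow_pos a).1 (waveRow_pos b).1
  have e : ∀ y : ℝ, C a.1 * waveFactor a x * sin ((waveRow a).1 * (π * (1 - y))) *
      (C b.1 * waveFactor b x * sin ((waveRow b).1 * (π * (1 - y)))) =
      C a.1 * waveFactor a x * (C b.1 * waveFactor b x) *
        (sin ((waveRow a).1 * (π * (1 - y))) * sin ((waveRow b).1 * (π * (1 - y)))) :=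
    fun y => mul_mul_mul_comm _ _ _ _
  simp_rw [e]
  rw [intervalIntegral.integral_const_mul, this]
  split_ifs <;> ring

/-- By Parseval in `y`, the integral over the strip region controls the quadratic forms
`lineForm` on the vertical segments with `x < α`. -/
theorem integral_lineForm_le {α : ℝ} (hα₀ : 0 < α) (hα₁ : α ≤ 1 / (3 + √3))
    (s : Finset ModeIdx) (C : ModeIdx → ℝ) :
    1 / 6 * ∫ x in (0 : ℝ)..α, lineForm s C x ≤ ∫ p in stripRegion α, modeSum s C p ^ 2 := by
  have hc : Continuous fun p => modeSum s C p ^ 2 := (continuous_modeSum s C).pow 2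
  have h1 := setIntegral_strip_le hc (fun p => sq_nonneg _) (foldInvariant_modeSum_sq s C) hα₀ hα₁
  rw [setIntegral_rect hc hα₀.le zero_le_one] at h1
  simp_rw [integral_modeSum_line] at h1
  rw [intervalIntegral.integral_const_mul] at h1
  linarith

/-- The coefficient at time `t` of a vibration with frequency `omega j`. -/
noncomputable def vib (A B : ModeIdx → ℝ) (t : ℝ) (j : ModeIdx) : ℝ :=
  A j * Real.cos (omega j * t) + B j * Real.sin (omega j * t)

theorem continuous_vib (A B : ModeIdx → ℝ) (j : ModeIdx) : Continuous fun t => vib A B t j := by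
  unfold vib
  fun_prop

open Real in
/-- Observability of a finite sum of modes on one vertical segment. Each mode has one wave, of row
`(m, q)`, on the controlled side `μ < l`; each of its three waves contributes to the error. -/
theorem ingham_lineForm {T : ℝ} (hT : 0 < T) (hT' : 100 ≤ T ^ 2) (s : Finset ModeIdx)
    (A B : ModeIdx → ℝ) (x : ℝ) :
    T / π * (∑ j ∈ s, (A j ^ 2 + B j ^ 2) *
        sin ((j.1.1 + 2 * j.1.2 : ℤ) * (π * x / √3)) ^ 2 -
        63 / T ^ 2 * ∑ j ∈ s, (A j ^ 2 + B j ^ 2)) ≤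
      ∫ t in (0 : ℝ)..T, sin (π * t / T) * lineForm s (vib A B t) x := by
  have h1 := ingham_rows (ι := {a // a ∈ s ×ˢ (Finset.univ : Finset (Fin 3))}) hT hT'
    (fun a => (waveRow a.1).1) (fun a => (waveRow a.1).2)
    (fun a b h1 h2 => Subtype.ext (waveRow_inj h1 h2))
    (fun a => (waveRow_pos a.1).1) (fun a => (waveRow_pos a.1).2)
    (fun a => A a.1.1 * waveFactor a.1 x) (fun a => B a.1.1 * waveFactor a.1 x)
  have e2 : ∀ a : ModeIdx × Fin 3, (A a.1 * waveFactor a x) ^ 2 + (B a.1 * waveFactor a x) ^ 2 =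
      (A a.1 ^ 2 + B a.1 ^ 2) *
        sin (((waveRow a).1 + 2 * (waveRow a).2 : ℤ) * (π * x / √3)) ^ 2 := by
    intro a
    rw [← waveFactor_sq]
    ring
  rw [Finset.sum_filter] at h1
  simp only [e2, freq_waveRow] at h1
  rw [Finset.sum_coe_sort (s ×ˢ Finset.univ) (fun a => if (waveRow a).1 < (waveRow a).2 then
      (A a.1 ^ 2 + B a.1 ^ 2) *
        sin (((waveRow a).1 + 2 * (waveRow a).2 : ℤ) * (π * x / √3)) ^ 2 else 0),
    Finset.sum_coe_sort (s ×ˢ Finset.univ) (fun a => (A a.1 ^ 2 + B a.1 ^ 2) *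
        sin (((waveRow a).1 + 2 * (waveRow a).2 : ℤ) * (π * x / √3)) ^ 2),
    Finset.sum_product, Finset.sum_product] at h1
  have e : ∀ t, (∑ a : {a // a ∈ s ×ˢ (Finset.univ : Finset (Fin 3))},
      ∑ b : {a // a ∈ s ×ˢ (Finset.univ : Finset (Fin 3))},
      if (waveRow a.1).1 = (waveRow b.1).1 then
      (A a.1.1 * waveFactor a.1 x * cos (omega a.1.1 * t) +
        B a.1.1 * waveFactor a.1 x * sin (omega a.1.1 * t)) *
      (A b.1.1 * waveFactor b.1 x * cos (omega b.1.1 * t) +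
        B b.1.1 * waveFactor b.1 x * sin (omega b.1.1 * t))
      else 0) = lineForm s (vib A B t) x := by
    intro t
    rw [lineForm, ← Finset.sum_coe_sort (s ×ˢ Finset.univ)]
    refine Finset.sum_congr rfl fun a _ => ?_
    rw [← Finset.sum_coe_sort (s ×ˢ Finset.univ)]
    refine Finset.sum_congr rfl fun b _ => ?_
    simp only [vib]
    split_ifs <;> ring
  simp_rw [e] at h1
  refine le_trans ?_ h1
  refine mul_le_mul_of_nonneg_left ?_ (by have := pi_pos; positivity)
  have hmain : ∑ j ∈ s, (A j ^ 2 + B j ^ 2) * sin ((j.1.1 + 2 * j.1.2 : ℤ) * (π * x / √3)) ^ 2 ≤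
      ∑ j ∈ s, ∑ i : Fin 3, if (waveRow (j, i)).1 < (waveRow (j, i)).2 then
        (A j ^ 2 + B j ^ 2) *
          sin (((waveRow (j, i)).1 + 2 * (waveRow (j, i)).2 : ℤ) * (π * x / √3)) ^ 2 else 0 := by
    refine Finset.sum_le_sum fun j _ => ?_
    refine le_trans (le_of_eq ?_) (Finset.single_le_sum (fun i _ => ?_) (Finset.mem_univ 0))
    · have : (waveRow (j, 0)).1 < (waveRow (j, 0)).2 := row_zero_lt j.2.2
      rw [if_pos this]
      rfl
    · split_ifs <;> positivity
  have herr : ∑ j ∈ s, ∑ i : Fin 3, (A j ^ 2 + B j ^ 2) *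
      sin (((waveRow (j, i)).1 + 2 * (waveRow (j, i)).2 : ℤ) * (π * x / √3)) ^ 2 ≤
      3 * ∑ j ∈ s, (A j ^ 2 + B j ^ 2) := by
    rw [Finset.mul_sum]
    refine Finset.sum_le_sum fun j _ => ?_
    calc _ ≤ ∑ i : Fin 3, (A j ^ 2 + B j ^ 2) := by
          refine Finset.sum_le_sum fun i _ => ?_
          exact mul_le_of_le_one_right (by positivity) (sin_sq_le_one _)
      _ = _ := by simp; ring
  have h21 : 0 ≤ 21 / T ^ 2 := by positivity
  have := mul_le_mul_of_nonneg_left herr h21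
  have e3 : 63 / T ^ 2 * ∑ j ∈ s, (A j ^ 2 + B j ^ 2) =
      21 / T ^ 2 * (3 * ∑ j ∈ s, (A j ^ 2 + B j ^ 2)) := by ring
  rw [e3]
  linarith

theorem continuous_lineForm {X : Type*} [TopologicalSpace X] (s : Finset ModeIdx)
    (A B : ModeIdx → ℝ) {f g : X → ℝ} (hf : Continuous f) (hg : Continuous g) :
    Continuous fun z => lineForm s (vib A B (f z)) (g z) := by
  refine continuous_finsetSum _ fun a _ => continuous_finsetSum _ fun b _ => ?_
  split_ifs
  · exact (((continuous_vib A B a.1).comp hf).mul ((continuous_waveFactor a).comp hg)).mul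
      (((continuous_vib A B b.1).comp hf).mul ((continuous_waveFactor b).comp hg))
  · exact continuous_const

theorem continuous_integral_modeSum_sq (α : ℝ) (s : Finset ModeIdx) (A B : ModeIdx → ℝ) :
    Continuous fun t => ∫ p in stripRegion α, modeSum s (vib A B t) p ^ 2 := by
  have e : ∀ t, ∫ p in stripRegion α, modeSum s (vib A B t) p ^ 2 =
      ∑ i ∈ s, ∑ j ∈ s, vib A B t i * vib A B t j *
        ∫ p in stripRegion α, modeOf i p * modeOf j p := by
    intro t
    have hint : ∀ i j, IntegrableOn (fun p => modeOf i p * modeOf j p) (stripRegion α) :=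
      fun i j => (integrableOn_rect ((continuous_mode _ _).mul (continuous_mode _ _)) √3 1).mono_set
        (Set.sdiff_subset.trans triangle_subset_rect)
    have e : ∀ p, modeSum s (vib A B t) p ^ 2 = ∑ i ∈ s, ∑ j ∈ s,
        vib A B t i * vib A B t j * (modeOf i p * modeOf j p) := fun p => by
      rw [sq, modeSum, Finset.sum_mul_sum]
      exact Finset.sum_congr rfl fun i _ => Finset.sum_congr rfl fun j _ =>
        mul_mul_mul_comm _ _ _ _
    simp_rw [e]
    rw [integral_finsetSum _ (fun i _ => integrable_finsetSum _ fun j _ => (hint i j).const_mul _)]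
    refine Finset.sum_congr rfl fun i _ => ?_
    rw [integral_finsetSum _ (fun j _ => (hint i j).const_mul _)]
    refine Finset.sum_congr rfl fun j _ => ?_
    rw [integral_const_mul]
  simp_rw [e]
  exact continuous_finsetSum _ fun i _ => continuous_finsetSum _ fun j _ =>
    ((continuous_vib A B i).mul (continuous_vib A B j)).mul continuous_const

open Real in
theorem continuous_weight_mul_lineForm (T : ℝ) (s : Finset ModeIdx) (A B : ModeIdx → ℝ) :
    Continuous fun z : ℝ × ℝ => sin (π * z.2 / T) * lineForm s (vib A B z.2) z.1 := by
  have h1 : Continuous fun z : ℝ × ℝ => sin (π * z.2 / T) := by fun_prop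
  exact h1.mul (continuous_lineForm s A B continuous_snd continuous_fst)

open Real in
theorem integral_lineForm_swap (α T : ℝ) (s : Finset ModeIdx) (A B : ModeIdx → ℝ) :
    ∫ x in (0 : ℝ)..α, ∫ t in (0 : ℝ)..T, sin (π * t / T) * lineForm s (vib A B t) x =
      ∫ t in (0 : ℝ)..T, sin (π * t / T) * ∫ x in (0 : ℝ)..α, lineForm s (vib A B t) x := by
  rw [intervalIntegral_intervalIntegral_swap
    (F := fun x t => sin (π * t / T) * lineForm s (vib A B t) x)]
  · simp_rw [intervalIntegral.integral_const_mul]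
  · refine IntegrableOn.mono_set ?_ (Set.prod_mono Set.uIoc_subset_uIcc Set.uIoc_subset_uIcc)
    exact ContinuousOn.integrableOn_compact (isCompact_uIcc.prod isCompact_uIcc)
      (continuous_weight_mul_lineForm T s A B).continuousOn

theorem continuous_integral_lineForm (α : ℝ) (s : Finset ModeIdx) (A B : ModeIdx → ℝ) :
    Continuous fun t => ∫ x in (0 : ℝ)..α, lineForm s (vib A B t) x :=
  intervalIntegral.continuous_parametric_intervalIntegral_of_continuous'
    (f := fun t x => lineForm s (vib A B t) x) (continuous_lineForm s A B continuous_fst continuous_snd) _ _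

open Real in
theorem continuous_integral_weight_mul_lineForm (T : ℝ) (s : Finset ModeIdx) (A B : ModeIdx → ℝ) :
    Continuous fun x => ∫ t in (0 : ℝ)..T, sin (π * t / T) * lineForm s (vib A B t) x :=
  intervalIntegral.continuous_parametric_intervalIntegral_of_continuous'
    (f := fun x t => sin (π * t / T) * lineForm s (vib A B t) x)
    (continuous_weight_mul_lineForm T s A B) _ _

open Real in
/-- The observability inequality for finite sums of modes. -/
theorem observability_finite {α T : ℝ} (hα₀ : 0 < α) (hα₁ : α ≤ 1 / (3 + √3)) (hT : 0 < T)
    (hT' : 100 ≤ T ^ 2) (s : Finset ModeIdx) (A B : ModeIdx → ℝ) :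
    obsConst α T * (√3 / 8) * ∑ j ∈ s, (A j ^ 2 + B j ^ 2) ≤
      ∫ t in (0 : ℝ)..T, ∫ p in stripRegion α, modeSum s (vib A B t) p ^ 2 := by
  have hπ := pi_pos
  set N := ∑ j ∈ s, (A j ^ 2 + B j ^ 2) with hN
  have hN0 : 0 ≤ N := Finset.sum_nonneg fun _ _ => by positivity
  have hsin : ∀ t ∈ Set.Icc (0 : ℝ) T, 0 ≤ sin (π * t / T) := fun t ht => by
    refine sin_nonneg_of_nonneg_of_le_pi ?_ ?_
    · have := ht.1; positivity
    · rw [div_le_iff₀ hT]; have := ht.2; gcongr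
  have hmode : ∀ j ∈ s, tInf α * (A j ^ 2 + B j ^ 2) ≤ ∫ x in (0 : ℝ)..α, (A j ^ 2 + B j ^ 2) *
      sin ((j.1.1 + 2 * j.1.2 : ℤ) * (π * x / √3)) ^ 2 := fun j _ => by
    rw [intervalIntegral.integral_const_mul, mul_comm]
    refine mul_le_mul_of_nonneg_left (tInf_le_integral hα₀.le ?_) (by positivity)
    have := j.2.1
    have := j.2.2
    omega
  have hx : T / π * (tInf α * N - 63 / T ^ 2 * N * α) ≤
      ∫ x in (0 : ℝ)..α, ∫ t in (0 : ℝ)..T, sin (π * t / T) * lineForm s (vib A B t) x := by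
    calc T / π * (tInf α * N - 63 / T ^ 2 * N * α) ≤
        ∫ x in (0 : ℝ)..α, T / π * (∑ j ∈ s, (A j ^ 2 + B j ^ 2) *
          sin ((j.1.1 + 2 * j.1.2 : ℤ) * (π * x / √3)) ^ 2 - 63 / T ^ 2 * N) := by
          rw [intervalIntegral.integral_const_mul, intervalIntegral.integral_sub
            (Continuous.intervalIntegrable (by fun_prop) _ _) (by simp),
            intervalIntegral.integral_finsetSum
              (fun j _ => Continuous.intervalIntegrable (by fun_prop) _ _),
            intervalIntegral.integral_const, hN, Finset.mul_sum, smul_eq_mul, sub_zero]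
          refine mul_le_mul_of_nonneg_left ?_ (by positivity)
          have := Finset.sum_le_sum hmode
          linarith
      _ ≤ _ := by
          refine intervalIntegral.integral_mono_on hα₀.le
            (Continuous.intervalIntegrable (by fun_prop) _ _)
            ((continuous_integral_weight_mul_lineForm T s A B).intervalIntegrable _ _)
            fun x _ => ingham_lineForm hT hT' s A B x
  have hswap : ∫ x in (0 : ℝ)..α, ∫ t in (0 : ℝ)..T, sin (π * t / T) * lineForm s (vib A B t) x =
      ∫ t in (0 : ℝ)..T, sin (π * t / T) * ∫ x in (0 : ℝ)..α, lineForm s (vib A B t) x :=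
    integral_lineForm_swap α T s A B
  have ht : ∫ t in (0 : ℝ)..T, sin (π * t / T) * ∫ x in (0 : ℝ)..α, lineForm s (vib A B t) x ≤
      6 * ∫ t in (0 : ℝ)..T, ∫ p in stripRegion α, modeSum s (vib A B t) p ^ 2 := by
    rw [← intervalIntegral.integral_const_mul]
    refine intervalIntegral.integral_mono_on hT.le (intervalIntegrable_sin_mul
      (continuous_integral_lineForm α s A B))
      ((continuous_const.mul (continuous_integral_modeSum_sq α s A B)).intervalIntegrable _ _)
      fun t ht => ?_
    have h1 := integral_lineForm_le hα₀ hα₁ s (vib A B t)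
    have h2 : 0 ≤ ∫ p in stripRegion α, modeSum s (vib A B t) p ^ 2 :=
      integral_nonneg fun _ => sq_nonneg _
    have h3 := hsin t ht
    have h4 := sin_le_one (π * t / T)
    calc _ ≤ sin (π * t / T) * (6 * ∫ p in stripRegion α, modeSum s (vib A B t) p ^ 2) := by
          gcongr
          linarith
      _ ≤ 1 * (6 * ∫ p in stripRegion α, modeSum s (vib A B t) p ^ 2) := by gcongr
      _ = _ := one_mul _
  have hconst := mul_le_mul_of_nonneg_right
    (obsConst_mul_le (T := T) hα₁ hT (tInf_pos hα₀).le) hN0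
  rw [hswap] at hx
  have e : 1 / 6 * (T / π * (tInf α - 63 * α / T ^ 2)) * N =
      1 / 6 * (T / π * (tInf α * N - 63 / T ^ 2 * N * α)) := by ring
  rw [e] at hconst
  linarith

/-! ### Completeness of the modes -/

/-- The algebraic core of the separation of points: the pair of the two lowest invariants, in terms
of `p = cos a` and `q = cos b`, is injective on the image of the triangle. -/
theorem invariants_injective_aux {p q p' q' : ℝ} (hp : 1 / 2 ≤ p) (hp' : p' ≤ 1) (hlt : p < p')
    (hq : q ≤ 4 * p ^ 3 - 3 * p)
    (h1 : 2 * p ^ 2 - 1 + 2 * p * q = 2 * p' ^ 2 - 1 + 2 * p' * q')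
    (h2 : 2 * q ^ 2 - 1 + 2 * (4 * p ^ 3 - 3 * p) * q =
      2 * q' ^ 2 - 1 + 2 * (4 * p' ^ 3 - 3 * p') * q') : False := by
  set s := p ^ 2 with hs
  set s' := p' ^ 2 with hs'
  set v := p ^ 2 + p * q with hv
  have hv' : v = p' ^ 2 + p' * q' := by linarith
  have hs4 : 1 / 4 ≤ s := by nlinarith
  have hs1 : s' ≤ 1 := by nlinarith
  have hd : 0 < s' - s := by nlinarith
  have hvs : v ≤ 4 * s ^ 2 - 2 * s := by
    have := mul_le_mul_of_nonneg_left hq (show 0 ≤ p by linarith)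
    have e : v = s + p * q := rfl
    rw [e, hs]
    nlinarith
  have e1 : s * (2 * q ^ 2 - 1 + 2 * (4 * p ^ 3 - 3 * p) * q) =
      2 * (v - s) ^ 2 - s + 2 * s * (4 * s - 3) * (v - s) := by
    simp only [hs, hv]; ring
  have e2 : s' * (2 * q' ^ 2 - 1 + 2 * (4 * p' ^ 3 - 3 * p') * q') =
      2 * (v - s') ^ 2 - s' + 2 * s' * (4 * s' - 3) * (v - s') := by
    rw [hv']; simp only [hs']; ring
  have key : (s' - s) * (v ^ 2 + 4 * (s * s') * (s + s' - 1 - v)) = 0 := by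
    linear_combination (s' / 2) * (-e1) + (s / 2) * e2 + (s * s' / 2) * h2
  have hzero : v ^ 2 + 4 * (s * s') * (s + s' - 1 - v) = 0 :=
    (mul_eq_zero.1 key).resolve_left hd.ne'
  have h3 : 2 * (s * (s' + 1 - 2 * s)) ≤ 2 * (s * s') - v := by nlinarith
  have h4 : 0 ≤ 2 * (s * (s' + 1 - 2 * s)) := by nlinarith
  have h5 := pow_le_pow_left₀ h4 h3 2
  have h6 : 0 < s * ((s' - s) * ((1 - s) * (4 * s - 1) + (s' - s))) := by
    have : 0 ≤ (1 - s) * (4 * s - 1) := mul_nonneg (by linarith) (by linarith)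
    have hs0 : 0 < s := by linarith
    positivity
  nlinarith

theorem invariants_injective {p q p' q' : ℝ} (hp : 1 / 2 ≤ p) (hp1 : p ≤ 1) (hp' : 1 / 2 ≤ p')
    (hp1' : p' ≤ 1) (hq : q ≤ 4 * p ^ 3 - 3 * p) (hq' : q' ≤ 4 * p' ^ 3 - 3 * p')
    (h1 : 2 * p ^ 2 - 1 + 2 * p * q = 2 * p' ^ 2 - 1 + 2 * p' * q')
    (h2 : 2 * q ^ 2 - 1 + 2 * (4 * p ^ 3 - 3 * p) * q =
      2 * q' ^ 2 - 1 + 2 * (4 * p' ^ 3 - 3 * p') * q') : p = p' ∧ q = q' := by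
  rcases lt_trichotomy p p' with h | h | h
  · exact (invariants_injective_aux hp hp1' h hq h1 h2).elim
  · subst h
    refine ⟨rfl, ?_⟩
    have : p * q = p * q' := by linarith
    exact mul_left_cancel₀ (by linarith : p ≠ 0) this
  · exact (invariants_injective_aux hp' hp1 h hq' h1.symm h2.symm).elim

/-- The closed triangle. -/
def closedTriangle : Set Plane := {p | 0 ≤ √3 * p 0 ∧ 0 ≤ p 1 ∧ √3 * p 0 + p 1 ≤ 1}

theorem triangle_subset_closedTriangle : triangle ⊆ closedTriangle := fun p hp => by
  rw [mem_triangle] at hp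
  exact ⟨hp.1.le, hp.2.1.le, hp.2.2.le⟩

theorem isClosed_closedTriangle : IsClosed closedTriangle := by
  refine (isClosed_le (f := fun _ : Plane => (0 : ℝ)) (g := fun p => √3 * p 0) continuous_const
    (by fun_prop)).inter ((isClosed_le (f := fun _ : Plane => (0 : ℝ)) (g := fun p => p 1)
    continuous_const (by fun_prop)).inter (isClosed_le (f := fun p : Plane => √3 * p 0 + p 1)
    (g := fun _ => 1) (by fun_prop) continuous_const))

theorem isCompact_closedTriangle : IsCompact closedTriangle := by
  refine (isCompact_closedBall (0 : Plane) (√2)).of_isClosed_subset isClosed_closedTriangle ?_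
  rintro p ⟨h1, h2, h3⟩
  rw [mem_closedBall_zero_iff, EuclideanSpace.norm_eq]
  apply Real.sqrt_le_sqrt
  simp only [Fin.sum_univ_two, Real.norm_eq_abs, sq_abs]
  have h : (1 : ℝ) ≤ √3 := Real.one_le_sqrt.2 (by norm_num)
  have h0 : 0 ≤ p 0 := nonneg_of_mul_nonneg_right h1 (by linarith)
  have : p 0 ≤ √3 * p 0 := le_mul_of_one_le_left h0 h
  nlinarith

instance : CompactSpace closedTriangle := isCompact_iff_compactSpace.1 isCompact_closedTriangle

open Real in
/-- The two lowest trigonometric polynomials that are invariant under the reflection group of the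
triangle. -/
noncomputable def invariant : Fin 2 → Plane → ℝ :=
  ![fun p => cos (2 * (π / √3 * p 0)) + 2 * cos (π / √3 * p 0) * cos (π * (1 - p 1)),
    fun p => cos (2 * (π * (1 - p 1))) + 2 * cos (3 * (π / √3 * p 0)) * cos (π * (1 - p 1))]

theorem continuous_invariant (i : Fin 2) : Continuous (invariant i) := by
  fin_cases i <;> simp only [invariant] <;> simp <;> fun_prop

theorem mode_mul_invariant_zero (m q : ℤ) (p : Plane) : mode m q p * invariant 0 p =
    2⁻¹ * (mode m (q + 1) p + mode m (q - 1) p + mode (m + 1) q p + mode (m - 1) q p +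
      mode (m - 1) (q + 1) p + mode (m + 1) (q - 1) p) :=
  trigMode_mul_short _ _ _ _

theorem mode_mul_invariant_one (m q : ℤ) (p : Plane) : mode m q p * invariant 1 p =
    2⁻¹ * (mode (m + 2) (q - 1) p + mode (m - 2) (q + 1) p + mode (m + 1) (q + 1) p +
      mode (m - 1) (q - 1) p + mode (m - 1) (q + 2) p + mode (m + 1) (q - 2) p) :=
  trigMode_mul_long _ _ _ _

open Real in
theorem angle_bounds {p : Plane} (hp : p ∈ closedTriangle) :
    0 ≤ π / √3 * p 0 ∧ 3 * (π / √3 * p 0) ≤ π * (1 - p 1) ∧ π * (1 - p 1) ≤ π := by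
  obtain ⟨h1, h2, h3⟩ := hp
  have hs : (0 : ℝ) < √3 := by positivity
  have hπ := pi_pos
  have e : π / √3 * p 0 = π * (√3 * p 0) / 3 := by
    field_simp
    rw [sqrt_three_sq, mul_comm]
  rw [e]
  refine ⟨by positivity, ?_, ?_⟩ <;> nlinarith

open Real in
/-- The two invariants separate the points of the closed triangle, a fundamental domain of the
reflection group. -/
theorem invariant_separates {p p' : Plane} (hp : p ∈ closedTriangle) (hp' : p' ∈ closedTriangle)
    (h : ∀ i, invariant i p = invariant i p') : p = p' := by
  have hπ := pi_pos
  obtain ⟨h1, h2, h3⟩ := angle_bounds hp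
  obtain ⟨h1', h2', h3'⟩ := angle_bounds hp'
  have hA := h 0
  have hB := h 1
  simp only [invariant, Matrix.cons_val_zero, Matrix.cons_val_one, cos_two_mul, cos_three_mul]
    at hA hB
  have half : ∀ a : ℝ, 0 ≤ a → 3 * a ≤ π → 1 / 2 ≤ cos a := fun a h0 h => by
    rw [← cos_pi_div_three]
    exact cos_le_cos_of_nonneg_of_le_pi h0 (by linarith) (by linarith)
  have le3 : ∀ a b : ℝ, 0 ≤ a → 3 * a ≤ b → b ≤ π → cos b ≤ 4 * cos a ^ 3 - 3 * cos a :=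
    fun a b h0 hab hb => by
      rw [← cos_three_mul]
      exact cos_le_cos_of_nonneg_of_le_pi (by linarith) hb hab
  obtain ⟨hc, hd⟩ := invariants_injective (half _ h1 (h2.trans h3)) (cos_le_one _)
    (half _ h1' (h2'.trans h3')) (cos_le_one _) (le3 _ _ h1 h2 h3) (le3 _ _ h1' h2' h3') hA hB
  have ea := injOn_cos ⟨h1, by linarith⟩ ⟨h1', by linarith⟩ hc
  have eb := injOn_cos ⟨by linarith, h3⟩ ⟨by linarith, h3'⟩ hd
  have hs : π / √3 ≠ 0 := by positivity
  ext i
  fin_cases i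
  · exact mul_left_cancel₀ hs ea
  · have := mul_left_cancel₀ hπ.ne' eb
    change p 1 = p' 1
    linarith

open Real in
theorem mode_one_two_ne_zero {p : Plane} (hp : p ∈ triangle) : mode 1 2 p ≠ 0 := by
  have hπ := pi_pos
  have hs : (0 : ℝ) < √3 := by positivity
  obtain ⟨h1, h2, h3⟩ := mem_triangle.1 hp
  have e : π / √3 * p 0 = π * (√3 * p 0) / 3 := by
    field_simp
    rw [sqrt_three_sq, mul_comm]
  have ha : 0 < π / √3 * p 0 := by rw [e]; positivity
  have hab : 3 * (π / √3 * p 0) < π * (1 - p 1) := by rw [e]; nlinarith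
  have hb : π * (1 - p 1) < π := by nlinarith
  rw [mode, trigMode_one_two]
  have s1 := sin_pos_of_pos_of_lt_pi ha (by linarith)
  have s2 := sin_pos_of_pos_of_lt_pi (show 0 < π * (1 - p 1) by linarith) hb
  have c1 : cos (π * (1 - p 1)) < cos (π / √3 * p 0) :=
    cos_lt_cos_of_nonneg_of_le_pi ha.le hb.le (by linarith)
  have c2 : cos (π * (1 - p 1)) < cos (3 * (π / √3 * p 0)) :=
    cos_lt_cos_of_nonneg_of_le_pi (by linarith) hb.le hab
  have : (cos (π * (1 - p 1)) - cos (π / √3 * p 0)) *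
      (cos (π * (1 - p 1)) - cos (3 * (π / √3 * p 0))) ≠ 0 :=
    mul_ne_zero (by linarith) (by linarith)
  rw [mul_assoc]
  exact mul_ne_zero (by positivity) this

/-- Orthogonality to the basis modes implies orthogonality to all modes. -/
theorem integral_mul_mode_eq_zero {f : Plane → ℝ}
    (h : ∀ j : ModeIdx, ∫ p in triangle, f p * modeOf j p = 0) (m q : ℤ) :
    ∫ p in triangle, f p * mode m q p = 0 := by
  refine trigMode_reduce (Z := fun F => ∫ p in triangle,
    f p * F (Real.pi / √3 * p 0) (Real.pi * (1 - p 1)) = 0) (by simp) (fun F hF => ?_)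
    (fun m q hm hq => h ⟨(m, q), hm, hq⟩) m q
  simp only [mul_neg, integral_neg, hF, neg_zero]

/-- The restriction of an invariant to the closed triangle. -/
noncomputable def invariantMap (i : Fin 2) : C(closedTriangle, ℝ) :=
  ⟨fun p => invariant i p, (continuous_invariant i).comp continuous_subtype_val⟩

theorem adjoin_invariant_dense :
    (Algebra.adjoin ℝ (Set.range invariantMap)).topologicalClosure = ⊤ := by
  refine ContinuousMap.subalgebra_topologicalClosure_eq_top_of_separatesPoints _ ?_
  intro p p' hne
  by_contra hcon
  refine hne (Subtype.ext (invariant_separates p.2 p'.2 fun i => ?_))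
  by_contra hi
  exact hcon ⟨_, ⟨invariantMap i, Algebra.subset_adjoin ⟨i, rfl⟩, rfl⟩, hi⟩

/-- Completeness of the modes in the triangle. The span of all the modes is a module over the
algebra generated by the two invariants, which is dense by the Stone-Weierstrass theorem; hence a
function orthogonal to all modes is killed by the lowest mode, which has no zero in the
triangle. -/
theorem ae_eq_zero_of_forall_integral_mode {f : Plane → ℝ} (hf : IntegrableOn f triangle)
    (h : ∀ j : ModeIdx, ∫ p in triangle, f p * modeOf j p = 0) :
    ∀ᵐ p : Plane, p ∈ triangle → f p = 0 := by
  have hK := isClosed_closedTriangle.measurableSet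
  have hemb := MeasurableEmbedding.subtype_coe hK
  set ν : Measure closedTriangle := Measure.comap Subtype.val (volume.restrict triangle) with hν
  have hint : ∀ g : Plane → ℝ, ∫ x : closedTriangle, g x ∂ν = ∫ p in triangle, g p := by
    intro g
    rw [hν, integral_subtype_comap hK, Measure.restrict_restrict hK,
      Set.inter_eq_right.2 triangle_subset_closedTriangle]
  have hfν : Integrable (fun x : closedTriangle => f x) ν := by
    have : Integrable f (Measure.map Subtype.val ν) := by
      rw [hν, hemb.map_comap, Measure.restrict_restrict hemb.measurableSet_range,
        Subtype.range_coe, Set.inter_eq_right.2 triangle_subset_closedTriangle]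
      exact hf
    exact hemb.integrable_map_iff.1 this
  have hmul : ∀ b : C(closedTriangle, ℝ), Integrable (fun x : closedTriangle => f x * b x) ν := fun b =>
    hfν.mul_bdd (c := ‖b‖) b.continuous.aestronglyMeasurable
      (Filter.Eventually.of_forall fun x => b.norm_coe_le_norm x)
  let M : ℤ → ℤ → C(closedTriangle, ℝ) := fun m q =>
    ⟨fun p => mode m q p, (continuous_mode m q).comp continuous_subtype_val⟩
  let φ : C(closedTriangle, ℝ) →ₗ[ℝ] ℝ :=
    { toFun := fun g => ∫ x, f x * g x ∂ν
      map_add' := fun g g' => by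
        rw [← integral_add (hmul g) (hmul g')]
        exact integral_congr_ae (Filter.Eventually.of_forall fun x => mul_add _ _ _)
      map_smul' := fun r g => by
        rw [RingHom.id_apply, smul_eq_mul, ← integral_const_mul]
        exact integral_congr_ae (Filter.Eventually.of_forall fun x => mul_left_comm _ _ _) }
  let P : C(closedTriangle, ℝ) → Prop := fun b => ∀ m q, φ (b * M m q) = 0
  have hone : P 1 := fun m q => by
    rw [one_mul]
    exact (hint fun p => f p * mode m q p).trans (integral_mul_mode_eq_zero h m q)
  have hadj : ∀ a ∈ Algebra.adjoin ℝ (Set.range invariantMap), ∀ b, P b → P (a * b) := by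
    intro a ha
    induction ha using Algebra.adjoin_induction with
    | mem a ha =>
      obtain ⟨i, rfl⟩ := ha
      intro b hb m q
      have hi : ∃ a1 a2 a3 a4 a5 a6 : ℤ × ℤ, M m q * invariantMap i = (2⁻¹ : ℝ) •
          (M a1.1 a1.2 + M a2.1 a2.2 + M a3.1 a3.2 + M a4.1 a4.2 + M a5.1 a5.2 + M a6.1 a6.2) := by
        fin_cases i
        · exact ⟨(m, q + 1), (m, q - 1), (m + 1, q), (m - 1, q), (m - 1, q + 1), (m + 1, q - 1),
            ContinuousMap.ext fun x => mode_mul_invariant_zero m q x⟩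
        · exact ⟨(m + 2, q - 1), (m - 2, q + 1), (m + 1, q + 1), (m - 1, q - 1), (m - 1, q + 2),
            (m + 1, q - 2), ContinuousMap.ext fun x => mode_mul_invariant_one m q x⟩
      obtain ⟨a1, a2, a3, a4, a5, a6, he⟩ := hi
      rw [show invariantMap i * b * M m q = b * (M m q * invariantMap i) by ring, he]
      simp only [mul_smul_comm, mul_add, map_add, map_smul, hb _ _, add_zero, smul_zero]
    | algebraMap r =>
      intro b hb m q
      rw [Algebra.algebraMap_eq_smul_one, smul_one_mul, smul_mul_assoc, map_smul, hb, smul_zero]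
    | add a a' _ _ ha ha' =>
      intro b hb m q
      rw [add_mul, add_mul, map_add, ha b hb, ha' b hb, add_zero]
    | mul a a' _ _ ha ha' =>
      intro b hb
      rw [mul_assoc]
      exact ha _ (ha' b hb)
  have hall : ∀ g : C(closedTriangle, ℝ), φ (g * M 1 2) = 0 := by
    intro g
    set J := ∫ x, ‖f x * (M 1 2) x‖ ∂ν with hJ
    have hJ0 : 0 ≤ J := integral_nonneg fun _ => norm_nonneg _
    have hg : g ∈ (Algebra.adjoin ℝ (Set.range invariantMap)).topologicalClosure := by
      rw [adjoin_invariant_dense]; trivial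
    rw [← SetLike.mem_coe, Subalgebra.topologicalClosure_coe, Metric.mem_closure_iff] at hg
    refine norm_le_zero_iff.1 (le_of_forall_pos_le_add fun ε hε => ?_)
    obtain ⟨a, ha, hd⟩ := hg (ε / (J + 1)) (by positivity)
    have ha0 : φ (a * M 1 2) = 0 := by
      have := hadj a ha 1 hone 1 2
      rwa [mul_one] at this
    have e : φ (g * M 1 2) = ∫ x, (g - a) x * (f x * (M 1 2) x) ∂ν := by
      rw [← sub_zero (φ (g * M 1 2)), ← ha0, ← map_sub, ← sub_mul]
      exact integral_congr_ae (Filter.Eventually.of_forall fun x => mul_left_comm _ _ _)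
    rw [e, zero_add]
    rw [dist_eq_norm] at hd
    calc ‖∫ x, (g - a) x * (f x * (M 1 2) x) ∂ν‖
        ≤ ∫ x, ‖(g - a) x * (f x * (M 1 2) x)‖ ∂ν := norm_integral_le_integral_norm _
      _ ≤ ∫ x, ε / (J + 1) * ‖f x * (M 1 2) x‖ ∂ν := by
          refine integral_mono_of_nonneg (Filter.Eventually.of_forall fun x => norm_nonneg _)
            ((hmul _).norm.const_mul _) (Filter.Eventually.of_forall fun x => ?_)
          simp only [norm_mul (_ : ℝ) (f x * (M 1 2) x)]
          gcongr
          exact ((g - a).norm_coe_le_norm x).trans hd.le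
      _ = ε / (J + 1) * J := by rw [integral_const_mul]
      _ ≤ ε := by
          rw [div_mul_eq_mul_div, div_le_iff₀ (by positivity)]
          nlinarith
  have hloc : LocallyIntegrableOn (fun p => f p * mode 1 2 p) triangle := by
    refine IntegrableOn.locallyIntegrableOn ?_
    have : Integrable (fun p => f p * mode 1 2 p) (volume.restrict triangle) := by
      obtain ⟨C, hC⟩ := isCompact_closedTriangle.exists_bound_of_continuousOn
        (continuous_mode 1 2).continuousOn
      refine Integrable.mul_bdd (c := C) hf (continuous_mode 1 2).aestronglyMeasurable ?_
      exact (ae_restrict_iff' isOpen_triangle.measurableSet).2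
        (Filter.Eventually.of_forall fun p hp => hC p (triangle_subset_closedTriangle hp))
    exact this
  have hfin := isOpen_triangle.ae_eq_zero_of_integral_contDiff_smul_eq_zero hloc
    fun g hg _ hsupp => by
      have h1 := hall ⟨fun p => g p, hg.continuous.comp continuous_subtype_val⟩
      have h2 := hint fun p => f p * (g p * mode 1 2 p)
      rw [← setIntegral_eq_integral_of_forall_compl_eq_zero (s := triangle)]
      · refine Eq.trans ?_ (h2.symm.trans h1)
        refine integral_congr_ae (Filter.Eventually.of_forall fun p => ?_)
        simp only [smul_eq_mul]
        ring
      · intro p hp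
        rw [image_eq_zero_of_notMem_tsupport fun hp' => hp (hsupp hp'), zero_smul]
  filter_upwards [hfin] with p hp hpT
  exact (mul_eq_zero.1 (hp hpT)).resolve_right (mode_one_two_ne_zero hpT)

/-! ### Green's formula and the Dirichlet Laplacian -/

theorem inner_gradient (f : Plane → ℝ) (p v : Plane) :
    inner ℝ (gradient f p) v = fderiv ℝ f p v := by
  rw [← toDual_gradient, InnerProductSpace.toDual_apply_apply]

theorem gradient_apply (f : Plane → ℝ) (p : Plane) (i : Fin 2) :
    gradient f p i = partialDeriv i f p := by
  rw [partialDeriv, ← inner_gradient, EuclideanSpace.inner_single_right]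
  simp

theorem norm_gradient (f : Plane → ℝ) (p : Plane) : ‖gradient f p‖ = ‖fderiv ℝ f p‖ :=
  LinearIsometryEquiv.norm_map _ _

theorem continuous_gradient {f : Plane → ℝ} (hf : ContDiff ℝ (⊤ : ℕ∞) f) :
    Continuous (gradient f) :=
  (LinearIsometryEquiv.continuous _).comp (hf.continuous_fderiv (by simp))

theorem tsupport_gradient_subset (f : Plane → ℝ) : tsupport (gradient f) ⊆ tsupport f :=
  (closure_mono (Function.support_comp_subset (map_zero (InnerProductSpace.toDual ℝ Plane).symm) _)).trans
    (tsupport_fderiv_subset ℝ)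

theorem inner_gradient_gradient (f g : Plane → ℝ) (p : Plane) :
    inner ℝ (gradient f p) (gradient g p) = ∑ i, partialDeriv i f p * partialDeriv i g p := by
  rw [PiLp.inner_apply]
  refine Finset.sum_congr rfl fun i _ => ?_
  rw [gradient_apply, gradient_apply]
  simp [mul_comm]

theorem continuous_lap {w : Plane → ℝ} (hw : ContDiff ℝ (⊤ : ℕ∞) w) : Continuous (lap w) :=
  continuous_finsetSum _ fun i _ =>
    (contDiff_partialDeriv (contDiff_partialDeriv hw i) i).continuous

/-- Green's formula against a test function. -/
theorem integral_inner_gradient {w φ : Plane → ℝ} (hw : ContDiff ℝ (⊤ : ℕ∞) w)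
    (hφ : ContDiff ℝ (⊤ : ℕ∞) φ) (hc : HasCompactSupport φ) :
    ∫ p, inner ℝ (gradient w p) (gradient φ p) = -∫ p, lap w p * φ p := by
  simp_rw [inner_gradient_gradient, lap, Finset.sum_mul]
  have hcd : ∀ i, HasCompactSupport (partialDeriv i φ) := fun i =>
    (hc.fderiv (𝕜 := ℝ)).comp_left (g := fun L : Plane →L[ℝ] ℝ => L (EuclideanSpace.single i 1))
      rfl
  have h1 : ∀ i, Integrable (fun p => partialDeriv i w p * partialDeriv i φ p) := fun i =>
    ((contDiff_partialDeriv hw i).continuous.mul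
      (contDiff_partialDeriv hφ i).continuous).integrable_of_hasCompactSupport (hcd i).mul_left
  have h2 : ∀ i, Integrable (fun p => partialDeriv i (partialDeriv i w) p * φ p) := fun i =>
    ((contDiff_partialDeriv (contDiff_partialDeriv hw i) i).continuous.mul
      hφ.continuous).integrable_of_hasCompactSupport hc.mul_left
  have h3 : ∀ i, Integrable (fun p => partialDeriv i w p * φ p) := fun i =>
    ((contDiff_partialDeriv hw i).continuous.mul
      hφ.continuous).integrable_of_hasCompactSupport hc.mul_left
  rw [integral_finsetSum _ (fun i _ => h1 i), integral_finsetSum _ (fun i _ => h2 i),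
    ← Finset.sum_neg_distrib]
  refine Finset.sum_congr rfl fun i _ => ?_
  exact integral_mul_fderiv_eq_neg_fderiv_mul_of_integrable (h2 i) (h1 i) (h3 i)
    (fun x _ => ((contDiff_partialDeriv hw i).differentiable (by simp)) x)
    (fun x _ => (hφ.differentiable (by simp)) x)

/-- A smooth function which, together with its gradient, represents an element of `H¹₀` has a
Dirichlet Laplacian as soon as its classical Laplacian is square integrable. -/
theorem hasDirichletLaplacian_of_smooth {Ω : Set Plane} {w : Plane → ℝ}
    (hw : ContDiff ℝ (⊤ : ℕ∞) w) (f : H10 Ω) (hf : H10.grad f =ᵐ[volume.restrict Ω] gradient w)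
    (g : L2 Ω) (hg : g =ᵐ[volume.restrict Ω] lap w) : HasDirichletLaplacian f g := by
  let l : L2 Ω × L2Vec Ω →L[ℝ] ℝ :=
    (innerSL ℝ (H10.grad f)).comp (ContinuousLinearMap.snd ℝ _ _) +
      (innerSL ℝ g).comp (ContinuousLinearMap.fst ℝ _ _)
  have hl : ∀ z, l z = inner ℝ (H10.grad f) z.2 + inner ℝ g z.1 := fun z => rfl
  have hle : H10 Ω ≤ LinearMap.ker (l : L2 Ω × L2Vec Ω →ₗ[ℝ] ℝ) := by
    refine Submodule.topologicalClosure_minimal _ (Submodule.span_le.2 ?_) l.isClosed_ker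
    rintro z ⟨φ, hφ, hc, hs, h1, h2⟩
    rw [SetLike.mem_coe, LinearMap.mem_ker]
    change l z = 0
    rw [hl, L2.inner_def, L2.inner_def]
    have e1 : ∫ p in Ω, inner ℝ (H10.grad f p) (z.2 p) =
        ∫ p, inner ℝ (gradient w p) (gradient φ p) := by
      rw [← setIntegral_eq_integral_of_forall_compl_eq_zero (s := Ω)
        (f := fun p => inner ℝ (gradient w p) (gradient φ p))]
      · refine integral_congr_ae ?_
        filter_upwards [hf, h2] with p h h'
        rw [h, h']
      · intro p hp
        have : gradient φ p = 0 := image_eq_zero_of_notMem_tsupport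
          fun h => hp (hs (tsupport_gradient_subset φ h))
        rw [this, inner_zero_right]
    have e2 : ∫ p in Ω, inner ℝ (g p) (z.1 p) = ∫ p, lap w p * φ p := by
      rw [← setIntegral_eq_integral_of_forall_compl_eq_zero (s := Ω)
        (f := fun p => lap w p * φ p)]
      · refine integral_congr_ae ?_
        filter_upwards [hg, h1] with p h h'
        rw [h, h']
        simp [mul_comm]
      · intro p hp
        rw [image_eq_zero_of_notMem_tsupport fun h => hp (hs h), mul_zero]
    rw [e1, e2, integral_inner_gradient hw hφ hc, neg_add_cancel]
  intro ψ
  have h : l ψ = 0 := hle ψ.2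
  rw [hl] at h
  exact eq_neg_of_add_eq_zero_left h

theorem L2_norm_sq {α E : Type*} [MeasurableSpace α] {μ : Measure α} [NormedAddCommGroup E]
    [InnerProductSpace ℝ E] (f : Lp E 2 μ) : ‖f‖ ^ 2 = ∫ x, ‖f x‖ ^ 2 ∂μ := by
  rw [← real_inner_self_eq_norm_sq, L2.inner_def]
  simp_rw [real_inner_self_eq_norm_sq]

/-- Bounded convergence in `L²` of a finite measure. -/
theorem tendsto_toLp_of_bounded {α E : Type*} [MeasurableSpace α] {μ : Measure α}
    [IsFiniteMeasure μ] [NormedAddCommGroup E] [InnerProductSpace ℝ E] {F : ℕ → α → E} {f : α → E}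
    (hF : ∀ n, MemLp (F n) 2 μ) (hf : MemLp f 2 μ) (C : ℝ)
    (hC : ∀ n, ∀ᵐ x ∂μ, ‖F n x - f x‖ ≤ C)
    (hlim : ∀ᵐ x ∂μ, Filter.Tendsto (fun n => F n x) Filter.atTop (nhds (f x))) :
    Filter.Tendsto (fun n => (hF n).toLp (F n)) Filter.atTop (nhds (hf.toLp f)) := by
  rw [tendsto_iff_norm_sub_tendsto_zero]
  have hsq : ∀ n, ‖(hF n).toLp (F n) - hf.toLp f‖ ^ 2 = ∫ x, ‖F n x - f x‖ ^ 2 ∂μ := by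
    intro n
    rw [← MemLp.toLp_sub, L2_norm_sq]
    refine integral_congr_ae ?_
    filter_upwards [((hF n).sub hf).coeFn_toLp] with x hx
    rw [hx]
    rfl
  have h0 : Filter.Tendsto (fun n => ∫ x, ‖F n x - f x‖ ^ 2 ∂μ) Filter.atTop (nhds 0) := by
    have : (0 : ℝ) = ∫ _, (0 : ℝ) ∂μ := by simp
    rw [this]
    refine tendsto_integral_of_dominated_convergence (fun _ => C ^ 2)
      (fun n => (((hF n).sub hf).aestronglyMeasurable.norm.pow 2)) (integrable_const _)
      (fun n => ?_) ?_
    · filter_upwards [hC n] with x hx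
      rw [norm_pow, norm_norm]
      gcongr
    · filter_upwards [hlim] with x hx
      have := ((tendsto_iff_norm_sub_tendsto_zero.1 hx).pow 2)
      simpa using this
  have h1 := (Real.continuous_sqrt.tendsto 0).comp h0
  rw [Real.sqrt_zero] at h1
  refine h1.congr fun n => ?_
  rw [Function.comp_apply, ← hsq, Real.sqrt_sq (norm_nonneg _)]

instance : IsFiniteMeasure (volume.restrict triangle) :=
  ⟨by
    rw [Measure.restrict_apply_univ]
    exact (measure_mono triangle_subset_closedTriangle).trans_lt
      isCompact_closedTriangle.measure_lt_top⟩

theorem ae_triangle {P : Plane → Prop} (h : ∀ p ∈ triangle, P p) :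
    ∀ᵐ p ∂volume.restrict triangle, P p :=
  (ae_restrict_iff' isOpen_triangle.measurableSet).2 (Filter.Eventually.of_forall h)

/-- A continuous function on the plane is square integrable on the triangle. -/
theorem memLp_triangle {E : Type*} [NormedAddCommGroup E] {f : Plane → E} (hf : Continuous f) :
    MemLp f 2 (volume.restrict triangle) := by
  obtain ⟨C, hC⟩ := isCompact_closedTriangle.exists_bound_of_continuousOn hf.continuousOn
  exact MemLp.of_bound hf.aestronglyMeasurable C
    (ae_triangle fun p hp => hC p (triangle_subset_closedTriangle hp))

/-! ### Smooth functions vanishing on the boundary -/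

/-- A smooth function on the line that vanishes for `s ≤ 1 / (n + 1)` and equals `1` for
`s ≥ 2 / (n + 1)`. -/
noncomputable def cutoff (n : ℕ) (s : ℝ) : ℝ := Real.smoothTransition ((n + 1) * s - 1)

theorem contDiff_cutoff (n : ℕ) : ContDiff ℝ (⊤ : ℕ∞) (cutoff n) :=
  Real.smoothTransition.contDiff.comp (by fun_prop)

theorem cutoff_eq_one {n : ℕ} {s : ℝ} (h : 2 ≤ (n + 1) * s) : cutoff n s = 1 :=
  Real.smoothTransition.one_of_one_le (by linarith)

theorem abs_cutoff_le_one (n : ℕ) (s : ℝ) : |cutoff n s| ≤ 1 :=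
  abs_le.2 ⟨by linarith [Real.smoothTransition.nonneg ((n + 1) * s - 1),
    show cutoff n s = Real.smoothTransition ((n + 1) * s - 1) from rfl],
    Real.smoothTransition.le_one _⟩

/-- The derivative of the cutoff at distance `s` from the boundary is `O(1 / s)`, uniformly in `n`. -/
theorem exists_bound_deriv_cutoff :
    ∃ M : ℝ, 0 ≤ M ∧ ∀ (n : ℕ) (s : ℝ), 0 < s → s * |deriv (cutoff n) s| ≤ M := by
  have hσ : Continuous (deriv Real.smoothTransition) :=
    (Real.smoothTransition.contDiff (n := 1)).continuous_deriv le_rfl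
  obtain ⟨M, hM⟩ := (isCompact_Icc (a := (-1 : ℝ)) (b := 1)).exists_bound_of_continuousOn
    hσ.continuousOn
  have hM0 : 0 ≤ M := (norm_nonneg _).trans (hM 0 (by simp))
  refine ⟨2 * M, by positivity, fun n s hs => ?_⟩
  have hn : (0 : ℝ) < n + 1 := by positivity
  by_cases h : (n + 1) * s ≤ 2
  · have hd : deriv (cutoff n) s = (n + 1) * deriv Real.smoothTransition ((n + 1) * s - 1) := by
      have h1 : HasDerivAt (fun s : ℝ => (n + 1) * s - 1) (n + 1) s := by
        simpa using ((hasDerivAt_id s).const_mul ((n : ℝ) + 1)).sub_const 1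
      have h2 : HasDerivAt Real.smoothTransition
          (deriv Real.smoothTransition ((n + 1) * s - 1)) ((n + 1) * s - 1) :=
        ((Real.smoothTransition.contDiff (n := 1)).differentiable (by simp) _).hasDerivAt
      rw [mul_comm]
      exact (h2.comp s h1).deriv
    have h3 := hM ((n + 1) * s - 1) ⟨by nlinarith, by linarith⟩
    rw [Real.norm_eq_abs] at h3
    rw [hd, abs_mul, abs_of_pos hn]
    calc s * ((n + 1) * |deriv Real.smoothTransition ((n + 1) * s - 1)|)
        = ((n + 1) * s) * |deriv Real.smoothTransition ((n + 1) * s - 1)| := by ring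
      _ ≤ 2 * M := by gcongr
  · have hev : cutoff n =ᶠ[nhds s] fun _ => 1 := by
      have ho : IsOpen {s : ℝ | 2 < (n + 1) * s} :=
        isOpen_lt continuous_const (by fun_prop)
      filter_upwards [ho.mem_nhds (not_le.1 h)] with x hx
      exact cutoff_eq_one (le_of_lt hx)
    rw [hev.deriv_eq, deriv_const, abs_zero, mul_zero]
    positivity

/-- Cutting off near a side preserves a gradient bound, for a function dominated by the distance to
that side. -/
theorem norm_fderiv_cutoff_mul_le {M : ℝ}
    (hM : ∀ (n : ℕ) (s : ℝ), 0 < s → s * |deriv (cutoff n) s| ≤ M) (n : ℕ) {L g : Plane → ℝ}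
    {L' : Plane →L[ℝ] ℝ} {p : Plane} {K : ℝ} (hK : 0 ≤ K) (hL : HasFDerivAt L L' p)
    (hg : DifferentiableAt ℝ g p) (hp : 0 < L p) (hgL : |g p| ≤ K * L p) :
    ‖fderiv ℝ (fun p => cutoff n (L p) * g p) p‖ ≤ ‖fderiv ℝ g p‖ + K * M * ‖L'‖ := by
  have hc : HasDerivAt (cutoff n) (deriv (cutoff n) (L p)) (L p) :=
    ((contDiff_cutoff n).differentiable (by simp) _).hasDerivAt
  have h := (hc.comp_hasFDerivAt p hL).mul hg.hasFDerivAt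
  have e : (fun p => cutoff n (L p) * g p) = (cutoff n ∘ L) * g := rfl
  rw [e, h.fderiv]
  refine (norm_add_le _ _).trans (add_le_add ?_ ?_)
  · rw [norm_smul, Real.norm_eq_abs]
    exact mul_le_of_le_one_left (norm_nonneg _) (abs_cutoff_le_one _ _)
  · rw [norm_smul, norm_smul, Real.norm_eq_abs, Real.norm_eq_abs, ← mul_assoc]
    refine mul_le_mul_of_nonneg_right ?_ (norm_nonneg _)
    calc |g p| * |deriv (cutoff n) (L p)| ≤ K * L p * |deriv (cutoff n) (L p)| := by gcongr
      _ = K * (L p * |deriv (cutoff n) (L p)|) := by ring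
      _ ≤ K * M := by gcongr; exact hM n _ hp

/-- The affine functions vanishing on the sides of the triangle. -/
noncomputable def side : Fin 3 → Plane → ℝ :=
  ![fun p => p 0, fun p => p 1, fun p => 1 - (√3 * p 0 + p 1)]

/-- The differentials of the functions `side`. -/
noncomputable def sideDeriv : Fin 3 → Plane →L[ℝ] ℝ :=
  ![EuclideanSpace.proj 0, EuclideanSpace.proj 1,
    -(√3 • EuclideanSpace.proj 0 + EuclideanSpace.proj 1)]

theorem hasFDerivAt_side (i : Fin 3) (p : Plane) : HasFDerivAt (side i) (sideDeriv i) p := by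
  have h0 : HasFDerivAt (fun p : Plane => p 0) (EuclideanSpace.proj 0 : Plane →L[ℝ] ℝ) p :=
    (EuclideanSpace.proj 0 : Plane →L[ℝ] ℝ).hasFDerivAt
  have h1 : HasFDerivAt (fun p : Plane => p 1) (EuclideanSpace.proj 1 : Plane →L[ℝ] ℝ) p :=
    (EuclideanSpace.proj 1 : Plane →L[ℝ] ℝ).hasFDerivAt
  fin_cases i
  · exact h0
  · exact h1
  · exact ((h0.const_mul √3).add h1).const_sub 1

theorem contDiff_side (i : Fin 3) : ContDiff ℝ (⊤ : ℕ∞) (side i) := by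
  fin_cases i <;> simp only [side] <;> simp <;> fun_prop

theorem mem_triangle_iff_side {p : Plane} : p ∈ triangle ↔ ∀ i, 0 < side i p := by
  simp [Fin.forall_fin_succ, side, triangle]

/-- A smooth function vanishing on the boundary of the triangle is dominated by the distance to
each side. -/
theorem exists_bound_side {w : Plane → ℝ} (hw : ContDiff ℝ (⊤ : ℕ∞) w)
    (h0 : ∀ (p : Plane) (i : Fin 3), side i p = 0 → w p = 0) :
    ∃ K : ℝ, 0 ≤ K ∧ ∀ p ∈ triangle, ‖fderiv ℝ w p‖ ≤ K ∧ ∀ i, |w p| ≤ K * side i p := by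
  obtain ⟨K, hK⟩ := isCompact_closedTriangle.exists_bound_of_continuousOn
    (hw.continuous_fderiv (by simp)).continuousOn
  have hs : (0 : ℝ) < √3 := by positivity
  have hconv : Convex ℝ closedTriangle := by
    intro p hp q hq a b ha hb hab
    obtain ⟨h1, h2, h3⟩ := hp
    obtain ⟨h1', h2', h3'⟩ := hq
    have e0 : (a • p + b • q) 0 = a * p 0 + b * q 0 := by simp
    have e1 : (a • p + b • q) 1 = a * p 1 + b * q 1 := by simp
    refine ⟨?_, ?_, ?_⟩
    · rw [e0, mul_add, mul_left_comm, mul_left_comm √3 b]; positivity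
    · rw [e1]; positivity
    · rw [e0, e1]
      have := mul_le_mul_of_nonneg_left h3 ha
      have := mul_le_mul_of_nonneg_left h3' hb
      nlinarith
  have hmvt : ∀ p ∈ closedTriangle, ∀ p' ∈ closedTriangle, w p' = 0 → |w p| ≤ K * ‖p - p'‖ := by
    intro p hp p' hp' h
    have := hconv.norm_image_sub_le_of_norm_fderiv_le (𝕜 := ℝ) (f := w)
      (fun x _ => hw.differentiable (by simp) x) hK hp' hp
    rwa [h, sub_zero, Real.norm_eq_abs] at this
  have hK0 : 0 ≤ K := (norm_nonneg _).trans (hK 0 ⟨by simp, by simp, by simp⟩)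
  refine ⟨K, hK0, fun p hp => ⟨hK p (triangle_subset_closedTriangle hp), ?_⟩⟩
  have hpc := triangle_subset_closedTriangle hp
  obtain ⟨h1, h2, h3⟩ := hp
  have hX : 0 < √3 * p 0 := by positivity
  have hnorm : ∀ (i : Fin 2) (c : ℝ), ‖p - (p - EuclideanSpace.single i c)‖ = |c| := fun i c => by
    rw [sub_sub_cancel, PiLp.norm_single, Real.norm_eq_abs]
  have main : ∀ (j : Fin 3) (i : Fin 2) (c : ℝ), 0 < side j p → |c| = side j p →
      p - EuclideanSpace.single i c ∈ closedTriangle →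
      side j (p - EuclideanSpace.single i c) = 0 → |w p| ≤ K * side j p := by
    intro j i c _ hc hm hz
    have := hmvt p hpc _ hm (h0 _ j hz)
    rwa [hnorm, hc] at this
  intro i
  fin_cases i
  · refine main 0 0 (p 0) h1 (abs_of_pos h1) ⟨?_, ?_, ?_⟩ ?_ <;> simp [side] <;> linarith
  · refine main 1 1 (p 1) h2 (abs_of_pos h2) ⟨?_, ?_, ?_⟩ ?_ <;> simp [side] <;> linarith
  · have h4 : side 2 p = 1 - (√3 * p 0 + p 1) := rfl
    have h5 : 0 < side 2 p := by rw [h4]; linarith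
    refine main 2 1 (-(side 2 p)) h5 (by rw [abs_neg, abs_of_pos h5]) ⟨?_, ?_, ?_⟩ ?_
    · simp; linarith
    · simp [h4]; linarith
    · simp [h4]; linarith
    · simp [side]; ring

/-- The truncation of a function near the three sides of the triangle. -/
noncomputable def truncate (w : Plane → ℝ) (n : ℕ) (p : Plane) : ℝ :=
  cutoff n (side 0 p) * (cutoff n (side 1 p) * (cutoff n (side 2 p) * w p))

theorem contDiff_truncate {w : Plane → ℝ} (hw : ContDiff ℝ (⊤ : ℕ∞) w) (n : ℕ) :
    ContDiff ℝ (⊤ : ℕ∞) (truncate w n) := by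
  have h := fun i => (contDiff_cutoff n).comp (contDiff_side i)
  exact (h 0).mul ((h 1).mul ((h 2).mul hw))

theorem tsupport_truncate (w : Plane → ℝ) (n : ℕ) :
    tsupport (truncate w n) ⊆ triangle ∧ HasCompactSupport (truncate w n) := by
  have hn : (0 : ℝ) < n + 1 := by positivity
  have hcl : IsClosed {p : Plane | ∀ i, 1 ≤ (n + 1) * side i p} := by
    rw [show {p : Plane | ∀ i, 1 ≤ (n + 1) * side i p} =
      ⋂ i, {p : Plane | 1 ≤ (n + 1) * side i p} from Set.ofPred_forall _]
    exact isClosed_iInter fun i => isClosed_le continuous_const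
      (continuous_const.mul (contDiff_side i).continuous)
  have hsub : tsupport (truncate w n) ⊆ {p : Plane | ∀ i, 1 ≤ (n + 1) * side i p} := by
    refine closure_minimal (fun p hp i => ?_) hcl
    by_contra hi
    have hz : cutoff n (side i p) = 0 :=
      Real.smoothTransition.zero_of_nonpos (by linarith [not_le.1 hi])
    refine hp ?_
    fin_cases i
    · exact mul_eq_zero_of_left hz _
    · exact mul_eq_zero_of_right _ (mul_eq_zero_of_left hz _)
    · exact mul_eq_zero_of_right _ (mul_eq_zero_of_right _ (mul_eq_zero_of_left hz _))
  have hT : tsupport (truncate w n) ⊆ triangle := hsub.trans fun p hp =>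
    mem_triangle_iff_side.2 fun i => pos_of_mul_pos_right (lt_of_lt_of_le one_pos (hp i)) hn.le
  exact ⟨hT, isCompact_closedTriangle.of_isClosed_subset (isClosed_tsupport _)
    (hT.trans triangle_subset_closedTriangle)⟩

theorem truncate_eventuallyEq (w : Plane → ℝ) {p : Plane} (hp : p ∈ triangle) :
    ∀ᶠ n : ℕ in Filter.atTop, truncate w n =ᶠ[nhds p] w := by
  have h1 : ∀ᶠ n : ℕ in Filter.atTop, ∀ i, 2 < ((n : ℝ) + 1) * side i p := by
    rw [Filter.eventually_all]
    intro i
    have hi := mem_triangle_iff_side.1 hp i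
    have : Filter.Tendsto (fun n : ℕ => ((n : ℝ) + 1) * side i p) Filter.atTop Filter.atTop :=
      (Filter.tendsto_atTop_add_const_right _ _ tendsto_natCast_atTop_atTop).atTop_mul_const hi
    exact this.eventually_gt_atTop 2
  filter_upwards [h1] with n hn
  have h2 : ∀ᶠ x in nhds p, ∀ i, 2 < ((n : ℝ) + 1) * side i x := by
    rw [Filter.eventually_all]
    intro i
    exact (continuous_const.mul (contDiff_side i).continuous).continuousAt.eventually
      (lt_mem_nhds (hn i))
  filter_upwards [h2] with x hx
  rw [truncate, cutoff_eq_one (hx 0).le, cutoff_eq_one (hx 1).le, cutoff_eq_one (hx 2).le]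
  simp

/-- The element of `L²` of the triangle given by a continuous function. -/
noncomputable def contL2 {E : Type*} [NormedAddCommGroup E] (f : Plane → E) (hf : Continuous f) :
    Lp E 2 (volume.restrict triangle) := (memLp_triangle hf).toLp f

theorem coeFn_contL2 {E : Type*} [NormedAddCommGroup E] (f : Plane → E) (hf : Continuous f) :
    contL2 f hf =ᵐ[volume.restrict triangle] f := MemLp.coeFn_toLp _

/-- A smooth function vanishing on the boundary of the triangle belongs to `H¹₀`. -/
theorem mem_H10_of_side {w : Plane → ℝ} (hw : ContDiff ℝ (⊤ : ℕ∞) w)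
    (h0 : ∀ (p : Plane) (i : Fin 3), side i p = 0 → w p = 0) :
    (contL2 w hw.continuous, contL2 (gradient w) (continuous_gradient hw)) ∈ H10 triangle := by
  obtain ⟨K, hK0, hK⟩ := exists_bound_side hw h0
  obtain ⟨M, hM0, hM⟩ := exists_bound_deriv_cutoff
  have hwn := contDiff_truncate hw
  have hd : ∀ {f : Plane → ℝ}, ContDiff ℝ (⊤ : ℕ∞) f → Differentiable ℝ f :=
    fun h => h.differentiable (by simp)
  have habs : ∀ (n : ℕ) (s x : ℝ), |cutoff n s * x| ≤ |x| := fun n s x => by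
    rw [abs_mul]
    exact mul_le_of_le_one_left (abs_nonneg _) (abs_cutoff_le_one _ _)
  have h1 : Filter.Tendsto (fun n => contL2 (truncate w n) (hwn n).continuous) Filter.atTop
      (nhds (contL2 w hw.continuous)) := by
    obtain ⟨C, hC⟩ := isCompact_closedTriangle.exists_bound_of_continuousOn
      hw.continuous.continuousOn
    refine tendsto_toLp_of_bounded _ _ (2 * C) (fun n => ae_triangle fun p hp => ?_)
      (ae_triangle fun p hp => ?_)
    · have h2 := hC p (triangle_subset_closedTriangle hp)
      have h3 : |truncate w n p| ≤ |w p| :=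
        (habs _ _ _).trans ((habs _ _ _).trans (habs _ _ _))
      rw [Real.norm_eq_abs] at h2
      refine (norm_sub_le _ _).trans ?_
      rw [Real.norm_eq_abs, Real.norm_eq_abs]
      linarith
    · refine tendsto_const_nhds.congr' ?_
      filter_upwards [truncate_eventuallyEq w hp] with n hn
      exact hn.self_of_nhds.symm
  have h2 : Filter.Tendsto (fun n => contL2 (gradient (truncate w n))
      (continuous_gradient (hwn n))) Filter.atTop
      (nhds (contL2 (gradient w) (continuous_gradient hw))) := by
    refine tendsto_toLp_of_bounded _ _
      (2 * K + K * M * ‖sideDeriv 2‖ + K * M * ‖sideDeriv 1‖ + K * M * ‖sideDeriv 0‖)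
      (fun n => ae_triangle fun p hp => ?_) (ae_triangle fun p hp => ?_)
    · obtain ⟨hKd, hKs⟩ := hK p hp
      have hs := mem_triangle_iff_side.1 hp
      have hc := fun i => (contDiff_cutoff n).comp (contDiff_side i)
      have b2 := norm_fderiv_cutoff_mul_le hM n hK0 (hasFDerivAt_side 2 p) (hd hw p) (hs 2) (hKs 2)
      have b1 := norm_fderiv_cutoff_mul_le hM n hK0 (hasFDerivAt_side 1 p)
        (hd ((hc 2).mul hw) p) (hs 1) ((habs _ _ _).trans (hKs 1))
      have b0 := norm_fderiv_cutoff_mul_le hM n hK0 (hasFDerivAt_side 0 p)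
        (hd ((hc 1).mul ((hc 2).mul hw)) p) (hs 0)
        ((habs _ _ _).trans ((habs _ _ _).trans (hKs 0)))
      refine (norm_sub_le _ _).trans ?_
      rw [norm_gradient, norm_gradient]
      have e0 : fderiv ℝ (truncate w n) p = fderiv ℝ (fun p => cutoff n (side 0 p) *
        (cutoff n (side 1 p) * (cutoff n (side 2 p) * w p))) p := rfl
      rw [e0]
      simp only [Function.comp_apply] at b0 b1 b2
      change ‖_‖ ≤ ‖fderiv ℝ (fun p => cutoff n (side 1 p) * (cutoff n (side 2 p) * w p)) p‖ + _
        at b0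
      change ‖_‖ ≤ ‖fderiv ℝ (fun p => cutoff n (side 2 p) * w p) p‖ + _ at b1
      linarith
    · refine tendsto_const_nhds.congr' ?_
      filter_upwards [truncate_eventuallyEq w hp] with n hn
      rw [gradient, gradient, hn.fderiv_eq]
  refine mem_closure_of_tendsto (h1.prodMk_nhds h2) (Filter.Eventually.of_forall fun n => ?_)
  have hmem : (contL2 (truncate w n) (hwn n).continuous,
      contL2 (gradient (truncate w n)) (continuous_gradient (hwn n))) ∈
      Submodule.span ℝ (testPairs triangle) :=
    Submodule.subset_span ⟨truncate w n, hwn n, (tsupport_truncate w n).2,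
      (tsupport_truncate w n).1, coeFn_contL2 _ (hwn n).continuous,
      coeFn_contL2 _ (continuous_gradient (hwn n))⟩
  exact hmem

theorem mode_eq_zero_of_side (m q : ℤ) (p : Plane) (i : Fin 3) (h : side i p = 0) :
    mode m q p = 0 := by
  fin_cases i
  · have h : p 0 = 0 := h
    simp [mode, trigMode, h]
  · have h : p 1 = 0 := h
    have e : ((m : ℝ) + q) * Real.pi = ((m + q : ℤ) : ℝ) * Real.pi := by push_cast; ring
    simp [mode, trigMode, h, e, Real.sin_int_mul_pi, -Int.cast_add]
  · have h : 1 - (√3 * p 0 + p 1) = 0 := h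
    have hfix : foldRefl p = p := by
      have h3 := sqrt_three_sq
      have h1 : p 1 = 1 - √3 * p 0 := by linarith
      ext i
      fin_cases i
      · change foldRefl p 0 = p 0
        simp only [foldRefl, planeMap_zero, h1]
        linear_combination (p 0 / 2) * h3
      · change foldRefl p 1 = p 1
        simp only [foldRefl, planeMap_one, h1]
        ring
    have := mode_foldRefl m q p
    rw [hfix] at this
    linarith

/-- The basis modes as elements of `H¹₀`. -/
noncomputable def modeH10 (j : ModeIdx) : H10 triangle :=
  ⟨_, mem_H10_of_side (contDiff_mode j.1.1 j.1.2) (mode_eq_zero_of_side j.1.1 j.1.2)⟩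

theorem coeFn_modeH10 (j : ModeIdx) :
    H10.toL2 (modeH10 j) =ᵐ[volume.restrict triangle] modeOf j :=
  coeFn_contL2 _ (continuous_mode j.1.1 j.1.2)

theorem hasDirichletLaplacian_modeH10 (j : ModeIdx) :
    HasDirichletLaplacian (modeH10 j) (-(omega j ^ 2) • H10.toL2 (modeH10 j)) := by
  refine hasDirichletLaplacian_of_smooth (contDiff_mode j.1.1 j.1.2) _
    (coeFn_contL2 _ (continuous_gradient (contDiff_mode j.1.1 j.1.2))) _ ?_
  filter_upwards [Lp.coeFn_smul (-(omega j ^ 2)) (H10.toL2 (modeH10 j)), coeFn_modeH10 j]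
    with p h1 h2
  rw [h1, Pi.smul_apply, h2, lap_mode, omega_sq]
  rfl

/-! ### The orthonormal basis of eigenfunctions -/

theorem HasDirichletLaplacian.smul {Ω : Set Plane} {f : H10 Ω} {g : L2 Ω}
    (h : HasDirichletLaplacian f g) (c : ℝ) : HasDirichletLaplacian (c • f) (c • g) := fun ψ => by
  change inner ℝ (c • H10.grad f) (H10.grad ψ) = _
  rw [real_inner_smul_left, real_inner_smul_left, h ψ, mul_neg]

theorem HasDirichletLaplacian.add {Ω : Set Plane} {f f' : H10 Ω} {g g' : L2 Ω}
    (h : HasDirichletLaplacian f g) (h' : HasDirichletLaplacian f' g') :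
    HasDirichletLaplacian (f + f') (g + g') := fun ψ => by
  change inner ℝ (H10.grad f + H10.grad f') (H10.grad ψ) = _
  rw [inner_add_left, inner_add_left, h ψ, h' ψ, neg_add]

/-- The map `f ↦ f` from `H¹₀` to `L²`, as a continuous linear map. -/
noncomputable def H10.toL2L (Ω : Set Plane) : H10 Ω →L[ℝ] L2 Ω :=
  (ContinuousLinearMap.fst ℝ (L2 Ω) (L2Vec Ω)).comp (H10 Ω).subtypeL

/-- The gradient from `H¹₀` to `L²`, as a continuous linear map. -/
noncomputable def H10.gradL (Ω : Set Plane) : H10 Ω →L[ℝ] L2Vec Ω :=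
  (ContinuousLinearMap.snd ℝ (L2 Ω) (L2Vec Ω)).comp (H10 Ω).subtypeL

/-- The inverse of the `L²` norm of the modes. -/
noncomputable def eigScale : ℝ := (√(√3 / 8))⁻¹

theorem eigScale_sq : eigScale ^ 2 * (√3 / 8) = 1 := by
  have : (0 : ℝ) < √3 / 8 := by positivity
  rw [eigScale, inv_pow, Real.sq_sqrt this.le, inv_mul_cancel₀ this.ne']

/-- The normalized eigenfunctions of the Dirichlet Laplacian. -/
noncomputable def eigVec (j : ModeIdx) : H10 triangle := eigScale • modeH10 j

/-- The normalized eigenfunctions as elements of `L²`. -/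
noncomputable def eigL2 (j : ModeIdx) : L2 triangle := H10.toL2 (eigVec j)

theorem coeFn_eigL2 (j : ModeIdx) :
    eigL2 j =ᵐ[volume.restrict triangle] fun p => eigScale * modeOf j p := by
  filter_upwards [Lp.coeFn_smul eigScale (H10.toL2 (modeH10 j)), coeFn_modeH10 j] with p h1 h2
  rw [← h2]
  exact h1

theorem hasDirichletLaplacian_eigVec (j : ModeIdx) :
    HasDirichletLaplacian (eigVec j) (-(omega j ^ 2) • eigL2 j) := by
  have h := (hasDirichletLaplacian_modeH10 j).smul eigScale
  rwa [smul_comm] at h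

theorem orthonormal_eigL2 : Orthonormal ℝ eigL2 := by
  rw [orthonormal_iff_ite]
  intro i j
  have h : inner ℝ (eigL2 i) (eigL2 j) =
      ∫ p in triangle, eigScale ^ 2 * (mode i.1.1 i.1.2 p * mode j.1.1 j.1.2 p) := by
    rw [L2.inner_def]
    refine integral_congr_ae ?_
    filter_upwards [coeFn_eigL2 i, coeFn_eigL2 j] with p h1 h2
    rw [h1, h2, real_inner_eq_re_inner]
    simp [modeOf]
    ring
  rw [h, integral_const_mul, integral_mode_mul_mode i.2.1 i.2.2 j.2.1 j.2.2]
  have e : i = j ↔ i.1.1 = j.1.1 ∧ i.1.2 = j.1.2 := by rw [Subtype.ext_iff, Prod.ext_iff]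
  simp_rw [e, mul_ite, eigScale_sq, mul_zero]

/-- The Hilbert basis of `L²` of the triangle formed by the normalized eigenfunctions. -/
noncomputable def eigBasis : HilbertBasis ModeIdx ℝ (L2 triangle) :=
  HilbertBasis.mkOfOrthogonalEqBot orthonormal_eigL2 <| by
    rw [Submodule.eq_bot_iff]
    intro f hf
    have hz : ∀ j : ModeIdx, ∫ p in triangle, f p * modeOf j p = 0 := by
      intro j
      have h1 := (Submodule.mem_orthogonal _ _).1 hf (eigL2 j) (Submodule.subset_span ⟨j, rfl⟩)
      have h2 : inner ℝ (eigL2 j) f = eigScale * ∫ p in triangle, f p * modeOf j p := by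
        rw [L2.inner_def, ← integral_const_mul]
        refine integral_congr_ae ?_
        filter_upwards [coeFn_eigL2 j] with p h
        rw [h]
        simp
        ring
      rw [h2] at h1
      refine (mul_eq_zero.1 h1).resolve_left fun h0 => ?_
      have := eigScale_sq
      rw [h0] at this
      norm_num at this
    have h3 := ae_eq_zero_of_forall_integral_mode
      ((Lp.memLp f).integrable (by norm_num)) hz
    refine (Lp.eq_zero_iff_ae_eq_zero).2 ?_
    exact (ae_restrict_iff' isOpen_triangle.measurableSet).2 h3

theorem coe_eigBasis : ⇑eigBasis = eigL2 := HilbertBasis.coe_mkOfOrthogonalEqBot _ _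

/-- The partial sums of the eigenfunction expansion. -/
noncomputable def eigSum (s : Finset ModeIdx) (f : L2 triangle) : L2 triangle :=
  ∑ j ∈ s, inner ℝ f (eigL2 j) • eigL2 j

theorem tendsto_eigSum (f : L2 triangle) :
    Filter.Tendsto (fun s => eigSum s f) Filter.atTop (nhds f) := by
  have h := eigBasis.hasSum_repr f
  simp_rw [HilbertBasis.repr_apply_apply, coe_eigBasis, real_inner_comm] at h
  exact h

theorem norm_eigSum_sq (s : Finset ModeIdx) (f : L2 triangle) :
    ‖eigSum s f‖ ^ 2 = ∑ j ∈ s, inner ℝ f (eigL2 j) ^ 2 := by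
  rw [← real_inner_self_eq_norm_sq, eigSum, orthonormal_eigL2.inner_sum]
  simp [pow_two]

theorem norm_eigSum_sq_le (s : Finset ModeIdx) (f : L2 triangle) : ‖eigSum s f‖ ^ 2 ≤ ‖f‖ ^ 2 := by
  rw [norm_eigSum_sq]
  have h := orthonormal_eigL2.sum_inner_products_le f (s := s)
  simp_rw [Real.norm_eq_abs, sq_abs, real_inner_comm] at h
  exact h

/-! ### The evolution of the Fourier coefficients -/

theorem eq_cos_add_sin_of_hasDerivAt {ω : ℝ} (hω : ω ≠ 0) {a d : ℝ → ℝ}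
    (ha : ∀ t, HasDerivAt a (d t) t) (hd : ∀ t, HasDerivAt d (-ω ^ 2 * a t) t) (t : ℝ) :
    a t = a 0 * Real.cos (ω * t) + d 0 / ω * Real.sin (ω * t) := by
  have hc : ∀ t, HasDerivAt (fun t => Real.cos (ω * t)) (-(ω * Real.sin (ω * t))) t := fun t => by
    have := (Real.hasDerivAt_cos (ω * t)).comp t ((hasDerivAt_id t).const_mul ω)
    refine this.congr_deriv ?_
    ring
  have hs : ∀ t, HasDerivAt (fun t => Real.sin (ω * t)) (ω * Real.cos (ω * t)) t := fun t => by
    have := (Real.hasDerivAt_sin (ω * t)).comp t ((hasDerivAt_id t).const_mul ω)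
    refine this.congr_deriv ?_
    ring
  -- The coordinates of `(a, d / ω)` in the rotating frame are constant.
  have hf : ∀ t, HasDerivAt (fun t => a t * Real.cos (ω * t) - d t / ω * Real.sin (ω * t)) 0 t :=
    fun t => by
      refine (((ha t).mul (hc t)).sub (((hd t).div_const ω).mul (hs t))).congr_deriv ?_
      field_simp
      ring
  have hg : ∀ t, HasDerivAt (fun t => a t * Real.sin (ω * t) + d t / ω * Real.cos (ω * t)) 0 t :=
    fun t => by
      refine (((ha t).mul (hs t)).add (((hd t).div_const ω).mul (hc t))).congr_deriv ?_
      field_simp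
      ring
  have h1 := is_const_of_deriv_eq_zero (fun t => (hf t).differentiableAt)
    (fun t => (hf t).deriv) t 0
  have h2 := is_const_of_deriv_eq_zero (fun t => (hg t).differentiableAt)
    (fun t => (hg t).deriv) t 0
  simp only [mul_zero, Real.cos_zero, Real.sin_zero, mul_one, sub_zero, zero_add] at h1 h2
  rw [← h1, ← h2]
  linear_combination -(a t) * Real.sin_sq_add_cos_sq (ω * t)

/-- The Fourier coefficients of the initial velocity, in the normalization of `H⁻¹`. -/
noncomputable def velCoeff (u₁ : Hneg1 triangle) (j : ModeIdx) : ℝ := u₁ (eigVec j) / omega j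

theorem IsWaveSolution.inner_eigL2 {u₀ : L2 triangle} {u₁ : Hneg1 triangle}
    {u : ℝ → L2 triangle} (h : IsWaveSolution u₀ u₁ u) (j : ModeIdx) (t : ℝ) :
    inner ℝ (u t) (eigL2 j) = vib (fun j => inner ℝ u₀ (eigL2 j)) (velCoeff u₁) t j := by
  obtain ⟨-, h0, v, -, hv0, h1, h2⟩ := h
  have := eq_cos_add_sin_of_hasDerivAt (omega_pos j).ne' (h1 (eigVec j)) (fun t => by
    have := h2 (eigVec j) _ (hasDirichletLaplacian_eigVec j) t
    rwa [real_inner_smul_right] at this) t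
  rw [h0, hv0] at this
  exact this

/-! ### Observability for all solutions -/

theorem integral_strip_sq (α : ℝ) (f : L2 triangle) : ∫ p in stripRegion α, |f p| ^ 2 =
    ‖LpToLpRestrictCLM Plane ℝ ℝ (volume.restrict triangle) 2 (stripRegion α) f‖ ^ 2 := by
  have hm : (volume.restrict triangle).restrict (stripRegion α) =
      volume.restrict (stripRegion α) := by
    rw [Measure.restrict_restrict (measurableSet_stripRegion α),
      Set.inter_eq_left.2 (show stripRegion α ⊆ triangle from Set.sdiff_subset)]
  rw [L2_norm_sq, ← hm]
  refine integral_congr_ae ?_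
  filter_upwards [LpToLpRestrictCLM_coeFn ℝ (stripRegion α) f] with p hp
  rw [hp, Real.norm_eq_abs]

theorem continuous_integral_strip_sq (α : ℝ) :
    Continuous fun f : L2 triangle => ∫ p in stripRegion α, |f p| ^ 2 := by
  simp_rw [integral_strip_sq]
  fun_prop

theorem integral_strip_sq_le (α : ℝ) (f : L2 triangle) :
    ∫ p in stripRegion α, |f p| ^ 2 ≤ ‖f‖ ^ 2 := by
  rw [L2_norm_sq]
  refine setIntegral_mono_set (s := stripRegion α) (t := triangle) (f := fun p => |f p| ^ 2) ?_ ?_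
    (Filter.Eventually.of_forall Set.sdiff_subset)
  · exact (Lp.memLp f).integrable_norm_pow (p := 2) (by norm_num)
  · exact Filter.Eventually.of_forall fun p => by positivity

theorem integral_strip_eigSum (α : ℝ) (s : Finset ModeIdx) (f : L2 triangle) :
    ∫ p in stripRegion α, |eigSum s f p| ^ 2 =
      ∫ p in stripRegion α, modeSum s (fun j => inner ℝ f (eigL2 j) * eigScale) p ^ 2 := by
  have h1 : eigSum s f =ᵐ[volume.restrict triangle]
      modeSum s (fun j => inner ℝ f (eigL2 j) * eigScale) := by
    have h2 : ∀ᵐ p ∂volume.restrict triangle, ∀ j ∈ s,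
        (inner ℝ f (eigL2 j) • eigL2 j : L2 triangle) p =
          inner ℝ f (eigL2 j) * eigScale * modeOf j p := by
      refine (Finset.eventually_all s).2 fun j _ => ?_
      filter_upwards [Lp.coeFn_smul (inner ℝ f (eigL2 j)) (eigL2 j), coeFn_eigL2 j] with p h3 h4
      rw [h3, Pi.smul_apply, h4, smul_eq_mul, mul_assoc]
    filter_upwards [Lp.coeFn_finsetSum s fun j => inner ℝ f (eigL2 j) • eigL2 j, h2] with p h3 h4
    rw [eigSum, h3, Finset.sum_apply, modeSum]
    exact Finset.sum_congr rfl h4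
  refine integral_congr_ae ?_
  filter_upwards [ae_restrict_of_ae_restrict_of_subset Set.sdiff_subset h1] with p hp
  rw [hp, sq_abs]

/-- Observability in terms of Fourier coefficients, by passing to the limit in the finite sums. -/
theorem observability_coeff {α T : ℝ} (hα₀ : 0 < α) (hα₁ : α ≤ 1 / (3 + √3)) (hT : 0 < T)
    (hT' : 100 ≤ T ^ 2) (hc : 0 ≤ obsConst α T) {u₀ : L2 triangle} {u₁ : Hneg1 triangle}
    {u : ℝ → L2 triangle} (h : IsWaveSolution u₀ u₁ u) (s : Finset ModeIdx) :
    obsConst α T * ∑ j ∈ s, (inner ℝ u₀ (eigL2 j) ^ 2 + velCoeff u₁ j ^ 2) ≤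
      ∫ t in (0 : ℝ)..T, ∫ p in stripRegion α, |u t p| ^ 2 := by
  have hu : Continuous u := h.1
  have hcont : ∀ s, Continuous fun t => ∫ p in stripRegion α, |eigSum s (u t) p| ^ 2 := fun s =>
    (continuous_integral_strip_sq α).comp (by unfold eigSum; fun_prop)
  have hlim : Filter.Tendsto
      (fun s => ∫ t in (0 : ℝ)..T, ∫ p in stripRegion α, |eigSum s (u t) p| ^ 2) Filter.atTop
      (nhds (∫ t in (0 : ℝ)..T, ∫ p in stripRegion α, |u t p| ^ 2)) := by
    refine intervalIntegral.tendsto_integral_filter_of_dominated_convergence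
      (fun t => ‖u t‖ ^ 2) (Filter.Eventually.of_forall fun s => (hcont s).aestronglyMeasurable)
      (Filter.Eventually.of_forall fun s => Filter.Eventually.of_forall fun t _ => ?_)
      ((hu.norm.pow 2).intervalIntegrable _ _)
      (Filter.Eventually.of_forall fun t _ => ?_)
    · rw [Real.norm_eq_abs, abs_of_nonneg (integral_nonneg fun p => by positivity)]
      exact (integral_strip_sq_le α _).trans (norm_eigSum_sq_le s _)
    · exact ((continuous_integral_strip_sq α).tendsto (u t)).comp (tendsto_eigSum (u t))
  refine ge_of_tendsto hlim ?_
  filter_upwards [Filter.eventually_ge_atTop s] with s' hs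
  have h1 := observability_finite hα₀ hα₁ hT hT' s'
    (fun j => inner ℝ u₀ (eigL2 j) * eigScale) (fun j => velCoeff u₁ j * eigScale)
  calc obsConst α T * ∑ j ∈ s, (inner ℝ u₀ (eigL2 j) ^ 2 + velCoeff u₁ j ^ 2)
      ≤ obsConst α T * ∑ j ∈ s', (inner ℝ u₀ (eigL2 j) ^ 2 + velCoeff u₁ j ^ 2) := by
        refine mul_le_mul_of_nonneg_left (Finset.sum_le_sum_of_subset_of_nonneg hs ?_) hc
        intro j _ _
        positivity
    _ = obsConst α T * (√3 / 8) * ∑ j ∈ s', ((inner ℝ u₀ (eigL2 j) * eigScale) ^ 2 +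
          (velCoeff u₁ j * eigScale) ^ 2) := by
        simp_rw [mul_pow, ← add_mul]
        rw [← Finset.sum_mul]
        linear_combination -(obsConst α T *
          ∑ j ∈ s', (inner ℝ u₀ (eigL2 j) ^ 2 + velCoeff u₁ j ^ 2)) * eigScale_sq
    _ ≤ _ := h1
    _ = _ := by
        refine intervalIntegral.integral_congr fun t _ => ?_
        have e : (fun j => inner ℝ (u t) (eigL2 j) * eigScale) =
            vib (fun j => inner ℝ u₀ (eigL2 j) * eigScale) (fun j => velCoeff u₁ j * eigScale) t := by
          funext j
          rw [h.inner_eigL2]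
          simp only [vib]
          ring
        simp only [integral_strip_eigSum, e]

/-! ### The norm of `H⁻¹` -/

/-- The partial sums of the eigenfunction expansion in `H¹₀`. -/
noncomputable def eigSumH10 (s : Finset ModeIdx) (f : H10 triangle) : H10 triangle :=
  ∑ j ∈ s, inner ℝ (H10.toL2 f) (eigL2 j) • eigVec j

theorem toL2_eigSumH10 (s : Finset ModeIdx) (f : H10 triangle) :
    H10.toL2 (eigSumH10 s f) = eigSum s (H10.toL2 f) := by
  change H10.toL2L triangle (∑ j ∈ s, inner ℝ (H10.toL2 f) (eigL2 j) • eigVec j) = _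
  rw [map_sum]
  simp_rw [map_smul]
  rfl

theorem inner_grad_eigVec (j : ModeIdx) (f : H10 triangle) :
    inner ℝ (H10.grad (eigVec j)) (H10.grad f) = omega j ^ 2 * inner ℝ (H10.toL2 f) (eigL2 j) := by
  rw [hasDirichletLaplacian_eigVec j f, real_inner_smul_left, real_inner_comm]
  ring

theorem inner_grad_eigSumH10 (s : Finset ModeIdx) (f g : H10 triangle) :
    inner ℝ (H10.grad (eigSumH10 s f)) (H10.grad g) =
      ∑ j ∈ s, omega j ^ 2 * (inner ℝ (H10.toL2 f) (eigL2 j) * inner ℝ (H10.toL2 g) (eigL2 j)) := by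
  change inner ℝ (H10.gradL triangle (∑ j ∈ s, inner ℝ (H10.toL2 f) (eigL2 j) • eigVec j)) _ = _
  rw [map_sum, sum_inner]
  refine Finset.sum_congr rfl fun j _ => ?_
  rw [map_smul, real_inner_smul_left]
  change _ * inner ℝ (H10.grad (eigVec j)) (H10.grad g) = _
  rw [inner_grad_eigVec]
  ring

theorem inner_toL2_eigSumH10 {s : Finset ModeIdx} (f : H10 triangle) {j : ModeIdx} (hj : j ∈ s) :
    inner ℝ (H10.toL2 (eigSumH10 s f)) (eigL2 j) = inner ℝ (H10.toL2 f) (eigL2 j) := by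
  rw [toL2_eigSumH10, eigSum, orthonormal_eigL2.inner_left_sum _ hj]
  simp

theorem norm_grad_eigSumH10_sq (s : Finset ModeIdx) (f : H10 triangle) :
    ‖H10.grad (eigSumH10 s f)‖ ^ 2 =
      ∑ j ∈ s, omega j ^ 2 * inner ℝ (H10.toL2 f) (eigL2 j) ^ 2 := by
  rw [← real_inner_self_eq_norm_sq, inner_grad_eigSumH10]
  refine Finset.sum_congr rfl fun j hj => ?_
  rw [inner_toL2_eigSumH10 f hj, pow_two (inner ℝ _ _)]

theorem inner_grad_eigSumH10_self (s : Finset ModeIdx) (f : H10 triangle) :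
    inner ℝ (H10.grad (eigSumH10 s f)) (H10.grad f) = ‖H10.grad (eigSumH10 s f)‖ ^ 2 := by
  rw [norm_grad_eigSumH10_sq, inner_grad_eigSumH10]
  simp_rw [← pow_two]

theorem norm_grad_eigSumH10_le (s : Finset ModeIdx) (f : H10 triangle) :
    ‖H10.grad (eigSumH10 s f)‖ ≤ ‖H10.grad f‖ := by
  have h := real_inner_le_norm (H10.grad (eigSumH10 s f)) (H10.grad f)
  rw [inner_grad_eigSumH10_self, pow_two] at h
  rcases (norm_nonneg (H10.grad (eigSumH10 s f))).eq_or_lt with h0 | h0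
  · rw [← h0]; exact norm_nonneg _
  · exact le_of_mul_le_mul_left h h0

/-- On the domain of the Dirichlet Laplacian the eigenfunction expansion converges in `H¹₀`. -/
theorem tendsto_eigSumH10 {f : H10 triangle} {g : L2 triangle} (h : HasDirichletLaplacian f g) :
    Filter.Tendsto (fun s => eigSumH10 s f) Filter.atTop (nhds f) := by
  have h1 : Filter.Tendsto (fun s => H10.toL2 (eigSumH10 s f)) Filter.atTop
      (nhds (H10.toL2 f)) := by
    simp_rw [toL2_eigSumH10]
    exact tendsto_eigSum _
  have h2 : Filter.Tendsto (fun s => H10.grad (eigSumH10 s f)) Filter.atTop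
      (nhds (H10.grad f)) := by
    rw [tendsto_iff_norm_sub_tendsto_zero]
    have hsq : ∀ s, ‖H10.grad (eigSumH10 s f) - H10.grad f‖ ^ 2 =
        inner ℝ g (H10.toL2 (eigSumH10 s f) - H10.toL2 f) := by
      intro s
      have e1 := h (eigSumH10 s f)
      have e2 := h f
      have e3 := inner_grad_eigSumH10_self s f
      rw [real_inner_self_eq_norm_sq] at e2
      rw [real_inner_comm] at e1
      rw [norm_sub_sq_real, inner_sub_right]
      linarith
    have h3 : Filter.Tendsto (fun s => inner ℝ g (H10.toL2 (eigSumH10 s f) - H10.toL2 f))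
        Filter.atTop (nhds 0) := by
      have := (tendsto_const_nhds (x := g)).inner (𝕜 := ℝ) (h1.sub_const (H10.toL2 f))
      rwa [sub_self, inner_zero_right] at this
    have h4 := (Real.continuous_sqrt.tendsto 0).comp h3
    rw [Real.sqrt_zero] at h4
    refine h4.congr fun s => ?_
    rw [Function.comp_apply, ← hsq, Real.sqrt_sq (norm_nonneg _)]
  exact tendsto_subtype_rng.2 (h1.prodMk_nhds h2)

/-- The domain of the Dirichlet Laplacian is dense in `H¹₀`: it contains the test functions. -/
theorem exists_seq_hasDirichletLaplacian (f : H10 triangle) :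
    ∃ x : ℕ → H10 triangle, (∀ n, ∃ g, HasDirichletLaplacian (x n) g) ∧
      Filter.Tendsto x Filter.atTop (nhds f) := by
  have hspan : ∀ z ∈ Submodule.span ℝ (testPairs triangle),
      ∃ w : H10 triangle, (w : L2 triangle × L2Vec triangle) = z ∧
        ∃ g, HasDirichletLaplacian w g := by
    intro z hz
    induction hz using Submodule.span_induction with
    | mem z hz =>
      obtain ⟨φ, hφ, -, -, -, h⟩ := id hz
      exact ⟨⟨z, Submodule.le_topologicalClosure _ (Submodule.subset_span hz)⟩, rfl,
        contL2 (lap φ) (continuous_lap hφ), hasDirichletLaplacian_of_smooth hφ _ h _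
          (coeFn_contL2 _ (continuous_lap hφ))⟩
    | zero =>
      refine ⟨0, rfl, 0, fun ψ => ?_⟩
      change inner ℝ (0 : L2Vec triangle) _ = _
      rw [inner_zero_left, inner_zero_left, neg_zero]
    | add _ _ _ _ hz hw =>
      obtain ⟨z, rfl, g, hg⟩ := hz
      obtain ⟨w, rfl, k, hk⟩ := hw
      exact ⟨z + w, rfl, g + k, hg.add hk⟩
    | smul c _ _ hz =>
      obtain ⟨z, rfl, g, hg⟩ := hz
      exact ⟨c • z, rfl, c • g, hg.smul c⟩
  obtain ⟨x, hx, hlim⟩ := mem_closure_iff_seq_limit.1 f.2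
  choose y hy1 hy2 using fun n => hspan (x n) (hx n)
  refine ⟨y, hy2, tendsto_subtype_rng.2 ?_⟩
  simpa only [hy1] using hlim

/-- Parseval's inequality for the norm of `H⁻¹`. -/
theorem dualNorm_sq_le {u₁ : Hneg1 triangle} {E : ℝ}
    (hE : ∀ s : Finset ModeIdx, ∑ j ∈ s, velCoeff u₁ j ^ 2 ≤ E) : Hneg1.dualNorm u₁ ^ 2 ≤ E := by
  have hE0 : 0 ≤ E := by simpa using hE ∅
  have h1 : ∀ (s : Finset ModeIdx) (f : H10 triangle), |u₁ (eigSumH10 s f)| ≤ √E * ‖H10.grad f‖ := by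
    intro s f
    have e : u₁ (eigSumH10 s f) =
        ∑ j ∈ s, velCoeff u₁ j * (omega j * inner ℝ (H10.toL2 f) (eigL2 j)) := by
      rw [eigSumH10, map_sum]
      refine Finset.sum_congr rfl fun j _ => ?_
      have := (omega_pos j).ne'
      rw [map_smul, velCoeff, smul_eq_mul]
      field_simp
    have h2 := Finset.sum_mul_sq_le_sq_mul_sq s (velCoeff u₁)
      (fun j => omega j * inner ℝ (H10.toL2 f) (eigL2 j))
    simp_rw [mul_pow] at h2
    rw [← e, ← norm_grad_eigSumH10_sq] at h2
    refine abs_le_of_sq_le_sq ?_ (by positivity)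
    rw [mul_pow, Real.sq_sqrt hE0]
    refine h2.trans (mul_le_mul (hE s) ?_ (by positivity) hE0)
    have := norm_grad_eigSumH10_le s f
    gcongr
  have h2 : ∀ (f : H10 triangle) (g : L2 triangle), HasDirichletLaplacian f g →
      |u₁ f| ≤ √E * ‖H10.grad f‖ := fun f g h =>
    le_of_tendsto ((u₁.continuous.tendsto f).comp (tendsto_eigSumH10 h)).abs
      (Filter.Eventually.of_forall fun s => h1 s f)
  have h3 : ∀ f : H10 triangle, |u₁ f| ≤ √E * ‖H10.grad f‖ := by
    intro f
    obtain ⟨x, hx, hlim⟩ := exists_seq_hasDirichletLaplacian f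
    refine le_of_tendsto_of_tendsto' ((u₁.continuous.tendsto f).comp hlim).abs
      (((((H10.gradL triangle).continuous.tendsto f).comp hlim).norm).const_mul √E) fun n => ?_
    obtain ⟨g, hg⟩ := hx n
    exact h2 _ g hg
  have h4 : Hneg1.dualNorm u₁ ≤ √E := csInf_le ⟨0, fun C hC => hC.1⟩ ⟨Real.sqrt_nonneg _, h3⟩
  have h5 : 0 ≤ Hneg1.dualNorm u₁ := Real.sInf_nonneg fun C hC => hC.1
  calc Hneg1.dualNorm u₁ ^ 2 ≤ √E ^ 2 := by gcongr
    _ = E := Real.sq_sqrt hE0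

theorem theorem1p2 (α : ℝ) (hα₀ : 0 < α) (hα₁ : α ≤ 1 / (3 + √3)) (T : ℝ) (hT : obsTime α < T) :
    0 < obsConst α T ∧
    ∀ (u₀ : L2 triangle) (u₁ : Hneg1 triangle) (u : ℝ → L2 triangle),
      IsWaveSolution u₀ u₁ u →
        ‖u₀‖ ^ 2 + Hneg1.dualNorm u₁ ^ 2 ≤
          1 / obsConst α T * ∫ t in (0 : ℝ)..T, ∫ x in stripRegion α, |u t x| ^ 2 := by
  obtain ⟨hT0, hT1, hc⟩ := obsTime_bounds hα₀ hα₁ hT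
  refine ⟨hc, fun u₀ u₁ u h => ?_⟩
  set D := 1 / obsConst α T * ∫ t in (0 : ℝ)..T, ∫ x in stripRegion α, |u t x| ^ 2 with hD
  have h1 : ∀ s : Finset ModeIdx,
      ∑ j ∈ s, (inner ℝ u₀ (eigL2 j) ^ 2 + velCoeff u₁ j ^ 2) ≤ D := by
    intro s
    rw [hD, one_div, inv_mul_eq_div, le_div_iff₀ hc, mul_comm]
    exact observability_coeff hα₀ hα₁ hT0 hT1 hc.le h s
  have h2 : ∀ s : Finset ModeIdx, ‖u₀‖ ^ 2 + ∑ j ∈ s, velCoeff u₁ j ^ 2 ≤ D := by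
    intro s
    refine le_of_tendsto (((tendsto_eigSum u₀).norm.pow 2).add_const _) ?_
    filter_upwards [Filter.eventually_ge_atTop s] with s' hs
    refine le_trans ?_ (h1 s')
    rw [norm_eigSum_sq, Finset.sum_add_distrib]
    gcongr
  have h3 : Hneg1.dualNorm u₁ ^ 2 ≤ D - ‖u₀‖ ^ 2 :=
    dualNorm_sq_le fun s => by linarith [h2 s]
  linarith
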